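/- Notation. For $f\in\mathcal S'(\mathbb R^3)$ let $\hat f$ be the Fourier transform normalized by $\hat f(\xi)=\int_{\mathbb R^3}e^{-ix\cdot\xi}f(x)\,dx$. For $a>0$, $\sigma>1$, $\rho\in\mathbb R$ let $Z^\rho_{a,\sigma}(\mathbb R^3)$ be the space of tempered distributions $f$ (here vector fields) such that $\hat f$ is a locally integrable function and $$\|f\|_{Z^\rho_{a,\sigma}}=\int_{\mathbb R^3}|\xi|^\rho e^{a|\xi|^{1/\sigma}}|\hat f(\xi)|\,d\xi<\infty ,$$ where $|\hat f(\xi)|$ is the Hermitian norm in $\mathbb C^3$. For $\nu>0$ consider the incompressible Navier–Stokes equations $$(NSE)\qquad \partial_tu-\nu\Delta u+u\cdot\nabla u=-\nabla p,\qquad \operatorname{div}u=0\quad\text{in }\mathbb R^+\times\mathbb R^3,\qquad u(0)=u^0,$$ for real vector fields $u$. The momentum equation is understood in the sense of distributions on $(0,\infty)\times\mathbb R^3$, with $u\cdot\nabla u=\operatorname{div}(u\otimes u)$ and some real distribution $p$ as pressure. Theorem. Let $\nu>0$, $a>0$, $\sigma>1$, and let $u^0\in Z^{-1}_{a,\sigma}(\mathbb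 R^3)$ be a real, divergence-free vector field with $\|u^0\|_{Z^{-1}_{a,\sigma}}<\nu$. Then $(NSE)$ has a unique global solution $u$ in $\mathcal C(\mathbb R^+,Z^{-1}_{a,\sigma}(\mathbb R^3))\cap L^1(\mathbb R^+,Z^{1}_{a,\sigma}(\mathbb R^3))$, where $\mathbb R^+=[0,\infty)$, and for all $t\ge 0$ $$\|u(t)\|_{Z^{-1}_{a,\sigma}}+\frac{\nu-\|u^0\|_{Z^{-1}_{a,\sigma}}}{2}\int_0^t\|\Delta u(\tau)\|_{Z^{-1}_{a,\sigma}}\,d\tau\le\|u^0\|_{Z^{-1}_{a,\sigma}} .$$ -/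

import Mathlib

open MeasureTheory Set Filter Topology TopologicalSpace
open scoped ENNReal FourierTransform SchwartzMap Distributions LineDeriv Laplacian

namespace LeiLinGevrey

/-- The physical (and frequency) space `ℝ³` with its Euclidean norm. -/
abbrev R3 : Type := EuclideanSpace ℝ (Fin 3)

/-- `ℂ³` with its Hermitian norm: the value space of Fourier transforms of vector fields. -/
abbrev C3 : Type := EuclideanSpace ℂ (Fin 3)

/-- The `i`-th vector of the standard basis of `ℝ³`. -/
noncomputable def basisVec (i : Fin 3) : R3 := EuclideanSpace.single i 1

/-! ### The Fourier transform `f̂(ξ) = ∫ exp(-i x·ξ) f(x) dx` -/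

/-- The dilation `x ↦ (2π)⁻¹ x` of `ℝ³`. -/
noncomputable def dilation : R3 ≃L[ℝ] R3 :=
  ContinuousLinearEquiv.smulLeft (Units.mk0 ((2 * Real.pi)⁻¹ : ℝ) (by positivity))

/-- The Fourier transform on Schwartz functions, with kernel `exp(-i x·ξ)` and no constant in
front (Mathlib's `𝓕` has the kernel `exp(-2π i x·ξ)`). See `schwartzFourier_apply`. -/
noncomputable def schwartzFourier : 𝓢(R3, ℂ) →L[ℂ] 𝓢(R3, ℂ) :=
  (SchwartzMap.compCLMOfContinuousLinearEquiv ℂ dilation) ∘L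
    (FourierTransform.fourierCLM ℂ 𝓢(R3, ℂ))

theorem schwartzFourier_apply (φ : 𝓢(R3, ℂ)) (ξ : R3) :
    schwartzFourier φ ξ = ∫ x, Complex.exp (-(Complex.I * (inner ℝ x ξ : ℝ))) * φ x := by
  have h : schwartzFourier φ ξ = 𝓕 (φ : R3 → ℂ) ((2 * Real.pi)⁻¹ • ξ) := rfl
  rw [h, Real.fourier_eq']
  refine integral_congr_ae (Eventually.of_forall fun x => ?_)
  simp only [smul_eq_mul, inner_smul_right]
  congr 2
  have hpi : (Real.pi : ℂ) ≠ 0 := by exact_mod_cast Real.pi_ne_zero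
  push_cast
  field_simp

/-- The Fourier transform of a tempered distribution, `⟨f̂, φ⟩ = ⟨f, φ̂⟩`. -/
noncomputable def fourierDist (f : 𝓢'(R3, C3)) : 𝓢'(R3, C3) :=
  PointwiseConvergenceCLM.precomp C3 schwartzFourier f

/-- The tempered distribution `f` is (integration against) the function `g`. The integrability
clause forces `g` to be a.e.-strongly measurable and locally integrable, because Schwartz functions
without zeros exist; such a `g` is determined by `f` almost everywhere. -/
def IsRepresentedBy (f : 𝓢'(R3, C3)) (g : R3 → C3) : Prop :=
  ∀ φ : 𝓢(R3, ℂ), Integrable (fun x => φ x • g x) ∧ f φ = ∫ x, φ x • g x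

/-! ### The Lei-Lin-Gevrey spaces -/

/-- The norm `‖f‖ = ∫ |ξ|^ρ exp(a |ξ|^(1/σ)) |f̂(ξ)| dξ` of `Z^ρ_{a,σ}(ℝ³)`, with values in
`[0, ∞]`. It is the value of the integral at the a.e.-unique function representing `f̂`, and it
is `∞` if `f̂` is not a function. -/
noncomputable def zNorm (ρ a σ : ℝ) (f : 𝓢'(R3, C3)) : ℝ≥0∞ :=
  ⨅ (g : R3 → C3) (_ : IsRepresentedBy (fourierDist f) g),
    ∫⁻ ξ, ENNReal.ofReal (‖ξ‖ ^ ρ * Real.exp (a * ‖ξ‖ ^ (1 / σ))) * ‖g ξ‖ₑ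

/-- Membership in `Z^ρ_{a,σ}(ℝ³)` (vector fields). -/
def MemZ (ρ a σ : ℝ) (f : 𝓢'(R3, C3)) : Prop := zNorm ρ a σ f < ∞

/-- `u ∈ C(ℝ⁺, Z^ρ_{a,σ}(ℝ³))`, where `ℝ⁺ = [0, ∞)`; the values `u t` for `t < 0` are
irrelevant. -/
def MemCZ (ρ a σ : ℝ) (u : ℝ → 𝓢'(R3, C3)) : Prop :=
  (∀ t, 0 ≤ t → MemZ ρ a σ (u t)) ∧
    ∀ t, 0 ≤ t → Tendsto (fun s => zNorm ρ a σ (u s - u t)) (𝓝[Ici 0] t) (𝓝 0)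

/-- `u ∈ L¹(ℝ⁺, Z^ρ_{a,σ}(ℝ³))`: almost all values lie in the space, the norm is integrable, and
`u` is measurable. As `Z^ρ_{a,σ}` is separable, strong measurability says precisely that the
distances of `u` to the points of the space are measurable functions of time. -/
def MemL1Z (ρ a σ : ℝ) (u : ℝ → 𝓢'(R3, C3)) : Prop :=
  (∀ᵐ t ∂(volume.restrict (Ici (0 : ℝ))), MemZ ρ a σ (u t)) ∧
    (∀ f, MemZ ρ a σ f →
      AEMeasurable (fun t => zNorm ρ a σ (u t - f)) (volume.restrict (Ici (0 : ℝ)))) ∧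
    ∫⁻ t in Ici (0 : ℝ), zNorm ρ a σ (u t) < ∞

/-! ### The Navier-Stokes equations -/

/-- The complexification of a real vector. -/
noncomputable def toC3 (x : R3) : C3 := WithLp.toLp 2 fun i => (x i : ℂ)

/-- A tempered distribution is real (an `ℝ³`-valued one) if it takes real values on real-valued
test functions. -/
def IsRealDist (f : 𝓢'(R3, C3)) : Prop :=
  ∀ φ : 𝓢(R3, ℂ), (∀ x, (φ x).im = 0) → ∀ i, (f φ i).im = 0

/-- `div f = 0` in the sense of tempered distributions. -/
def IsDivFree (f : 𝓢'(R3, C3)) : Prop :=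
  ∀ φ : 𝓢(R3, ℂ), ∑ i : Fin 3, ((∂_{basisVec i} f : 𝓢'(R3, C3)) φ) i = 0

/-- The open space-time domain `(0, ∞) × ℝ³`. -/
def spaceTime : Opens (ℝ × R3) := ⟨Ioi 0 ×ˢ univ, isOpen_Ioi.prod isOpen_univ⟩

/-- The unit vector of `ℝ × ℝ³` in the time direction. -/
def timeDir : ℝ × R3 := (1, 0)

/-- The `i`-th unit vector of `ℝ × ℝ³` in the space directions. -/
noncomputable def spaceDir (i : Fin 3) : ℝ × R3 := (0, basisVec i)

/-- The distribution `φ ↦ ∫ φ h` on `(0, ∞) × ℝ³` given by a locally integrable function `h`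
(it is only used for such `h`). -/
noncomputable def regularDist (h : ℝ × R3 → ℝ) : 𝓓'(spaceTime, ℝ) :=
  ContinuousLinearMap.toUniformConvergenceCLM _ _ _
    (TestFunction.integralAgainstBilinCLM (ContinuousLinearMap.mul ℝ ℝ) volume h)

theorem regularDist_apply {h : ℝ × R3 → ℝ} (hh : LocallyIntegrableOn h spaceTime)
    (φ : 𝓓(spaceTime, ℝ)) : regularDist h φ = ∫ z, φ z * h z := by
  change TestFunction.integralAgainstBilinCLM (ContinuousLinearMap.mul ℝ ℝ) volume h φ = _
  rw [TestFunction.integralAgainstBilinCLM_eq_integral hh]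
  rfl

/-- `v` solves `∂ₜ v - ν Δ v + div (v ⊗ v) = -∇ p` in the sense of distributions on
`(0, ∞) × ℝ³`, where `div (v ⊗ v) = (∑ⱼ ∂ⱼ (vⱼ vᵢ))ᵢ` is `v · ∇ v` for divergence-free `v`. -/
def SolvesMomentum (ν : ℝ) (v : ℝ → R3 → R3) (p : 𝓓'(spaceTime, ℝ)) : Prop :=
  (∀ i, LocallyIntegrableOn (fun z : ℝ × R3 => v z.1 z.2 i) spaceTime) ∧
  (∀ i j, LocallyIntegrableOn (fun z : ℝ × R3 => v z.1 z.2 j * v z.1 z.2 i) spaceTime) ∧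
  ∀ i : Fin 3,
    ∂_{timeDir} (regularDist fun z => v z.1 z.2 i)
      - ν • ∑ j : Fin 3, ∂_{spaceDir j} (∂_{spaceDir j} (regularDist fun z => v z.1 z.2 i))
      + ∑ j : Fin 3, ∂_{spaceDir j} (regularDist fun z => v z.1 z.2 j * v z.1 z.2 i)
      = -∂_{spaceDir i} p

/-- `u` is a global solution of the Navier-Stokes equations with viscosity `ν` and initial velocity
`u₀`: `u 0 = u₀`, `div u = 0`, and `u` is given by a real velocity field `v` which satisfies the
momentum equation with some pressure `p`. -/
structure IsNSESolution (ν : ℝ) (u₀ : 𝓢'(R3, C3)) (u : ℝ → 𝓢'(R3, C3)) : Prop where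
  initial : u 0 = u₀
  divFree : ∀ t, 0 ≤ t → IsDivFree (u t)
  momentum : ∃ (v : ℝ → R3 → R3) (p : 𝓓'(spaceTime, ℝ)),
    (∀ t, 0 ≤ t → IsRepresentedBy (u t) (fun x => toC3 (v t x))) ∧ SolvesMomentum ν v p

end LeiLinGevrey

/-! On the Fourier side the equation becomes, frequency by frequency, ∂ₜû = -ν|ξ|²û + N(û,û), where
N is -i(2π)⁻³ times the Leray projection of a convolution. Two estimates carry the existence part.

The bilinear estimate is `lintegral_nlinMaj_le`. The factor |ξ| coming from the divergence cancels
the weight |ξ|⁻¹. The remaining weight exp(a|ξ|^(1/σ)) is submultiplicative, because r ↦ r^(1/σ) is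
subadditive for σ > 1, so it distributes over the convolution. Finally 1 ≤ x + x⁻¹ with x =
ε|η|/|ξ-η| turns the product of two norms of order 0 into ε‖f‖₁‖g‖₋₁ + ε⁻¹‖f‖₋₁‖g‖₁.

The linear estimate is `zInt_add_integral_le`. The scalar majorant y of Duhamel's formula satisfies
y(t) + λ∫y = y₀ + ∫n exactly (`duhMajorant_add`). With λ = ν|ξ|² and the weight of order -1, the
damping term is ν times the L¹ norm in time with values in Z¹.

Write m for the norm of the initial velocity. Since (2π)⁻³ ≤ 1/16, the Picard map preserves the ball
of radius 2m and halves distances there whenever m ≤ ν (`SizeLE.picardMap_two`,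
`SizeLE.picardMap_sub`). On its fixed point the quadratic term costs at most (m/4)∫‖u‖₁, and ν - m/4
≥ (ν-m)/2, which is the stated inequality because ‖Δu‖₋₁ = ‖u‖₁. The Gevrey weight dominates all
powers of |ξ|, so all Fourier transforms are integrable and one returns to a bounded real velocity
and a bounded pressure by absolutely convergent inverse Fourier integrals
(`solvesMomentum_of_integral_eq`).

For uniqueness, an arbitrary solution has a pressure about which nothing is known. It is removed by
taking the curl. If R is the difference between û and û(0) plus the time integral of its expected
derivative, the weak equation says that the curl of R has zero time derivative in the sense of
distributions. The lemma of du Bois-Reymond makes this curl vanish, so the Leray projection of R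
vanishes. As R is also divergence-free, R = 0 (`integral_eq_of_solvesMomentum`). Two solutions of
the integral equation are then compared directly. A small ε in the bilinear estimate lets the
dissipation absorb the Z¹ norm of the difference, and a Gronwall argument with an integrable weight
concludes (`zInt_sub_eq_zero`). No smallness enters this comparison. -/

namespace LeiLinGevrey

/-! ### The Gevrey weights -/

/-- The weight `|ξ|^ρ exp(a |ξ|^(1/σ))`. -/
noncomputable def wt (ρ a σ : ℝ) (ξ : R3) : ℝ≥0∞ :=
  ENNReal.ofReal (‖ξ‖ ^ ρ * Real.exp (a * ‖ξ‖ ^ (1 / σ)))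

/-- The weighted `L¹` norm `∫ |ξ|^ρ exp(a |ξ|^(1/σ)) |g(ξ)| dξ`. -/
noncomputable def zInt (ρ a σ : ℝ) (g : R3 → C3) : ℝ≥0∞ := ∫⁻ ξ, wt ρ a σ ξ * ‖g ξ‖ₑ

theorem measurable_wt (ρ a σ : ℝ) : Measurable (wt ρ a σ) := by
  unfold wt
  fun_prop

theorem wt_ne_top (ρ a σ : ℝ) (ξ : R3) : wt ρ a σ ξ ≠ ∞ := ENNReal.ofReal_ne_top

theorem wt_ne_zero (ρ a σ : ℝ) {ξ : R3} (hξ : ξ ≠ 0) : wt ρ a σ ξ ≠ 0 := by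
  have : 0 < ‖ξ‖ := norm_pos_iff.2 hξ
  have : 0 < ‖ξ‖ ^ ρ * Real.exp (a * ‖ξ‖ ^ (1 / σ)) := by positivity
  simpa [wt] using this

theorem ae_ne_zero : ∀ᵐ ξ : R3, ξ ≠ 0 := by
  simp [ae_iff, measure_singleton]

/-- Subadditivity of r ↦ r^(1/σ), which needs 1/σ ≤ 1, makes the Gevrey weight submultiplicative.
This is why it passes through convolutions at no cost. -/
theorem exp_weight_le {a σ : ℝ} (ha : 0 < a) (hσ : 1 < σ) (ξ η : R3) :
    Real.exp (a * ‖ξ + η‖ ^ (1 / σ)) ≤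
      Real.exp (a * ‖ξ‖ ^ (1 / σ)) * Real.exp (a * ‖η‖ ^ (1 / σ)) := by
  rw [← Real.exp_add, ← mul_add]
  refine Real.exp_le_exp.2 (mul_le_mul_of_nonneg_left ?_ ha.le)
  have h1 : 0 ≤ 1 / σ := by positivity
  have h2 : 1 / σ ≤ 1 := by
    rw [div_le_one (by linarith)]
    exact hσ.le
  refine (Real.rpow_le_rpow (norm_nonneg _) (norm_add_le _ _) h1).trans ?_
  exact Real.rpow_add_le_add_rpow (norm_nonneg _) (norm_nonneg _) h1 h2

/-- The derivative in the quadratic term is paid for by the negative order of the weight. Equality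
fails only at the origin, where the left side is 0 and the right side is 1. -/
theorem wt_neg_one_mul_norm_le (a σ : ℝ) (ξ : R3) :
    wt (-1) a σ ξ * ENNReal.ofReal ‖ξ‖ ≤ wt 0 a σ ξ := by
  rw [wt, wt, ← ENNReal.ofReal_mul (by positivity)]
  refine ENNReal.ofReal_le_ofReal ?_
  rcases eq_or_ne ξ 0 with rfl | hξ
  · simp
    positivity
  · have h : 0 < ‖ξ‖ := norm_pos_iff.2 hξ
    rw [Real.rpow_neg_one, Real.rpow_zero]
    field_simp
    exact le_rfl

theorem wt_zero_add_le {a σ : ℝ} (ha : 0 < a) (hσ : 1 < σ) (ξ η : R3) :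
    wt 0 a σ (ξ + η) ≤ wt 0 a σ ξ * wt 0 a σ η := by
  simp only [wt, Real.rpow_zero, one_mul]
  rw [← ENNReal.ofReal_mul (by positivity)]
  exact ENNReal.ofReal_le_ofReal (exp_weight_le ha hσ ξ η)

/-- This is the symbol form of ‖Δf‖₋₁ = ‖f‖₁. It is exact even at the origin, where both sides
vanish. -/
theorem wt_neg_one_mul_sq (a σ : ℝ) (ξ : R3) :
    wt (-1) a σ ξ * ENNReal.ofReal (‖ξ‖ ^ 2) = wt 1 a σ ξ := by
  rw [wt, wt, ← ENNReal.ofReal_mul (by positivity)]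
  congr 1
  rcases eq_or_ne ξ 0 with rfl | hξ
  · simp
  · have h : 0 < ‖ξ‖ := norm_pos_iff.2 hξ
    rw [Real.rpow_neg_one, Real.rpow_one]
    field_simp

/-- A pointwise substitute for the interpolation inequality `‖f‖₀² ≤ ‖f‖₋₁ ‖f‖₁`. -/
theorem wt_zero_mul_le (a σ : ℝ) {ε : ℝ} (hε : 0 < ε) {ξ η : R3} (hξ : ξ ≠ 0) (hη : η ≠ 0) :
    wt 0 a σ ξ * wt 0 a σ η ≤
      ENNReal.ofReal ε * (wt 1 a σ ξ * wt (-1) a σ η)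
        + ENNReal.ofReal ε⁻¹ * (wt (-1) a σ ξ * wt 1 a σ η) := by
  have h : 0 < ‖ξ‖ := norm_pos_iff.2 hξ
  have h' : 0 < ‖η‖ := norm_pos_iff.2 hη
  simp only [wt]
  rw [← ENNReal.ofReal_mul (by positivity), ← ENNReal.ofReal_mul (by positivity),
    ← ENNReal.ofReal_mul (by positivity), ← ENNReal.ofReal_mul (by positivity),
    ← ENNReal.ofReal_mul (by positivity), ← ENNReal.ofReal_add (by positivity) (by positivity)]
  refine ENNReal.ofReal_le_ofReal ?_
  simp only [Real.rpow_neg_one, Real.rpow_one, Real.rpow_zero]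
  set A := Real.exp (a * ‖ξ‖ ^ (1 / σ))
  set B := Real.exp (a * ‖η‖ ^ (1 / σ))
  have hAB : 0 < A * B := by positivity
  -- The two summands are x and x⁻¹ for x = ε‖ξ‖/‖η‖, and one of them is at least 1.
  have key : 1 ≤ ε * (‖ξ‖ * ‖η‖⁻¹) + ε⁻¹ * (‖ξ‖⁻¹ * ‖η‖) := by
    set x := ε * (‖ξ‖ * ‖η‖⁻¹) with hx
    have hx0 : 0 < x := by positivity
    have : ε⁻¹ * (‖ξ‖⁻¹ * ‖η‖) = x⁻¹ := by
      rw [hx]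
      field_simp
    rw [this]
    rcases le_total 1 x with h1 | h1
    · have : 0 < x⁻¹ := by positivity
      linarith
    · have := (one_le_inv₀ hx0).2 h1
      linarith
  nlinarith

/-- The Gevrey weight dominates every power of the frequency. -/
theorem exists_norm_pow_le_wt {a σ : ℝ} (ha : 0 < a) (hσ : 1 < σ) (N : ℕ) :
    ∃ C : ℝ, 0 < C ∧ ∀ ξ : R3, ξ ≠ 0 →
      ENNReal.ofReal (‖ξ‖ ^ N) ≤ ENNReal.ofReal C * wt (-1) a σ ξ := by
  -- With x = ‖ξ‖^(1/σ) one has ‖ξ‖ = x^σ ≤ (1+x)^k. One extra power, N + 1, compensates the factor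
  -- ‖ξ‖⁻¹ of the weight. The constant comes from keeping the term of order M in the series of
  -- exp(a(1+x)).
  obtain ⟨k, hk⟩ := exists_nat_ge σ
  set M := k * (N + 1) with hM
  refine ⟨(M.factorial : ℝ) * Real.exp a / a ^ M, by positivity, fun ξ hξ => ?_⟩
  have h : 0 < ‖ξ‖ := norm_pos_iff.2 hξ
  rw [wt, ← ENNReal.ofReal_mul (by positivity)]
  refine ENNReal.ofReal_le_ofReal ?_
  rw [Real.rpow_neg_one]
  set x := ‖ξ‖ ^ (1 / σ) with hx
  have hx0 : 0 < x := by positivity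
  have hσ0 : (0 : ℝ) < σ := by linarith
  have hxσ : ‖ξ‖ ≤ (1 + x) ^ k := by
    have h1 : ‖ξ‖ = x ^ σ := by
      rw [hx, ← Real.rpow_mul h.le, one_div, inv_mul_cancel₀ hσ0.ne', Real.rpow_one]
    rw [h1, ← Real.rpow_natCast]
    calc x ^ σ ≤ (1 + x) ^ σ := Real.rpow_le_rpow hx0.le (by linarith) hσ0.le
      _ ≤ (1 + x) ^ (k : ℝ) := Real.rpow_le_rpow_of_exponent_le (by linarith) hk
  have h2 : ‖ξ‖ ^ (N + 1) ≤ (1 + x) ^ M := by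
    rw [hM, pow_mul]
    exact pow_le_pow_left₀ h.le hxσ _
  have h3 : (a * (1 + x)) ^ M / M.factorial ≤ Real.exp (a * (1 + x)) :=
    Real.pow_div_factorial_le_exp _ (by positivity) _
  rw [mul_add, mul_one, Real.exp_add, div_le_iff₀ (by positivity), ← mul_one_add, mul_pow] at h3
  have h4 : ‖ξ‖ ^ (N + 1) ≤ (M.factorial : ℝ) * Real.exp a / a ^ M * Real.exp (a * x) := by
    refine h2.trans ?_
    rw [div_mul_eq_mul_div, le_div_iff₀ (by positivity)]
    linarith
  rw [pow_succ] at h4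
  calc ‖ξ‖ ^ N = ‖ξ‖⁻¹ * (‖ξ‖ ^ N * ‖ξ‖) := by field_simp
    _ ≤ ‖ξ‖⁻¹ * ((M.factorial : ℝ) * Real.exp a / a ^ M * Real.exp (a * x)) := by gcongr
    _ = _ := by ring

theorem lintegral_pow_mul_enorm_le {a σ : ℝ} (ha : 0 < a) (hσ : 1 < σ) (N : ℕ) :
    ∃ C : ℝ, 0 < C ∧ ∀ g : R3 → C3,
      ∫⁻ ξ, ENNReal.ofReal (‖ξ‖ ^ N) * ‖g ξ‖ₑ ≤ ENNReal.ofReal C * zInt (-1) a σ g := by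
  obtain ⟨C, hC, h⟩ := exists_norm_pow_le_wt ha hσ N
  refine ⟨C, hC, fun g => ?_⟩
  rw [zInt, ← lintegral_const_mul' _ _ ENNReal.ofReal_ne_top]
  refine lintegral_mono_ae ?_
  filter_upwards [ae_ne_zero] with ξ hξ
  rw [← mul_assoc]
  gcongr
  exact h ξ hξ

theorem lintegral_enorm_le_zInt {a σ : ℝ} (ha : 0 < a) (hσ : 1 < σ) :
    ∃ C : ℝ, 0 < C ∧ ∀ g : R3 → C3, ∫⁻ ξ, ‖g ξ‖ₑ ≤ ENNReal.ofReal C * zInt (-1) a σ g := by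
  obtain ⟨C, hC, h⟩ := lintegral_pow_mul_enorm_le ha hσ 0
  exact ⟨C, hC, fun g => by simpa using h g⟩

/-- Near the origin |ξ|⁻¹ is bounded below and at infinity the exponential wins, so Z⁻¹ consists of
inverse Fourier transforms of L¹ functions. All later computations rest on this. -/
theorem integrable_of_zInt {a σ : ℝ} (ha : 0 < a) (hσ : 1 < σ) {g : R3 → C3}
    (hg : AEStronglyMeasurable g) (h : zInt (-1) a σ g < ∞) : Integrable g := by
  obtain ⟨C, hC, hle⟩ := lintegral_enorm_le_zInt ha hσ
  exact ⟨hg, (hle g).trans_lt (ENNReal.mul_lt_top ENNReal.ofReal_lt_top h)⟩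

theorem aemeasurable_wt_mul (ρ a σ : ℝ) {g : R3 → C3} (hg : AEStronglyMeasurable g) :
    AEMeasurable fun ξ => wt ρ a σ ξ * ‖g ξ‖ₑ :=
  (measurable_wt ρ a σ).aemeasurable.mul hg.enorm

theorem zInt_congr {ρ a σ : ℝ} {g h : R3 → C3} (hgh : g =ᵐ[volume] h) :
    zInt ρ a σ g = zInt ρ a σ h :=
  lintegral_congr_ae (hgh.mono fun ξ hξ => by simp only [hξ])

theorem zInt_add_le {ρ a σ : ℝ} {g h : R3 → C3} (hg : AEStronglyMeasurable g) :
    zInt ρ a σ (g + h) ≤ zInt ρ a σ g + zInt ρ a σ h := by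
  rw [zInt, zInt, zInt, ← lintegral_add_left'
    (aemeasurable_wt_mul ρ a σ hg)]
  refine lintegral_mono fun ξ => ?_
  rw [← mul_add]
  gcongr
  exact enorm_add_le _ _

theorem zInt_neg {ρ a σ : ℝ} (g : R3 → C3) : zInt ρ a σ (-g) = zInt ρ a σ g := by
  simp [zInt]

theorem ae_eq_zero_of_zInt_eq_zero {ρ a σ : ℝ} {g : R3 → C3} (hg : AEStronglyMeasurable g)
    (h : zInt ρ a σ g = 0) : g =ᵐ[volume] 0 := by
  rw [zInt, lintegral_eq_zero_iff' (aemeasurable_wt_mul ρ a σ hg)] at h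
  filter_upwards [h, ae_ne_zero] with ξ h1 h2
  simpa [wt_ne_zero ρ a σ h2] using h1

/-! ### Fourier synthesis -/

section Synthesis

variable {F : Type*} [NormedAddCommGroup F] [NormedSpace ℂ F]

/-- The constant `(2π)⁻³`. -/
noncomputable def fourConst : ℝ := ((2 * Real.pi) ^ 3)⁻¹

theorem fourConst_pos : 0 < fourConst := by
  unfold fourConst
  positivity

/-- The only numerical input on the constant (2π)⁻³. The value 1/16 is far from sharp, but it
already allows every initial norm up to ν. -/
theorem fourConst_le : fourConst ≤ 1 / 16 := by
  rw [fourConst, one_div]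
  refine inv_anti₀ (by norm_num) ?_
  have h : (6 : ℝ) ≤ 2 * Real.pi := by linarith [Real.pi_gt_three]
  calc (16 : ℝ) ≤ 6 ^ 3 := by norm_num
    _ ≤ (2 * Real.pi) ^ 3 := pow_le_pow_left₀ (by norm_num) h 3

/-- The inverse Fourier transform `x ↦ (2π)⁻³ ∫ exp(i x·ξ) g(ξ) dξ`. -/
noncomputable def synth (g : R3 → F) (x : R3) : F :=
  (fourConst : ℂ) • ∫ ξ, Complex.exp (Complex.I * (inner ℝ x ξ : ℝ)) • g ξ

theorem norm_cexp_I_mul_ofReal (r : ℝ) : ‖Complex.exp (Complex.I * (r : ℂ))‖ = 1 := by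
  rw [mul_comm, Complex.norm_exp_ofReal_mul_I]

theorem continuous_wave (ξ : R3) :
    Continuous fun x : R3 => Complex.exp (Complex.I * (inner ℝ x ξ : ℝ)) := by
  fun_prop

theorem continuous_wave' (x : R3) :
    Continuous fun ξ : R3 => Complex.exp (Complex.I * (inner ℝ x ξ : ℝ)) := by
  fun_prop

theorem integrable_wave_smul {g : R3 → F} (hg : Integrable g) (x : R3) :
    Integrable fun ξ => Complex.exp (Complex.I * (inner ℝ x ξ : ℝ)) • g ξ := by
  refine hg.norm.mono' ((continuous_wave' x).aestronglyMeasurable.smul hg.1) ?_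
  refine Eventually.of_forall fun ξ => ?_
  rw [norm_smul, norm_cexp_I_mul_ofReal, one_mul]

theorem norm_synth_le {g : R3 → F} (x : R3) : ‖synth g x‖ ≤ fourConst * ∫ ξ, ‖g ξ‖ := by
  rw [synth, norm_smul, Complex.norm_real, Real.norm_of_nonneg fourConst_pos.le]
  refine mul_le_mul_of_nonneg_left ((norm_integral_le_integral_norm _).trans_eq ?_)
    fourConst_pos.le
  refine integral_congr_ae (Eventually.of_forall fun ξ => ?_)
  simp only [norm_smul, norm_cexp_I_mul_ofReal, one_mul]

theorem continuous_synth {g : R3 → F} (hg : Integrable g) : Continuous (synth g) := by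
  refine (continuous_of_dominated (bound := fun ξ => ‖g ξ‖) (fun x => ?_) (fun x => ?_) hg.norm
    ?_).const_smul _
  · exact (integrable_wave_smul hg x).1
  · refine Eventually.of_forall fun ξ => ?_
    rw [norm_smul, norm_cexp_I_mul_ofReal, one_mul]
  · exact Eventually.of_forall fun ξ => (continuous_wave ξ).smul continuous_const

theorem synth_congr {g h : R3 → F} (hgh : g =ᵐ[volume] h) : synth g = synth h := by
  funext x
  rw [synth, synth]
  congr 1
  exact integral_congr_ae (hgh.mono fun ξ hξ => by simp only [hξ])

theorem synth_add {g h : R3 → F} (hg : Integrable g) (hh : Integrable h) (x : R3) :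
    synth (fun ξ => g ξ + h ξ) x = synth g x + synth h x := by
  simp only [synth, smul_add]
  rw [integral_add (integrable_wave_smul hg x) (integrable_wave_smul hh x), smul_add]

theorem synth_sub {g h : R3 → F} (hg : Integrable g) (hh : Integrable h) (x : R3) :
    synth (fun ξ => g ξ - h ξ) x = synth g x - synth h x := by
  simp only [synth, smul_sub]
  rw [integral_sub (integrable_wave_smul hg x) (integrable_wave_smul hh x), smul_sub]

theorem synth_smul (c : ℂ) (g : R3 → F) (x : R3) :
    synth (fun ξ => c • g ξ) x = c • synth g x := by
  simp only [synth]
  rw [smul_comm c, ← integral_smul c]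
  simp only [smul_comm c]

theorem synth_sum {ι : Type*} (s : Finset ι) {g : ι → R3 → F} (hg : ∀ i ∈ s, Integrable (g i))
    (x : R3) : synth (fun ξ => ∑ i ∈ s, g i ξ) x = ∑ i ∈ s, synth (g i) x := by
  simp only [synth, Finset.smul_sum]
  rw [integral_finsetSum _ fun i hi => integrable_wave_smul (hg i hi) x, Finset.smul_sum]

/-- Fubini, since the kernel exp(i x·ξ) is symmetric in its two variables. It moves every pairing
with a distribution between space and frequency. -/
theorem integral_synth_smul [CompleteSpace F] {φ : R3 → ℂ} {g : R3 → F} (hφ : Integrable φ)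
    (hg : Integrable g) : ∫ ξ, synth φ ξ • g ξ = ∫ x, φ x • synth g x := by
  have h1 : ∀ ξ, synth φ ξ • g ξ =
      ∫ x, ((fourConst : ℂ) * (Complex.exp (Complex.I * (inner ℝ ξ x : ℝ)) * φ x)) • g ξ := by
    intro ξ
    rw [integral_smul_const, integral_const_mul]
    rfl
  have h2 : ∀ x, φ x • synth g x =
      ∫ ξ, ((fourConst : ℂ) * (Complex.exp (Complex.I * (inner ℝ ξ x : ℝ)) * φ x)) • g ξ := by
    intro x
    rw [synth, smul_comm, ← integral_smul, ← integral_smul]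
    refine integral_congr_ae (Eventually.of_forall fun ξ => ?_)
    simp only [smul_smul]
    rw [real_inner_comm]
    ring_nf
  simp only [h1, h2]
  refine integral_integral_swap ?_
  have h3 : Integrable (fun p : R3 × R3 => φ p.2 • g p.1) (volume.prod volume) :=
    (hφ.smul_prod hg).swap
  have h4 : Continuous fun p : R3 × R3 =>
      (fourConst : ℂ) * Complex.exp (Complex.I * (inner ℝ p.1 p.2 : ℝ)) := by fun_prop
  refine (h3.norm.const_mul fourConst).mono' ?_ (Eventually.of_forall fun p => ?_)
  · refine (h4.aestronglyMeasurable.smul h3.1).congr (Eventually.of_forall fun p => ?_)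
    rw [Function.uncurry, Pi.smul_apply', smul_smul, mul_assoc]
  · simp only [Function.uncurry, norm_smul, norm_mul, norm_cexp_I_mul_ofReal, one_mul,
      Complex.norm_real, Real.norm_of_nonneg fourConst_pos.le, mul_assoc]
    exact le_rfl

theorem synth_eq_fourierInv (g : R3 → F) (x : R3) :
    synth g x = (fourConst : ℂ) • 𝓕⁻ g ((2 * Real.pi)⁻¹ • x) := by
  rw [synth, Real.fourierInv_eq']
  congr 1
  refine integral_congr_ae (Eventually.of_forall fun ξ => ?_)
  simp only [inner_smul_right, real_inner_comm x ξ]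
  congr 2
  have hpi : (Real.pi : ℂ) ≠ 0 := by exact_mod_cast Real.pi_ne_zero
  push_cast
  field_simp

/-- The inverse of `schwartzFourier`. -/
noncomputable def schwartzSynth : 𝓢(R3, ℂ) →L[ℂ] 𝓢(R3, ℂ) :=
  (FourierTransform.fourierInvCLM ℂ 𝓢(R3, ℂ)) ∘L
    (SchwartzMap.compCLMOfContinuousLinearEquiv ℂ dilation.symm)

theorem schwartzFourier_schwartzSynth (φ : 𝓢(R3, ℂ)) :
    schwartzFourier (schwartzSynth φ) = φ := by
  ext x
  simp [schwartzFourier, schwartzSynth]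

theorem schwartzSynth_schwartzFourier (φ : 𝓢(R3, ℂ)) :
    schwartzSynth (schwartzFourier φ) = φ := by
  have h : SchwartzMap.compCLMOfContinuousLinearEquiv ℂ dilation.symm
      (SchwartzMap.compCLMOfContinuousLinearEquiv ℂ dilation (𝓕 φ)) = 𝓕 φ := by
    ext x
    simp
  simp [schwartzFourier, schwartzSynth, h]

/-- The change of variables ξ ↦ 2πξ in dimension 3 turns the kernel exp(2πi x·ξ) into exp(i x·ξ) and
produces the constant (2π)⁻³. -/
theorem schwartzSynth_apply (φ : 𝓢(R3, ℂ)) (x : R3) : schwartzSynth φ x = synth φ x := by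
  have h : schwartzSynth φ x = 𝓕⁻ (fun y : R3 => φ (dilation.symm y)) x := by
    simp only [schwartzSynth, ContinuousLinearMap.comp_apply,
      FourierTransform.fourierInvCLM_apply, SchwartzMap.fourierInv_coe]
    rfl
  have hd : ∀ y : R3, dilation.symm y = (2 * Real.pi) • y := by
    intro y
    rw [ContinuousLinearEquiv.symm_apply_eq]
    change y = (2 * Real.pi)⁻¹ • (2 * Real.pi) • y
    rw [smul_smul, inv_mul_cancel₀ (by positivity), one_smul]
  rw [h, Real.fourierInv_eq', synth]
  have h2 := Measure.integral_comp_smul (volume : Measure R3)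
    (fun ξ => Complex.exp (Complex.I * (inner ℝ x ξ : ℝ)) • φ ξ) (2 * Real.pi)
  have hr : Module.finrank ℝ R3 = 3 := by simp
  rw [hr, abs_of_pos (by positivity)] at h2
  have h3 : (fourConst : ℂ) • ∫ ξ, Complex.exp (Complex.I * (inner ℝ x ξ : ℝ)) • φ ξ =
      ((2 * Real.pi) ^ 3)⁻¹ • ∫ ξ, Complex.exp (Complex.I * (inner ℝ x ξ : ℝ)) • φ ξ := rfl
  rw [h3, ← h2]
  refine integral_congr_ae (Eventually.of_forall fun ξ => ?_)
  simp only [hd, inner_smul_right, real_inner_comm x ξ]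
  congr 2
  push_cast
  ring

theorem synth_schwartzFourier (φ : 𝓢(R3, ℂ)) : synth (schwartzFourier φ) = φ := by
  funext x
  rw [← schwartzSynth_apply, schwartzSynth_schwartzFourier]

theorem synth_lineDeriv (φ : 𝓢(R3, ℂ)) (v ξ : R3) :
    synth (∂_{v} φ : 𝓢(R3, ℂ)) ξ = -(Complex.I * (inner ℝ ξ v : ℝ)) * synth φ ξ := by
  rw [synth_eq_fourierInv, synth_eq_fourierInv, ← SchwartzMap.fourierInv_coe,
    SchwartzMap.fourierInv_lineDerivOp_eq]
  have hg : (fun x : R3 => (inner ℝ x v : ℝ)).HasTemperateGrowth := by fun_prop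
  rw [← SchwartzMap.fourierInv_coe]
  simp only [smul_apply, smul_eq_mul, neg_mul, mul_neg]
  rw [SchwartzMap.smulLeftCLM_apply_apply (by fun_prop)]
  have hpi : (Real.pi : ℂ) ≠ 0 := by exact_mod_cast Real.pi_ne_zero
  simp only [real_inner_smul_left, Complex.real_smul]
  push_cast
  field_simp

end Synthesis

/-! ### Integration against Schwartz functions -/

/-- A smooth real function with compact support, as a complex Schwartz function. -/
noncomputable def schwartzOfReal (ψ : R3 → ℝ) (hψ : ContDiff ℝ (⊤ : ℕ∞) ψ)
    (hc : HasCompactSupport ψ) : 𝓢(R3, ℂ) :=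
  (hc.comp_left (g := Complex.ofReal) Complex.ofReal_zero).toSchwartzMap
    (Complex.ofRealCLM.contDiff.comp hψ)

theorem schwartzOfReal_apply (ψ : R3 → ℝ) (hψ : ContDiff ℝ (⊤ : ℕ∞) ψ)
    (hc : HasCompactSupport ψ) (x : R3) : schwartzOfReal ψ hψ hc x = (ψ x : ℂ) := rfl

theorem lineDeriv_schwartzOfReal (ψ : R3 → ℝ) (hψ : ContDiff ℝ (⊤ : ℕ∞) ψ)
    (hc : HasCompactSupport ψ) (v x : R3) :
    (∂_{v} (schwartzOfReal ψ hψ hc) : 𝓢(R3, ℂ)) x = ((fderiv ℝ ψ x v : ℝ) : ℂ) := by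
  rw [SchwartzMap.lineDerivOp_apply_eq_fderiv]
  have h1 : HasFDerivAt ψ (fderiv ℝ ψ x) x :=
    ((hψ.differentiable (by simp)) x).hasFDerivAt
  have h2 : HasFDerivAt (schwartzOfReal ψ hψ hc : R3 → ℂ)
      (Complex.ofRealCLM.comp (fderiv ℝ ψ x)) x :=
    Complex.ofRealCLM.hasFDerivAt.comp x h1
  rw [h2.fderiv]
  rfl

section Pairing

variable {F : Type*} [NormedAddCommGroup F] [NormedSpace ℂ F]

/-- Test with a bump function equal to 1 on a ball around the given point. -/
theorem locallyIntegrable_of_schwartz {g : R3 → F}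
    (h : ∀ φ : 𝓢(R3, ℂ), Integrable fun x => φ x • g x) : LocallyIntegrable g := by
  intro x
  let b : ContDiffBump x := ⟨1, 2, by norm_num, by norm_num⟩
  refine ⟨Metric.closedBall x 1, Metric.closedBall_mem_nhds x one_pos, ?_⟩
  have h1 := (h (schwartzOfReal b b.contDiff b.hasCompactSupport)).integrableOn
    (s := Metric.closedBall x 1)
  refine h1.congr_fun (fun y hy => ?_) measurableSet_closedBall
  simp only [schwartzOfReal_apply]
  rw [b.one_of_mem_closedBall hy]
  simp

theorem ae_eq_of_schwartz [CompleteSpace F] {g h : R3 → F} (hg : LocallyIntegrable g)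
    (hh : LocallyIntegrable h)
    (H : ∀ φ : 𝓢(R3, ℂ), ∫ x, φ x • g x = ∫ x, φ x • h x) : g =ᵐ[volume] h := by
  refine ae_eq_of_integral_contDiff_smul_eq hg hh fun ψ hψ hc => ?_
  have := H (schwartzOfReal ψ hψ hc)
  simpa only [schwartzOfReal_apply, Complex.coe_smul] using this

theorem integrable_schwartz_smul (φ : 𝓢(R3, ℂ)) {g : R3 → F} (hg : Integrable g) :
    Integrable fun x => φ x • g x := by
  refine hg.bdd_smul (SchwartzMap.seminorm ℝ 0 0 φ) φ.continuous.aestronglyMeasurable ?_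
  exact Eventually.of_forall fun x => SchwartzMap.norm_le_seminorm ℝ φ x

theorem integrable_schwartz_smul_synth (φ : 𝓢(R3, ℂ)) {g : R3 → F} (hg : Integrable g) :
    Integrable fun x => φ x • synth g x :=
  φ.integrable.smul_bdd (fourConst * ∫ ξ, ‖g ξ‖) (continuous_synth hg).aestronglyMeasurable
    (Eventually.of_forall fun x => norm_synth_le x)

/-- Integration by parts: `∂ᵥ` acts on a synthesized function as multiplication by `i v·ξ`. -/
theorem integral_lineDeriv_smul_synth [CompleteSpace F] (φ : 𝓢(R3, ℂ)) (v : R3) {g : R3 → F}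
    (hg : Integrable g)
    (hg' : Integrable fun ξ => (Complex.I * (inner ℝ ξ v : ℝ)) • g ξ) :
    ∫ x, (∂_{v} φ : 𝓢(R3, ℂ)) x • synth g x =
      -∫ x, φ x • synth (fun ξ => (Complex.I * (inner ℝ ξ v : ℝ)) • g ξ) x := by
  rw [← integral_synth_smul (SchwartzMap.integrable _) hg,
    ← integral_synth_smul φ.integrable hg', ← integral_neg]
  refine integral_congr_ae (Eventually.of_forall fun ξ => ?_)
  simp only [synth_lineDeriv, smul_smul, ← neg_smul]
  congr 1
  ring

/-- Fourier synthesis is injective, tested against smooth functions with compact support. -/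
theorem ae_eq_zero_of_synth [CompleteSpace F] {g : R3 → F} (hg : Integrable g)
    (h : ∀ ψ : R3 → ℝ, ContDiff ℝ (⊤ : ℕ∞) ψ → HasCompactSupport ψ →
      ∫ x, ψ x • synth g x = 0) : g =ᵐ[volume] 0 := by
  have h1 : synth g =ᵐ[volume] 0 :=
    ae_eq_zero_of_integral_contDiff_smul_eq_zero (continuous_synth hg).locallyIntegrable h
  refine ae_eq_of_schwartz hg.locallyIntegrable (locallyIntegrable_zero) fun φ => ?_
  -- Every Schwartz function is the synthesis of its own Fourier transform, so pairing it with g is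
  -- pairing that transform with `synth g`, which vanishes almost everywhere.
  have h2 := integral_synth_smul (schwartzFourier φ).integrable hg
  rw [synth_schwartzFourier] at h2
  rw [h2]
  refine integral_congr_ae (h1.mono fun x hx => ?_)
  simp [hx]

end Pairing

/-! ### Distributions represented by functions -/

theorem IsRepresentedBy.ae_eq {f : 𝓢'(R3, C3)} {g h : R3 → C3} (hg : IsRepresentedBy f g)
    (hh : IsRepresentedBy f h) : g =ᵐ[volume] h :=
  ae_eq_of_schwartz (locallyIntegrable_of_schwartz fun φ => (hg φ).1)
    (locallyIntegrable_of_schwartz fun φ => (hh φ).1) fun φ => by rw [← (hg φ).2, ← (hh φ).2]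

theorem IsRepresentedBy.aestronglyMeasurable {f : 𝓢'(R3, C3)} {g : R3 → C3}
    (hg : IsRepresentedBy f g) : AEStronglyMeasurable g :=
  (locallyIntegrable_of_schwartz fun φ => (hg φ).1).aestronglyMeasurable

theorem IsRepresentedBy.congr {f : 𝓢'(R3, C3)} {g h : R3 → C3} (hg : IsRepresentedBy f g)
    (hgh : g =ᵐ[volume] h) : IsRepresentedBy f h := by
  intro φ
  have : (fun x => φ x • g x) =ᵐ[volume] fun x => φ x • h x := hgh.mono fun x hx => by
    simp only [hx]
  exact ⟨(hg φ).1.congr this, (hg φ).2.trans (integral_congr_ae this)⟩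

theorem IsRepresentedBy.sub {f f' : 𝓢'(R3, C3)} {g h : R3 → C3} (hg : IsRepresentedBy f g)
    (hh : IsRepresentedBy f' h) : IsRepresentedBy (f - f') (g - h) := by
  intro φ
  have h1 := (hg φ).1.sub (hh φ).1
  have h2 := integral_sub (hg φ).1 (hh φ).1
  simp only [Pi.sub_apply, smul_sub] at h1 h2 ⊢
  refine ⟨h1, ?_⟩
  rw [h2, ← (hg φ).2, ← (hh φ).2]
  rfl

theorem fourierDist_apply (f : 𝓢'(R3, C3)) (φ : 𝓢(R3, ℂ)) :
    fourierDist f φ = f (schwartzFourier φ) := rfl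

theorem fourierDist_sub (f f' : 𝓢'(R3, C3)) :
    fourierDist (f - f') = fourierDist f - fourierDist f' := by
  ext φ
  rfl

theorem eq_of_fourierDist_rep {f f' : 𝓢'(R3, C3)} {g h : R3 → C3}
    (hg : IsRepresentedBy (fourierDist f) g) (hh : IsRepresentedBy (fourierDist f') h)
    (hgh : g =ᵐ[volume] h) : f = f' := by
  ext1 φ
  have h1 := (hg (schwartzSynth φ)).2
  have h2 := ((hh.congr hgh.symm) (schwartzSynth φ)).2
  rw [fourierDist_apply, schwartzFourier_schwartzSynth] at h1 h2
  rw [h1, h2]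

/-- The infimum runs over a single almost-everywhere class, on which the integral is constant, so
any representative computes the norm. -/
theorem zNorm_eq_zInt {f : 𝓢'(R3, C3)} {g : R3 → C3} (hg : IsRepresentedBy (fourierDist f) g)
    (ρ a σ : ℝ) : zNorm ρ a σ f = zInt ρ a σ g := by
  refine le_antisymm (iInf₂_le g hg) (le_iInf₂ fun h hh => ?_)
  exact (zInt_congr (hg.ae_eq hh)).le

theorem MemZ.exists_rep {ρ a σ : ℝ} {f : 𝓢'(R3, C3)} (h : MemZ ρ a σ f) :
    ∃ g : R3 → C3, Measurable g ∧ IsRepresentedBy (fourierDist f) g := by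
  have : ∃ g, IsRepresentedBy (fourierDist f) g := by
    by_contra hc
    push Not at hc
    simp [MemZ, zNorm, hc] at h
  obtain ⟨g, hg⟩ := this
  have hm := hg.aestronglyMeasurable
  exact ⟨hm.mk g, hm.stronglyMeasurable_mk.measurable, hg.congr hm.ae_eq_mk⟩

theorem isRepresentedBy_synth {f : 𝓢'(R3, C3)} {g : R3 → C3} (hg : Integrable g)
    (hf : IsRepresentedBy (fourierDist f) g) : IsRepresentedBy f (synth g) := by
  intro φ
  refine ⟨integrable_schwartz_smul_synth φ hg, ?_⟩
  have h1 := (hf (schwartzSynth φ)).2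
  rw [fourierDist_apply, schwartzFourier_schwartzSynth] at h1
  rw [h1, ← integral_synth_smul φ.integrable hg]
  simp only [schwartzSynth_apply]

theorem isRepresentedBy_fourierDist {f : 𝓢'(R3, C3)} {g : R3 → C3} (hg : Integrable g)
    (hf : IsRepresentedBy f (synth g)) : IsRepresentedBy (fourierDist f) g := by
  intro φ
  refine ⟨integrable_schwartz_smul φ hg, ?_⟩
  rw [fourierDist_apply, (hf _).2, ← integral_synth_smul (SchwartzMap.integrable _) hg,
    synth_schwartzFourier]

/-- The synthesis of an integrable function is bounded and continuous, and an L^∞ function is a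
tempered distribution. -/
theorem exists_fourierDist_rep {g : R3 → C3} (hg : Integrable g) :
    ∃ f : 𝓢'(R3, C3), IsRepresentedBy (fourierDist f) g := by
  have hmem : MemLp (synth g) ∞ :=
    memLp_top_of_bound (continuous_synth hg).aestronglyMeasurable (fourConst * ∫ ξ, ‖g ξ‖)
      (Eventually.of_forall fun x => norm_synth_le x)
  refine ⟨Lp.toTemperedDistribution (hmem.toLp _), isRepresentedBy_fourierDist hg fun φ => ?_⟩
  refine ⟨integrable_schwartz_smul_synth φ hg, ?_⟩
  rw [Lp.toTemperedDistribution_apply]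
  refine integral_congr_ae (hmem.coeFn_toLp.mono fun x hx => ?_)
  simp only [hx]

/-- The two moment assumptions justify integrating by parts twice in each direction, and the symbols
(iξⱼ)² add up to -‖ξ‖². -/
theorem fourierDist_laplacian_rep {f : 𝓢'(R3, C3)} {g : R3 → C3} (hg : Integrable g)
    (hg1 : Integrable fun ξ => ‖ξ‖ • g ξ) (hg2 : Integrable fun ξ => ‖ξ‖ ^ 2 • g ξ)
    (hf : IsRepresentedBy (fourierDist f) g) :
    IsRepresentedBy (fourierDist (Δ f)) fun ξ => -(‖ξ‖ ^ 2 • g ξ) := by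
  have hc : ∀ j : Fin 3, Integrable fun ξ : R3 =>
      (Complex.I * (inner ℝ ξ (basisVec j) : ℝ)) • g ξ := by
    intro j
    refine hg1.norm.mono' ?_ (Eventually.of_forall fun ξ => ?_)
    · have : Continuous fun ξ : R3 => Complex.I * ((inner ℝ ξ (basisVec j) : ℝ) : ℂ) := by
        fun_prop
      exact this.aestronglyMeasurable.smul hg.1
    · rw [norm_smul, norm_smul, norm_mul, Complex.norm_I, one_mul, Complex.norm_real, norm_norm]
      refine mul_le_mul_of_nonneg_right ((norm_inner_le_norm _ _).trans ?_) (norm_nonneg _)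
      simp [basisVec]
  have hc2 : ∀ j : Fin 3, Integrable fun ξ : R3 =>
      (Complex.I * (inner ℝ ξ (basisVec j) : ℝ)) • (Complex.I * (inner ℝ ξ (basisVec j) : ℝ)) •
        g ξ := by
    intro j
    refine hg2.norm.mono' ?_ (Eventually.of_forall fun ξ => ?_)
    · have : Continuous fun ξ : R3 => Complex.I * ((inner ℝ ξ (basisVec j) : ℝ) : ℂ) := by
        fun_prop
      exact this.aestronglyMeasurable.smul (hc j).1
    · rw [smul_smul, norm_smul, norm_smul, norm_mul, norm_mul, Complex.norm_I, one_mul,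
        Complex.norm_real, norm_pow, norm_norm, sq]
      have : ‖(inner ℝ ξ (basisVec j) : ℝ)‖ ≤ ‖ξ‖ :=
        (norm_inner_le_norm _ _).trans (by simp [basisVec])
      gcongr
  have hint : Integrable fun ξ => -(‖ξ‖ ^ 2 • g ξ) := hg2.neg
  refine isRepresentedBy_fourierDist hint fun φ =>
    ⟨integrable_schwartz_smul_synth φ hint, ?_⟩
  have hrep := isRepresentedBy_synth hg hf
  rw [TemperedDistribution.laplacian_apply_apply,
    SchwartzMap.laplacian_eq_sum (EuclideanSpace.basisFun (Fin 3) ℝ), map_sum]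
  have hj : ∀ j : Fin 3, EuclideanSpace.basisFun (Fin 3) ℝ j = basisVec j := by
    intro j
    simp [basisVec]
  have hs : synth (fun ξ => -(‖ξ‖ ^ 2 • g ξ)) = fun x => ∑ j : Fin 3, synth (fun ξ : R3 =>
      (Complex.I * (inner ℝ ξ (basisVec j) : ℝ)) • (Complex.I * (inner ℝ ξ (basisVec j) : ℝ)) •
        g ξ) x := by
    funext x
    rw [← synth_sum _ fun j _ => hc2 j]
    congr 1
    funext ξ
    rw [EuclideanSpace.norm_sq_eq, Finset.sum_smul, ← Finset.sum_neg_distrib]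
    refine Finset.sum_congr rfl fun j _ => ?_
    have : (inner ℝ ξ (basisVec j) : ℝ) = ξ j := by
      simp [basisVec, EuclideanSpace.inner_single_right]
    rw [this, smul_smul, ← neg_smul, ← Complex.coe_smul]
    congr 1
    rw [Real.norm_eq_abs, sq_abs, mul_mul_mul_comm, Complex.I_mul_I]
    push_cast
    ring
  rw [hs]
  simp only [Finset.smul_sum]
  rw [integral_finsetSum _ fun j _ => integrable_schwartz_smul_synth φ (hc2 j)]
  refine Finset.sum_congr rfl fun j _ => ?_
  rw [hj, (hrep _).2, integral_lineDeriv_smul_synth _ _ hg (hc j),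
    integral_lineDeriv_smul_synth _ _ (hc j) (hc2 j), neg_neg]

/-! ### Products, components, reality and divergence on the Fourier side -/

theorem inner_basisVec (ξ : R3) (j : Fin 3) : (inner ℝ ξ (basisVec j) : ℝ) = ξ j := by
  simp [basisVec, EuclideanSpace.inner_single_right]

theorem abs_coord_le (ξ : R3) (j : Fin 3) : |ξ j| ≤ ‖ξ‖ := PiLp.norm_apply_le ξ j

theorem norm_coord_le (v : C3) (j : Fin 3) : ‖v j‖ ≤ ‖v‖ := PiLp.norm_apply_le v j

theorem enorm_coord_le (v : C3) (j : Fin 3) : ‖v j‖ₑ ≤ ‖v‖ₑ := by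
  rw [← ofReal_norm, ← ofReal_norm]
  exact ENNReal.ofReal_le_ofReal (norm_coord_le v j)

theorem integrable_coord {α : Type*} [MeasurableSpace α] {μ : Measure α} {g : α → C3}
    (hg : Integrable g μ) (i : Fin 3) : Integrable (fun ξ => g ξ i) μ :=
  (EuclideanSpace.proj (𝕜 := ℂ) i).integrable_comp hg

theorem integral_coord {α : Type*} [MeasurableSpace α] {μ : Measure α} {g : α → C3}
    (hg : Integrable g μ) (i : Fin 3) : (∫ ξ, g ξ ∂μ) i = ∫ ξ, g ξ i ∂μ :=
  ((EuclideanSpace.proj (𝕜 := ℂ) i).integral_comp_comm hg).symm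

theorem synth_coord {g : R3 → C3} (hg : Integrable g) (x : R3) (i : Fin 3) :
    synth g x i = synth (fun ξ => g ξ i) x := by
  rw [synth, synth, PiLp.smul_apply, integral_coord (integrable_wave_smul hg x)]
  rfl

theorem integrable_conv {f g : R3 → ℂ} (hf : Integrable f) (hg : Integrable g) :
    Integrable fun ξ => ∫ η, f η * g (ξ - η) :=
  hf.integrable_convolution (ContinuousLinearMap.mul ℂ ℂ) hg

/-- The convolution theorem: the two constants (2π)⁻³ on the left leave one in front of the
convolution. This is the source of `fourConst` in the quadratic term. -/
theorem synth_mul_synth {f g : R3 → ℂ} (hf : Integrable f) (hg : Integrable g) (x : R3) :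
    synth f x * synth g x = synth (fun ξ => (fourConst : ℂ) * ∫ η, f η * g (ξ - η)) x := by
  have h := Real.fourier_mul_convolution_eq hf hg (-((2 * Real.pi)⁻¹ • x))
  have h2 := synth_smul (fourConst : ℂ) (fun ξ => ∫ η, f η * g (ξ - η)) x
  simp only [smul_eq_mul] at h2
  rw [h2, synth_eq_fourierInv, synth_eq_fourierInv, synth_eq_fourierInv]
  simp only [Real.fourierInv_eq_fourier_neg, smul_eq_mul]
  have h3 : 𝓕 (fun ξ : R3 => ∫ η, f η * g (ξ - η)) (-((2 * Real.pi)⁻¹ • x)) = _ := h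
  rw [h3]
  ring

theorem conj_synth (g : R3 → ℂ) (x : R3) :
    (starRingEnd ℂ) (synth g x) = synth (fun ξ => (starRingEnd ℂ) (g (-ξ))) x := by
  simp only [synth, smul_eq_mul, map_mul, Complex.conj_ofReal]
  rw [← integral_conj, ← integral_neg_eq_self]
  congr 1
  refine integral_congr_ae (Eventually.of_forall fun ξ => ?_)
  simp only [map_mul, ← Complex.exp_conj, inner_neg_right, Complex.conj_I, Complex.conj_ofReal]
  congr 2
  push_cast
  ring

theorem integrable_conj_neg {g : R3 → ℂ} (hg : Integrable g) :
    Integrable fun ξ => (starRingEnd ℂ) (g (-ξ)) :=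
  (Complex.conjCLE.toContinuousLinearMap.integrable_comp hg.comp_neg :)

theorem im_synth_eq_zero {g : R3 → ℂ} (h : ∀ᵐ ξ, g (-ξ) = (starRingEnd ℂ) (g ξ)) (x : R3) :
    (synth g x).im = 0 := by
  rw [← Complex.conj_eq_iff_im, conj_synth]
  have : (fun ξ => (starRingEnd ℂ) (g (-ξ))) =ᵐ[volume] g :=
    h.mono fun ξ hξ => by simp only [hξ, Complex.conj_conj]
  rw [synth_congr this]

/-- The function conj(g(-ξ)) - g(ξ) synthesizes to -2i times the imaginary part of the field.
Reality makes this vanish against real test functions, and synthesis is injective. -/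
theorem IsRealDist.symm_rep {f : 𝓢'(R3, C3)} (hf : IsRealDist f) {g : R3 → C3}
    (hg : Integrable g) (hrep : IsRepresentedBy (fourierDist f) g) (i : Fin 3) :
    ∀ᵐ ξ, g (-ξ) i = (starRingEnd ℂ) (g ξ i) := by
  have hs := isRepresentedBy_synth hg hrep
  have hgi := integrable_coord hg i
  have hz : (fun ξ => (starRingEnd ℂ) (g (-ξ) i) - g ξ i) =ᵐ[volume] 0 := by
    refine ae_eq_zero_of_synth ((integrable_conj_neg hgi).sub hgi) fun ψ hψ hc => ?_
    have h1 := hf (schwartzOfReal ψ hψ hc) (fun x => by simp [schwartzOfReal_apply]) i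
    rw [(hs _).2, integral_coord (hs _).1] at h1
    have h2 : ∀ x, (schwartzOfReal ψ hψ hc x • synth g x) i =
        ψ x • synth (fun ξ => g ξ i) x := by
      intro x
      rw [PiLp.smul_apply, synth_coord hg, schwartzOfReal_apply, Complex.coe_smul]
    simp only [h2] at h1
    rw [← Complex.conj_eq_iff_im, ← integral_conj] at h1
    have h3 : Integrable fun x => ψ x • synth (fun ξ => g ξ i) x := by
      have := integrable_schwartz_smul_synth (schwartzOfReal ψ hψ hc) hgi
      simpa only [schwartzOfReal_apply, Complex.coe_smul] using this
    have h4 : Integrable fun x => ψ x • synth (fun ξ => (starRingEnd ℂ) (g (-ξ) i)) x := by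
      have := integrable_schwartz_smul_synth (schwartzOfReal ψ hψ hc) (integrable_conj_neg hgi)
      simpa only [schwartzOfReal_apply, Complex.coe_smul] using this
    have h5 : ∀ x, synth (fun ξ => (starRingEnd ℂ) (g (-ξ) i) - g ξ i) x =
        synth (fun ξ => (starRingEnd ℂ) (g (-ξ) i)) x - synth (fun ξ => g ξ i) x :=
      fun x => synth_sub (integrable_conj_neg hgi) hgi x
    simp only [h5, smul_sub]
    rw [integral_sub h4 h3, sub_eq_zero, ← h1]
    refine integral_congr_ae (Eventually.of_forall fun x => ?_)
    simp only [Complex.real_smul, map_mul, Complex.conj_ofReal, conj_synth]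
  filter_upwards [hz] with ξ hξ
  have := sub_eq_zero.1 hξ
  rw [← this, Complex.conj_conj]

theorem integrable_I_mul_coord {g : R3 → ℂ} (hg : Integrable g)
    (hg1 : Integrable fun ξ => ‖ξ‖ • g ξ) (j : Fin 3) :
    Integrable fun ξ : R3 => (Complex.I * (ξ j : ℂ)) * g ξ := by
  refine hg1.norm.mono' ?_ (Eventually.of_forall fun ξ => ?_)
  · have : Continuous fun ξ : R3 => Complex.I * (ξ j : ℂ) := by fun_prop
    exact this.aestronglyMeasurable.mul hg.1
  · rw [norm_smul, norm_mul, norm_mul, Complex.norm_I, one_mul, Complex.norm_real, norm_norm]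
    exact mul_le_mul_of_nonneg_right (abs_coord_le ξ j) (norm_nonneg _)

theorem integral_lineDeriv_mul_synth (φ : 𝓢(R3, ℂ)) (j : Fin 3) {g : R3 → ℂ}
    (hg : Integrable g) (hg' : Integrable fun ξ : R3 => (Complex.I * (ξ j : ℂ)) * g ξ) :
    ∫ x, (∂_{basisVec j} φ : 𝓢(R3, ℂ)) x * synth g x =
      -∫ x, φ x * synth (fun ξ => (Complex.I * (ξ j : ℂ)) * g ξ) x := by
  have h := integral_lineDeriv_smul_synth φ (basisVec j) hg
  simp only [inner_basisVec, smul_eq_mul] at h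
  exact h hg'

theorem sum_lineDeriv_apply {f : 𝓢'(R3, C3)} {g : R3 → C3} (hg : Integrable g)
    (hg1 : Integrable fun ξ => ‖ξ‖ • g ξ) (hrep : IsRepresentedBy (fourierDist f) g)
    (φ : 𝓢(R3, ℂ)) :
    ∑ i : Fin 3, ((∂_{basisVec i} f : 𝓢'(R3, C3)) φ) i =
      ∫ x, φ x * synth (fun ξ => ∑ i : Fin 3, (Complex.I * (ξ i : ℂ)) * g ξ i) x := by
  have hs := isRepresentedBy_synth hg hrep
  have hI : ∀ i : Fin 3, Integrable fun ξ : R3 => (Complex.I * (ξ i : ℂ)) * g ξ i := fun i =>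
    integrable_I_mul_coord (integrable_coord hg i) (integrable_coord hg1 i) i
  simp only [synth_sum Finset.univ fun i _ => hI i, Finset.mul_sum]
  have hφ : ∀ i : Fin 3, Integrable fun x =>
      φ x * synth (fun ξ : R3 => (Complex.I * (ξ i : ℂ)) * g ξ i) x := fun i =>
    integrable_schwartz_smul_synth φ (hI i)
  rw [integral_finsetSum _ fun i _ => hφ i]
  refine Finset.sum_congr rfl fun i _ => ?_
  rw [TemperedDistribution.lineDerivOp_apply_apply, map_neg, PiLp.neg_apply, (hs _).2,
    integral_coord (hs _).1, ← neg_eq_iff_eq_neg.2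
      (integral_lineDeriv_mul_synth φ i (integrable_coord hg i) (hI i))]
  congr 1
  refine integral_congr_ae (Eventually.of_forall fun x => ?_)
  simp only [PiLp.smul_apply, synth_coord hg, smul_eq_mul]

theorem IsDivFree.rep {f : 𝓢'(R3, C3)} (hf : IsDivFree f) {g : R3 → C3} (hg : Integrable g)
    (hg1 : Integrable fun ξ => ‖ξ‖ • g ξ) (hrep : IsRepresentedBy (fourierDist f) g) :
    ∀ᵐ ξ : R3, ∑ i : Fin 3, (ξ i : ℂ) * g ξ i = 0 := by
  have hI : Integrable fun ξ : R3 => ∑ i : Fin 3, (Complex.I * (ξ i : ℂ)) * g ξ i :=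
    integrable_finsetSum _ fun i _ =>
      integrable_I_mul_coord (integrable_coord hg i) (integrable_coord hg1 i) i
  have h0 : (fun ξ : R3 => ∑ i : Fin 3, (Complex.I * (ξ i : ℂ)) * g ξ i) =ᵐ[volume] 0 := by
    refine ae_eq_zero_of_synth hI fun ψ hψ hc => ?_
    have := hf (schwartzOfReal ψ hψ hc)
    rw [sum_lineDeriv_apply hg hg1 hrep] at this
    simpa only [schwartzOfReal_apply, ← Complex.real_smul] using this
  filter_upwards [h0] with ξ hξ
  simp only [mul_assoc, ← Finset.mul_sum, Pi.zero_apply, mul_eq_zero, Complex.I_ne_zero,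
    false_or] at hξ
  exact hξ

theorem isDivFree_of_rep {f : 𝓢'(R3, C3)} {g : R3 → C3} (hg : Integrable g)
    (hg1 : Integrable fun ξ => ‖ξ‖ • g ξ) (hrep : IsRepresentedBy (fourierDist f) g)
    (h : ∀ᵐ ξ : R3, ∑ i : Fin 3, (ξ i : ℂ) * g ξ i = 0) : IsDivFree f := by
  intro φ
  rw [sum_lineDeriv_apply hg hg1 hrep]
  have h0 : (fun ξ : R3 => ∑ i : Fin 3, (Complex.I * (ξ i : ℂ)) * g ξ i) =ᵐ[volume] 0 := by
    filter_upwards [h] with ξ hξ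
    simp only [mul_assoc, ← Finset.mul_sum, hξ, mul_zero, Pi.zero_apply]
  rw [synth_congr h0]
  simp [synth]

/-! ### The scalar linear equation `y' + λ y = n` with integrable forcing -/

section Triangle

theorem measurableSet_triangle : MeasurableSet {p : ℝ × ℝ | p.2 ≤ p.1} :=
  measurableSet_le measurable_snd measurable_fst

/-- Tonelli on the triangle 0 < r ≤ s ≤ t. It replaces differentiation in time throughout, so the
forcing needs no regularity. -/
theorem lintegral_triangle_swap (t : ℝ) {K m : ℝ → ℝ≥0∞} (hK : Measurable K)
    (hm : Measurable m) :
    ∫⁻ s in Ioc 0 t, K s * ∫⁻ r in Ioc 0 s, m r =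
      ∫⁻ r in Ioc 0 t, (∫⁻ s in Ioc r t, K s) * m r := by
  have hmeas : Measurable fun p : ℝ × ℝ =>
      {p : ℝ × ℝ | p.2 ≤ p.1}.indicator (fun p => K p.1 * m p.2) p :=
    ((hK.comp measurable_fst).mul (hm.comp measurable_snd)).indicator measurableSet_triangle
  have h1 : ∀ s ∈ Ioc 0 t, K s * ∫⁻ r in Ioc 0 s, m r = ∫⁻ r in Ioc 0 t,
      {p : ℝ × ℝ | p.2 ≤ p.1}.indicator (fun p => K p.1 * m p.2) (s, r) := by
    intro s hs
    rw [← lintegral_const_mul _ hm]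
    have : Ioc 0 s = Iic s ∩ Ioc 0 t := by
      ext r
      simp only [mem_Ioc, mem_inter_iff, mem_Iic] at hs ⊢
      grind
    rw [this, ← Measure.restrict_restrict measurableSet_Iic,
      ← lintegral_indicator measurableSet_Iic]
    rfl
  have h2 : ∀ᵐ r ∂(volume.restrict (Ioc 0 t)), (∫⁻ s in Ioc 0 t,
      {p : ℝ × ℝ | p.2 ≤ p.1}.indicator (fun p => K p.1 * m p.2) (s, r)) =
        (∫⁻ s in Ioc r t, K s) * m r := by
    filter_upwards [ae_restrict_mem measurableSet_Ioc] with r hr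
    -- The section of the closed triangle at r is [r, t], which differs from (r, t] by a null set.
    rw [← lintegral_mul_const _ hK, Measure.restrict_congr_set (Ioc_ae_eq_Icc (a := r) (b := t))]
    have : Icc r t = Ici r ∩ Ioc 0 t := by
      ext s
      simp only [mem_Icc, mem_inter_iff, mem_Ici, mem_Ioc] at hr ⊢
      grind
    rw [this, ← Measure.restrict_restrict measurableSet_Ici,
      ← lintegral_indicator measurableSet_Ici]
    rfl
  rw [setLIntegral_congr_fun measurableSet_Ioc h1, lintegral_lintegral_swap hmeas.aemeasurable]
  exact lintegral_congr_ae h2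

variable {E : Type*} [NormedAddCommGroup E] [NormedSpace ℝ E] [CompleteSpace E]

theorem integral_triangle_swap (t : ℝ) {K : ℝ → ℝ} {m : ℝ → E}
    (hK : IntegrableOn K (Ioc 0 t)) (hm : IntegrableOn m (Ioc 0 t)) :
    ∫ s in Ioc 0 t, K s • ∫ r in Ioc 0 s, m r =
      ∫ r in Ioc 0 t, (∫ s in Ioc r t, K s) • m r := by
  have hint : Integrable (fun p : ℝ × ℝ =>
      {p : ℝ × ℝ | p.2 ≤ p.1}.indicator (fun p => K p.1 • m p.2) p)
      ((volume.restrict (Ioc 0 t)).prod (volume.restrict (Ioc 0 t))) :=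
    (Integrable.smul_prod hK hm).indicator measurableSet_triangle
  have h1 : ∀ s ∈ Ioc 0 t, K s • ∫ r in Ioc 0 s, m r = ∫ r in Ioc 0 t,
      {p : ℝ × ℝ | p.2 ≤ p.1}.indicator (fun p => K p.1 • m p.2) (s, r) := by
    intro s hs
    rw [← integral_smul]
    have : Ioc 0 s = Iic s ∩ Ioc 0 t := by
      ext r
      simp only [mem_Ioc, mem_inter_iff, mem_Iic] at hs ⊢
      grind
    rw [this, ← Measure.restrict_restrict measurableSet_Iic,
      ← integral_indicator measurableSet_Iic]
    rfl
  have h2 : ∀ᵐ r ∂(volume.restrict (Ioc 0 t)), (∫ s in Ioc 0 t,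
      {p : ℝ × ℝ | p.2 ≤ p.1}.indicator (fun p => K p.1 • m p.2) (s, r)) =
        (∫ s in Ioc r t, K s) • m r := by
    filter_upwards [ae_restrict_mem measurableSet_Ioc] with r hr
    rw [← integral_smul_const, Measure.restrict_congr_set (Ioc_ae_eq_Icc (a := r) (b := t))]
    have : Icc r t = Ici r ∩ Ioc 0 t := by
      ext s
      simp only [mem_Icc, mem_inter_iff, mem_Ici, mem_Ioc] at hr ⊢
      grind
    rw [this, ← Measure.restrict_restrict measurableSet_Ici,
      ← integral_indicator measurableSet_Ici]
    rfl
  rw [setIntegral_congr_fun measurableSet_Ioc h1, integral_integral_swap hint]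
  exact integral_congr_ae h2

end Triangle

theorem integral_Ioc_mul_exp_neg (l : ℝ) {r t : ℝ} (hrt : r ≤ t) :
    ∫ s in Ioc r t, l * Real.exp (-(l * s)) = Real.exp (-(l * r)) - Real.exp (-(l * t)) := by
  rw [← intervalIntegral.integral_of_le hrt]
  have h : ∀ s ∈ uIcc r t, HasDerivAt (fun s => -Real.exp (-(l * s)))
      (l * Real.exp (-(l * s))) s := by
    intro s _
    have := ((((hasDerivAt_id' s).const_mul l).fun_neg).exp).fun_neg
    rwa [mul_one, mul_neg, neg_neg, mul_comm] at this
  rw [intervalIntegral.integral_eq_sub_of_hasDerivAt h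
    ((by fun_prop : Continuous fun s => l * Real.exp (-(l * s))).intervalIntegrable _ _)]
  ring

theorem lintegral_Ioc_mul_exp_neg {l : ℝ} (hl : 0 ≤ l) {r t : ℝ} (hrt : r ≤ t) :
    ∫⁻ s in Ioc r t, ENNReal.ofReal l * ENNReal.ofReal (Real.exp (-(l * s))) =
      ENNReal.ofReal (Real.exp (-(l * r)) - Real.exp (-(l * t))) := by
  rw [← integral_Ioc_mul_exp_neg l hrt, ofReal_integral_eq_lintegral_ofReal]
  · simp only [ENNReal.ofReal_mul hl]
  · exact (by fun_prop : Continuous fun s => l * Real.exp (-(l * s))).integrableOn_Ioc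
  · exact Eventually.of_forall fun s => by positivity

/-- The scalar majorant `exp(-λt) y₀ + ∫₀ᵗ exp(-λ(t-s)) n(s) ds` of Duhamel's formula. -/
noncomputable def duhMajorant (l : ℝ) (y : ℝ≥0∞) (n : ℝ → ℝ≥0∞) (t : ℝ) : ℝ≥0∞ :=
  ENNReal.ofReal (Real.exp (-(l * t))) * y +
    ∫⁻ s in Ioc 0 t, ENNReal.ofReal (Real.exp (-(l * (t - s)))) * n s

/-- The integrated form of y' + λy = n with y(0) = y₀. For each r, exp(-λ(t-r)) and λ times the
integral of exp(-λ(s-r)) over s in (r, t] add up to 1. Working in [0, ∞] avoids any integrability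
assumption and loses nothing of the damping. -/
theorem duhMajorant_add {l : ℝ} (hl : 0 ≤ l) (y : ℝ≥0∞) {n : ℝ → ℝ≥0∞} (hn : Measurable n)
    {t : ℝ} (ht : 0 ≤ t) :
    duhMajorant l y n t + ENNReal.ofReal l * ∫⁻ s in Ioc 0 t, duhMajorant l y n s =
      y + ∫⁻ s in Ioc 0 t, n s := by
  have hexp : ∀ s r : ℝ, ENNReal.ofReal (Real.exp (-(l * (s - r)))) =
      ENNReal.ofReal (Real.exp (-(l * s))) * ENNReal.ofReal (Real.exp (l * r)) := by
    intro s r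
    rw [← ENNReal.ofReal_mul (by positivity), ← Real.exp_add]
    congr 2
    ring
  have hmexp : Measurable fun s : ℝ => ENNReal.ofReal (Real.exp (-(l * s))) := by fun_prop
  have hmn : Measurable fun s : ℝ => ENNReal.ofReal (Real.exp (l * s)) * n s := by fun_prop
  have hB : ∀ s : ℝ, ∫⁻ r in Ioc 0 s, ENNReal.ofReal (Real.exp (-(l * (s - r)))) * n r =
      ENNReal.ofReal (Real.exp (-(l * s))) *
        ∫⁻ r in Ioc 0 s, ENNReal.ofReal (Real.exp (l * r)) * n r := by
    intro s
    rw [← lintegral_const_mul _ hmn]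
    simp only [hexp, mul_assoc]
  have h1 : ENNReal.ofReal l * ∫⁻ s in Ioc 0 t, duhMajorant l y n s =
      ENNReal.ofReal (1 - Real.exp (-(l * t))) * y +
      ∫⁻ r in Ioc 0 t, ENNReal.ofReal (Real.exp (-(l * r)) - Real.exp (-(l * t))) *
        (ENNReal.ofReal (Real.exp (l * r)) * n r) := by
    simp only [duhMajorant]
    rw [lintegral_add_left (hmexp.mul_const y), mul_add]
    congr 1
    · rw [lintegral_mul_const _ hmexp, ← mul_assoc, ← lintegral_const_mul _ hmexp,
        lintegral_Ioc_mul_exp_neg hl ht]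
      simp
    · simp only [hB]
      rw [← lintegral_const_mul' _ _ ENNReal.ofReal_ne_top]
      simp only [← mul_assoc (ENNReal.ofReal l)]
      rw [lintegral_triangle_swap t (hmexp.const_mul _) hmn]
      refine setLIntegral_congr_fun measurableSet_Ioc fun r hr => ?_
      simp only [lintegral_Ioc_mul_exp_neg hl hr.2]
  rw [h1, duhMajorant, add_add_add_comm, ← add_mul, ← ENNReal.ofReal_add (by positivity)
    (by rw [sub_nonneg, Real.exp_le_one_iff]; nlinarith [mul_nonneg hl ht])]
  have h2 : ENNReal.ofReal (Real.exp (-(l * t)) + (1 - Real.exp (-(l * t)))) = 1 := by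
    rw [add_sub_cancel, ENNReal.ofReal_one]
  rw [h2, one_mul, ← lintegral_add_left (by fun_prop)]
  congr 1
  refine setLIntegral_congr_fun measurableSet_Ioc fun r hr => ?_
  have h3 : 0 ≤ Real.exp (-(l * r)) - Real.exp (-(l * t)) := by
    rw [sub_nonneg, Real.exp_le_exp]
    nlinarith [mul_le_mul_of_nonneg_left hr.2 hl]
  rw [← mul_assoc, ← add_mul, ← ENNReal.ofReal_mul h3, ← ENNReal.ofReal_add (by positivity)
    (by positivity)]
  have h4 : Real.exp (-(l * (t - r))) + (Real.exp (-(l * r)) - Real.exp (-(l * t))) *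
      Real.exp (l * r) = 1 := by
    rw [sub_mul, ← Real.exp_add, ← Real.exp_add]
    have : -(l * (t - r)) = -(l * t) + l * r := by ring
    rw [this]
    simp
  rw [h4, ENNReal.ofReal_one, one_mul]

section Duhamel

variable {E : Type*} [NormedAddCommGroup E] [NormedSpace ℝ E]

/-- Duhamel's formula `exp(-λt) y₀ + ∫₀ᵗ exp(-λ(t-s)) n(s) ds`. -/
noncomputable def duh (l : ℝ) (y : E) (n : ℝ → E) (t : ℝ) : E :=
  Real.exp (-(l * t)) • y + ∫ s in Ioc 0 t, Real.exp (-(l * (t - s))) • n s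

theorem enorm_duh_le (l : ℝ) (y : E) (n : ℝ → E) (t : ℝ) :
    ‖duh l y n t‖ₑ ≤ duhMajorant l ‖y‖ₑ (fun s => ‖n s‖ₑ) t := by
  have h : ∀ (r : ℝ) (v : E), ‖Real.exp r • v‖ₑ = ENNReal.ofReal (Real.exp r) * ‖v‖ₑ := by
    intro r v
    rw [enorm_smul, Real.enorm_of_nonneg (Real.exp_pos r).le]
  refine (enorm_add_le _ _).trans ?_
  rw [h, duhMajorant]
  gcongr
  refine (enorm_integral_le_lintegral_enorm _).trans_eq ?_
  simp only [h]

theorem duh_zero (l : ℝ) (y : E) (n : ℝ → E) : duh l y n 0 = y := by simp [duh]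

theorem integrableOn_exp_smul {n : ℝ → E} {t : ℝ} (hn : IntegrableOn n (Ioc 0 t)) (l : ℝ) :
    IntegrableOn (fun s => Real.exp (l * s) • n s) (Ioc 0 t) := by
  have hc : ContinuousOn (fun s => Real.exp (l * s)) (Icc 0 t) := by fun_prop
  have h := ((integrableOn_Icc_iff_integrableOn_Ioc).2 hn).continuousOn_smul hc isCompact_Icc
  exact h.mono_set Ioc_subset_Icc_self

theorem exp_smul_setIntegral (n : ℝ → E) (l t : ℝ) :
    ∫ s in Ioc 0 t, Real.exp (-(l * (t - s))) • n s =
      Real.exp (-(l * t)) • ∫ s in Ioc 0 t, Real.exp (l * s) • n s := by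
  rw [← integral_smul]
  congr 1
  funext s
  rw [smul_smul, ← Real.exp_add]
  congr 2
  ring

/-- A function of the form `R(t) = ∫₀ᵗ (-λ R + n)` is given by Duhamel's formula. -/
theorem eq_duh_of_integral_eq [CompleteSpace E] {l t : ℝ} {f n : ℝ → E} (hf : IntegrableOn f (Ioc 0 t))
    (hn : IntegrableOn n (Ioc 0 t))
    (h : ∀ᵐ s ∂(volume.restrict (Ioc 0 t)), f s = ∫ r in Ioc 0 s, (-(l • f r) + n r)) :
    ∫ s in Ioc 0 t, (-(l • f s) + n s) = duh l 0 n t := by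
  set q : ℝ → E := fun s => -(l • f s) + n s with hq
  have hqi : IntegrableOn q (Ioc 0 t) := (hf.smul l).neg.add hn
  -- Formally (exp(λs) R)' = exp(λs) n with R' = q. Since exp(λs) n = exp(λs) q + λ exp(λs) R,
  -- exchanging the order of integration in the last term replaces this differentiation.
  have h1 : ∫ s in Ioc 0 t, Real.exp (l * s) • n s = (∫ s in Ioc 0 t, Real.exp (l * s) • q s) +
      ∫ s in Ioc 0 t, (l * Real.exp (l * s)) • ∫ r in Ioc 0 s, q r := by
    rw [← integral_add]
    · refine integral_congr_ae (h.mono fun s hs => ?_)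
      simp only
      rw [← hs]
      simp only [hq]
      module
    · exact integrableOn_exp_smul hqi l
    · have : IntegrableOn (fun s => (l * Real.exp (l * s)) • f s) (Ioc 0 t) := by
        simp only [mul_smul]
        exact (integrableOn_exp_smul hf l).fun_smul l
      exact this.congr (h.mono fun s hs => by simp only [← hs])
  have h2 : ∀ r ∈ Ioc 0 t, ∫ s in Ioc r t, l * Real.exp (l * s) =
      Real.exp (l * t) - Real.exp (l * r) := by
    intro r hr
    have := integral_Ioc_mul_exp_neg (-l) hr.2
    simp only [neg_mul, neg_neg, integral_neg] at this
    linarith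
  rw [duh, smul_zero, zero_add, exp_smul_setIntegral, h1,
    integral_triangle_swap t
      (by fun_prop : Continuous fun s => l * Real.exp (l * s)).integrableOn_Ioc hqi,
    ← integral_add (integrableOn_exp_smul hqi l)]
  · rw [← integral_smul]
    refine setIntegral_congr_fun measurableSet_Ioc fun s hs => ?_
    simp only [h2 s hs]
    rw [← add_smul, smul_smul, add_sub_cancel, ← Real.exp_add, neg_add_cancel, Real.exp_zero,
      one_smul]
  · have h3 : IntegrableOn (fun s => Real.exp (l * t) • q s - Real.exp (l * s) • q s)
        (Ioc 0 t) := (hqi.smul (Real.exp (l * t))).sub (integrableOn_exp_smul hqi l)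
    refine h3.congr_fun (fun s hs => ?_) measurableSet_Ioc
    simp only [h2 s hs, sub_smul]

theorem continuous_setIntegral_Ioc {n : ℝ → E} {t : ℝ} (hn : IntegrableOn n (Ioc 0 t)) :
    ContinuousOn (fun s => ∫ r in Ioc 0 s, n r) (Icc 0 t) := by
  have h := intervalIntegral.continuousOn_primitive
    ((integrableOn_Icc_iff_integrableOn_Ioc).2 hn)
  exact h

theorem continuousOn_duh {l t : ℝ} {n : ℝ → E} (hn : IntegrableOn n (Ioc 0 t)) (y : E) :
    ContinuousOn (duh l y n) (Icc 0 t) := by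
  have h : duh l y n = fun s => Real.exp (-(l * s)) • y +
      Real.exp (-(l * s)) • ∫ r in Ioc 0 s, Real.exp (l * r) • n r := by
    funext s
    rw [duh, exp_smul_setIntegral]
  rw [h]
  have := continuous_setIntegral_Ioc (integrableOn_exp_smul hn l)
  fun_prop

/-- Duhamel's formula solves the integrated equation. -/
theorem duh_eq_add_integral [CompleteSpace E] {l t : ℝ} (ht : 0 ≤ t) {n : ℝ → E} (hn : IntegrableOn n (Ioc 0 t))
    (y : E) :
    duh l y n t = y + ∫ s in Ioc 0 t, (-(l • duh l y n s) + n s) := by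
  have hd : IntegrableOn (duh l y n) (Ioc 0 t) :=
    ((continuousOn_duh hn y).integrableOn_Icc).mono_set Ioc_subset_Icc_self
  have he : IntegrableOn (fun s => l * Real.exp (-(l * s))) (Ioc 0 t) :=
    (by fun_prop : Continuous fun s => l * Real.exp (-(l * s))).integrableOn_Ioc
  have hm := integrableOn_exp_smul hn l
  have h1 : ∫ s in Ioc 0 t, l • duh l y n s = (1 - Real.exp (-(l * t))) • y +
      ∫ r in Ioc 0 t, (Real.exp (-(l * r)) - Real.exp (-(l * t))) • Real.exp (l * r) • n r := by
    have h2 : ∀ s, l • duh l y n s = (l * Real.exp (-(l * s))) • y +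
        (l * Real.exp (-(l * s))) • ∫ r in Ioc 0 s, Real.exp (l * r) • n r := by
      intro s
      rw [duh, exp_smul_setIntegral, smul_add, smul_smul, smul_smul]
    simp only [h2]
    rw [integral_add (Integrable.smul_const he y), integral_smul_const,
      integral_Ioc_mul_exp_neg l ht, integral_triangle_swap t he hm]
    · simp only [mul_zero, neg_zero, Real.exp_zero]
      congr 1
      refine setIntegral_congr_fun measurableSet_Ioc fun r hr => ?_
      simp only [integral_Ioc_mul_exp_neg l hr.2]
    · have : IntegrableOn (fun s => l • duh l y n s - (l * Real.exp (-(l * s))) • y) (Ioc 0 t) :=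
        (hd.smul l).sub (Integrable.smul_const he y)
      refine this.congr (Eventually.of_forall fun s => ?_)
      simp only [h2]
      abel
  have hd' : IntegrableOn (fun s => -(l • duh l y n s)) (Ioc 0 t) := (hd.fun_smul l).fun_neg
  rw [integral_add hd' hn, integral_neg, h1, duh, exp_smul_setIntegral]
  have h3 : ∫ r in Ioc 0 t,
      (Real.exp (-(l * r)) - Real.exp (-(l * t))) • Real.exp (l * r) • n r =
      (∫ r in Ioc 0 t, n r) - Real.exp (-(l * t)) • ∫ r in Ioc 0 t, Real.exp (l * r) • n r := by
    have hm' : IntegrableOn (fun r => Real.exp (-(l * t)) • Real.exp (l * r) • n r) (Ioc 0 t) :=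
      hm.fun_smul _
    rw [← integral_smul, ← integral_sub hn hm']
    congr 1
    funext r
    rw [sub_smul, smul_smul (Real.exp (-(l * r))), ← Real.exp_add, neg_add_cancel, Real.exp_zero,
      one_smul]
  rw [h3]
  module

end Duhamel

/-! ### The Leray projector -/

theorem toC3_apply (x : R3) (i : Fin 3) : toC3 x i = (x i : ℂ) := rfl

theorem norm_toC3 (x : R3) : ‖toC3 x‖ = ‖x‖ := by
  rw [EuclideanSpace.norm_eq, EuclideanSpace.norm_eq]
  simp [toC3_apply]

theorem inner_toC3 (x : R3) (v : C3) : inner ℂ (toC3 x) v = ∑ j : Fin 3, (x j : ℂ) * v j := by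
  simp [PiLp.inner_apply, toC3_apply, mul_comm]

theorem continuous_toC3 : Continuous toC3 := by
  unfold toC3
  fun_prop

/-- The bilinear product `ξ · v` for a frequency `ξ` and `v ∈ ℂ³`. -/
noncomputable def fdot (ξ : R3) (v : C3) : ℂ := ∑ j : Fin 3, (ξ j : ℂ) * v j

theorem fdot_eq_inner (ξ : R3) (v : C3) : fdot ξ v = inner ℂ (toC3 ξ) v := (inner_toC3 ξ v).symm

theorem norm_fdot_le (ξ : R3) (v : C3) : ‖fdot ξ v‖ ≤ ‖ξ‖ * ‖v‖ := by
  rw [fdot_eq_inner, ← norm_toC3 ξ]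
  exact norm_inner_le_norm _ _

theorem enorm_fdot_le (ξ : R3) (v : C3) : ‖fdot ξ v‖ₑ ≤ ENNReal.ofReal ‖ξ‖ * ‖v‖ₑ := by
  rw [← ofReal_norm, ← ofReal_norm, ← ENNReal.ofReal_mul (norm_nonneg _)]
  exact ENNReal.ofReal_le_ofReal (norm_fdot_le ξ v)

theorem continuous_fdot : Continuous fun p : R3 × C3 => fdot p.1 p.2 := by
  unfold fdot
  fun_prop

theorem fdot_sub (ξ : R3) (v w : C3) : fdot ξ (v - w) = fdot ξ v - fdot ξ w := by
  simp only [fdot_eq_inner, inner_sub_right]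

/-- The Leray projector at the frequency `ξ`: the orthogonal projection on `ξ^⊥`. -/
noncomputable def leray (ξ : R3) : C3 →L[ℂ] C3 := (ℂ ∙ toC3 ξ)ᗮ.starProjection

/-- At ξ = 0 the line spanned by ξ is trivial and the projector is the identity. The formula agrees,
because the quotient by 0 is 0. -/
theorem leray_apply (ξ : R3) (v : C3) :
    leray ξ v = v - (fdot ξ v / ((‖ξ‖ ^ 2 : ℝ) : ℂ)) • toC3 ξ := by
  rw [leray, Submodule.starProjection_orthogonal', fdot_eq_inner, ← norm_toC3]
  simp [Submodule.starProjection_singleton]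

theorem norm_leray_le (ξ : R3) (v : C3) : ‖leray ξ v‖ ≤ ‖v‖ :=
  Submodule.norm_starProjection_apply_le _ _

theorem enorm_leray_le (ξ : R3) (v : C3) : ‖leray ξ v‖ₑ ≤ ‖v‖ₑ := by
  rw [← ofReal_norm, ← ofReal_norm]
  exact ENNReal.ofReal_le_ofReal (norm_leray_le ξ v)

theorem leray_eq_self_iff (ξ : R3) (v : C3) : leray ξ v = v ↔ fdot ξ v = 0 := by
  rw [leray, Submodule.starProjection_eq_self_iff, Submodule.mem_orthogonal_singleton_iff_inner_right,
    fdot_eq_inner]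

theorem leray_leray (ξ : R3) (v : C3) : leray ξ (leray ξ v) = leray ξ v := by
  rw [leray, Submodule.starProjection_eq_self_iff]
  exact Submodule.starProjection_apply_mem _ _

theorem measurable_leray : Measurable fun p : R3 × C3 => leray p.1 p.2 := by
  simp only [leray_apply]
  have h1 := continuous_fdot.measurable
  have h2 : Measurable fun p : R3 × C3 => ((‖p.1‖ ^ 2 : ℝ) : ℂ) := by fun_prop
  have h3 : Measurable fun p : R3 × C3 => toC3 p.1 := (continuous_toC3.comp continuous_fst).measurable
  exact measurable_snd.sub ((h1.div h2).smul h3)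

/-- The Leray projector kills vectors parallel to the frequency. -/
theorem leray_eq_zero_of_curl {ξ : R3} (hξ : ξ ≠ 0) {v : C3}
    (h : ∀ i k : Fin 3, (ξ k : ℂ) * v i = (ξ i : ℂ) * v k) : leray ξ v = 0 := by
  rw [leray_apply, sub_eq_zero]
  have hn : ((‖ξ‖ ^ 2 : ℝ) : ℂ) ≠ 0 := by
    exact_mod_cast (pow_pos (norm_pos_iff.2 hξ) 2).ne'
  ext i
  rw [PiLp.smul_apply, smul_eq_mul, toC3_apply, div_mul_eq_mul_div, eq_div_iff hn,
    EuclideanSpace.norm_sq_eq, fdot, Finset.sum_mul]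
  push_cast
  rw [Finset.mul_sum]
  refine Finset.sum_congr rfl fun k _ => ?_
  have := h i k
  rw [← Complex.ofReal_pow, Real.norm_eq_abs, sq_abs]
  push_cast
  linear_combination (ξ k : ℂ) * this

/-- Componentwise complex conjugation of `ℂ³`. -/
noncomputable def conjC3 : C3 ≃ₗᵢ[ℝ] C3 :=
  LinearIsometryEquiv.piLpCongrRight 2 fun _ => Complex.conjLIE

theorem conjC3_apply (v : C3) (i : Fin 3) : conjC3 v i = (starRingEnd ℂ) (v i) := rfl

theorem conjC3_conjC3 (v : C3) : conjC3 (conjC3 v) = v := by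
  ext i
  simp [conjC3_apply]

theorem conjC3_smul (c : ℂ) (v : C3) : conjC3 (c • v) = (starRingEnd ℂ) c • conjC3 v := by
  ext i
  simp [conjC3_apply]

theorem toC3_neg (ξ : R3) : toC3 (-ξ) = -toC3 ξ := by
  ext i
  simp [toC3_apply]

theorem conjC3_toC3 (ξ : R3) : conjC3 (toC3 ξ) = toC3 ξ := by
  ext i
  simp [conjC3_apply, toC3_apply]

theorem fdot_neg_conj (ξ : R3) (v : C3) :
    fdot (-ξ) (conjC3 v) = -(starRingEnd ℂ) (fdot ξ v) := by
  simp [fdot, conjC3_apply]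

/-- The projector respects the symmetry of Fourier transforms of real fields, so projecting the
quadratic term keeps the velocity real. -/
theorem leray_neg_conj (ξ : R3) (v : C3) : leray (-ξ) (conjC3 v) = conjC3 (leray ξ v) := by
  rw [leray_apply, leray_apply, map_sub, conjC3_smul, conjC3_toC3, toC3_neg, fdot_neg_conj,
    norm_neg, map_div₀, Complex.conj_ofReal, neg_div, neg_smul, smul_neg, neg_neg]

/-! ### The quadratic term on the Fourier side -/

/-- The convolution `∫ (ξ · f(η)) g(ξ - η) dη`; up to constants, the Fourier transform of
`div (f ⊗ g)`. -/
noncomputable def transport (f g : R3 → C3) (ξ : R3) : C3 := ∫ η, fdot ξ (f η) • g (ξ - η)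

/-- The projected quadratic term `- i (2π)⁻³ P(ξ) ∫ (ξ · f(η)) g(ξ - η) dη`. -/
noncomputable def nlin (f g : R3 → C3) (ξ : R3) : C3 :=
  (-(Complex.I * (fourConst : ℂ))) • leray ξ (transport f g ξ)

/-- The convolution of the absolute values. -/
noncomputable def absConv (f g : R3 → C3) (ξ : R3) : ℝ≥0∞ := ∫⁻ η, ‖f η‖ₑ * ‖g (ξ - η)‖ₑ

/-- A majorant of the quadratic term. -/
noncomputable def nlinMaj (f g : R3 → C3) (ξ : R3) : ℝ≥0∞ :=
  ENNReal.ofReal fourConst * (ENNReal.ofReal ‖ξ‖ * absConv f g ξ)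

theorem enorm_transport_le (f g : R3 → C3) (ξ : R3) :
    ‖transport f g ξ‖ₑ ≤ ENNReal.ofReal ‖ξ‖ * absConv f g ξ := by
  rw [transport, absConv, ← lintegral_const_mul' _ _ ENNReal.ofReal_ne_top]
  refine (enorm_integral_le_lintegral_enorm _).trans (lintegral_mono fun η => ?_)
  rw [enorm_smul, ← mul_assoc]
  gcongr
  exact enorm_fdot_le ξ _

theorem enorm_nlin_coeff : ‖-(Complex.I * (fourConst : ℂ))‖ₑ = ENNReal.ofReal fourConst := by
  rw [← ofReal_norm, norm_neg, norm_mul, Complex.norm_I, one_mul, Complex.norm_real,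
    Real.norm_of_nonneg fourConst_pos.le]

theorem enorm_nlin_le (f g : R3 → C3) (ξ : R3) : ‖nlin f g ξ‖ₑ ≤ nlinMaj f g ξ := by
  rw [nlin, enorm_smul, enorm_nlin_coeff, nlinMaj]
  gcongr
  exact (enorm_leray_le _ _).trans (enorm_transport_le f g ξ)

theorem lintegral_conv {F G : R3 → ℝ≥0∞} (hF : Measurable F) (hG : Measurable G) :
    ∫⁻ ξ, ∫⁻ η, F η * G (ξ - η) = (∫⁻ η, F η) * ∫⁻ η, G η := by
  rw [lintegral_lintegral_swap]
  · have : ∀ η, ∫⁻ ξ, F η * G (ξ - η) = F η * ∫⁻ ξ, G ξ := fun η => by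
      rw [lintegral_const_mul _ (by fun_prop : Measurable fun ξ => G (ξ - η)),
        lintegral_sub_right_eq_self G η]
    simp only [this]
    rw [lintegral_mul_const _ hF]
  · exact ((hF.comp measurable_snd).mul
      (hG.comp (measurable_fst.sub measurable_snd))).aemeasurable

theorem lintegral_absConv {f g : R3 → C3} (hf : Measurable f) (hg : Measurable g) :
    ∫⁻ ξ, absConv f g ξ = (∫⁻ η, ‖f η‖ₑ) * ∫⁻ η, ‖g η‖ₑ :=
  lintegral_conv hf.enorm hg.enorm

/-- The key bilinear estimate in the Lei-Lin-Gevrey norms. -/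
theorem lintegral_nlinMaj_le {a σ : ℝ} (ha : 0 < a) (hσ : 1 < σ) {ε : ℝ} (hε : 0 < ε)
    {f g : R3 → C3} (hf : Measurable f) (hg : Measurable g) :
    ∫⁻ ξ, wt (-1) a σ ξ * nlinMaj f g ξ ≤ ENNReal.ofReal fourConst *
      (ENNReal.ofReal ε * (zInt 1 a σ f * zInt (-1) a σ g) +
        ENNReal.ofReal ε⁻¹ * (zInt (-1) a σ f * zInt 1 a σ g)) := by
  have hm : ∀ (ρ : ℝ) {h : R3 → C3}, Measurable h → Measurable fun η => wt ρ a σ η * ‖h η‖ₑ :=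
    fun ρ h hh => (measurable_wt ρ a σ).mul hh.enorm
  have h1 : ∀ ξ, wt (-1) a σ ξ * nlinMaj f g ξ ≤ ENNReal.ofReal fourConst *
      (ENNReal.ofReal ε *
          (∫⁻ η, wt 1 a σ η * ‖f η‖ₑ * (wt (-1) a σ (ξ - η) * ‖g (ξ - η)‖ₑ)) +
        ENNReal.ofReal ε⁻¹ *
          ∫⁻ η, wt (-1) a σ η * ‖f η‖ₑ * (wt 1 a σ (ξ - η) * ‖g (ξ - η)‖ₑ)) := by
    intro ξ
    rw [nlinMaj, mul_left_comm]
    gcongr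
    rw [← mul_assoc]
    -- The derivative cancels |ξ|⁻¹. Only the weight of order 0 is left, and it splits along ξ = η +
    -- (ξ - η).
    refine (mul_le_mul_left (wt_neg_one_mul_norm_le a σ ξ) _).trans ?_
    rw [absConv, ← lintegral_const_mul' _ _ (wt_ne_top _ _ _ _),
      ← lintegral_const_mul' _ _ ENNReal.ofReal_ne_top,
      ← lintegral_const_mul' _ _ ENNReal.ofReal_ne_top, ← lintegral_add_left]
    · refine lintegral_mono_ae ?_
      -- At the origin the weight of order -1 takes the default value 0 instead of ∞, so the points
      -- η = 0 and η = ξ are discarded.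
      have hne : ∀ᵐ η : R3, η ≠ ξ := by simp [ae_iff, measure_singleton]
      filter_upwards [ae_ne_zero, hne] with η h0 hη
      have h2 : wt 0 a σ ξ ≤ wt 0 a σ η * wt 0 a σ (ξ - η) := by
        simpa using wt_zero_add_le ha hσ η (ξ - η)
      have h3 := h2.trans (wt_zero_mul_le a σ hε h0 (sub_ne_zero.2 hη.symm))
      refine (mul_le_mul_left h3 _).trans_eq ?_
      ring
    · exact ((hm 1 hf).mul ((hm (-1) hg).comp (measurable_const.sub measurable_id))).const_mul _
  refine (lintegral_mono h1).trans_eq ?_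
  rw [lintegral_const_mul' _ _ ENNReal.ofReal_ne_top, lintegral_add_left,
    lintegral_const_mul' _ _ ENNReal.ofReal_ne_top,
    lintegral_const_mul' _ _ ENNReal.ofReal_ne_top, lintegral_conv (hm 1 hf) (hm (-1) hg),
    lintegral_conv (hm (-1) hf) (hm 1 hg)]
  · rfl
  · refine Measurable.const_mul (Measurable.lintegral_prod_right' (f := fun p : R3 × R3 =>
      wt 1 a σ p.2 * ‖f p.2‖ₑ * (wt (-1) a σ (p.1 - p.2) * ‖g (p.1 - p.2)‖ₑ)) ?_) _
    exact ((hm 1 hf).comp measurable_snd).mul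
      ((hm (-1) hg).comp (measurable_fst.sub measurable_snd))

/-- The equality holds at every ξ although the arguments agree only almost everywhere. This lets the
Picard fixed point be upgraded from almost every frequency to every frequency. -/
theorem transport_congr {f f' g g' : R3 → C3} (hf : f =ᵐ[volume] f') (hg : g =ᵐ[volume] g')
    (ξ : R3) : transport f g ξ = transport f' g' ξ := by
  have h : (fun η => g (ξ - η)) =ᵐ[volume] fun η => g' (ξ - η) :=
    (quasiMeasurePreserving_sub_left volume ξ).ae_eq_comp hg
  refine integral_congr_ae ?_
  filter_upwards [hf, h] with η h1 h2
  simp only [h1, h2]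

theorem nlin_congr {f f' g g' : R3 → C3} (hf : f =ᵐ[volume] f') (hg : g =ᵐ[volume] g')
    (ξ : R3) : nlin f g ξ = nlin f' g' ξ := by
  rw [nlin, nlin, transport_congr hf hg]

theorem transport_neg_conj {f g : R3 → C3} (hf : ∀ η, f (-η) = conjC3 (f η))
    (hg : ∀ η, g (-η) = conjC3 (g η)) (ξ : R3) :
    transport f g (-ξ) = -conjC3 (transport f g ξ) := by
  have h1 : conjC3 (transport f g ξ) = ∫ η, conjC3 (fdot ξ (f η) • g (ξ - η)) :=
    (conjC3.toContinuousLinearEquiv.integral_comp_comm _).symm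
  rw [h1, transport, ← integral_neg_eq_self, ← integral_neg]
  refine integral_congr_ae (Eventually.of_forall fun η => ?_)
  have h2 : -ξ - -η = -(ξ - η) := by abel
  simp only [hf, h2, hg, fdot_neg_conj, conjC3_smul, neg_smul]

theorem nlin_neg_conj {f g : R3 → C3} (hf : ∀ η, f (-η) = conjC3 (f η))
    (hg : ∀ η, g (-η) = conjC3 (g η)) (ξ : R3) : nlin f g (-ξ) = conjC3 (nlin f g ξ) := by
  rw [nlin, nlin, transport_neg_conj hf hg, map_neg, leray_neg_conj, conjC3_smul]
  simp

theorem leray_nlin (f g : R3 → C3) (ξ : R3) : leray ξ (nlin f g ξ) = nlin f g ξ := by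
  rw [nlin, map_smul, leray_leray]

theorem measurable_transport {α : Type*} [MeasurableSpace α] {U V : α → R3 → C3}
    (hU : Measurable (Function.uncurry U)) (hV : Measurable (Function.uncurry V)) :
    Measurable (Function.uncurry fun s => transport (U s) (V s)) := by
  have h1 : Measurable fun q : (α × R3) × R3 => U q.1.1 q.2 :=
    hU.comp ((measurable_fst.comp measurable_fst).prodMk measurable_snd)
  have h2 : Measurable fun q : (α × R3) × R3 => V q.1.1 (q.1.2 - q.2) :=
    hV.comp ((measurable_fst.comp measurable_fst).prodMk
      ((measurable_snd.comp measurable_fst).sub measurable_snd))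
  have h3 : Measurable fun q : (α × R3) × R3 => fdot q.1.2 (U q.1.1 q.2) :=
    continuous_fdot.measurable.comp ((measurable_snd.comp measurable_fst).prodMk h1)
  exact ((h3.smul h2).stronglyMeasurable.integral_prod_right').measurable

theorem measurable_nlin {α : Type*} [MeasurableSpace α] {U V : α → R3 → C3}
    (hU : Measurable (Function.uncurry U)) (hV : Measurable (Function.uncurry V)) :
    Measurable (Function.uncurry fun s => nlin (U s) (V s)) :=
  (measurable_leray.comp (measurable_snd.prodMk (measurable_transport hU hV))).fun_const_smul _

theorem measurable_absConv {α : Type*} [MeasurableSpace α] {U V : α → R3 → C3}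
    (hU : Measurable (Function.uncurry U)) (hV : Measurable (Function.uncurry V)) :
    Measurable (Function.uncurry fun s => absConv (U s) (V s)) := by
  have h1 : Measurable fun q : (α × R3) × R3 => U q.1.1 q.2 :=
    hU.comp ((measurable_fst.comp measurable_fst).prodMk measurable_snd)
  have h2 : Measurable fun q : (α × R3) × R3 => V q.1.1 (q.1.2 - q.2) :=
    hV.comp ((measurable_fst.comp measurable_fst).prodMk
      ((measurable_snd.comp measurable_fst).sub measurable_snd))
  exact (h1.enorm.mul h2.enorm).lintegral_prod_right'

theorem measurable_nlinMaj {α : Type*} [MeasurableSpace α] {U V : α → R3 → C3}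
    (hU : Measurable (Function.uncurry U)) (hV : Measurable (Function.uncurry V)) :
    Measurable (Function.uncurry fun s => nlinMaj (U s) (V s)) :=
  ((ENNReal.measurable_ofReal.comp measurable_snd.norm).mul
    (measurable_absConv hU hV)).const_mul _

theorem ae_integrable_transport {f g : R3 → C3} (hf : Integrable f) (hg : Integrable g) :
    ∀ᵐ ξ, Integrable fun η => fdot ξ (f η) • g (ξ - η) := by
  filter_upwards [hf.norm.ae_convolution_exists (ContinuousLinearMap.mul ℝ ℝ) hg.norm] with ξ hξ
  have h1 : Integrable fun η => ‖f η‖ * ‖g (ξ - η)‖ := hξ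
  refine (h1.const_mul ‖ξ‖).mono' ?_ (Eventually.of_forall fun η => ?_)
  · have hc : Continuous fun v : C3 => fdot ξ v := by
      unfold fdot
      fun_prop
    refine AEStronglyMeasurable.smul (hc.comp_aestronglyMeasurable hf.1) ?_
    exact hg.1.comp_quasiMeasurePreserving
        (quasiMeasurePreserving_sub_left volume ξ)
  · rw [norm_smul, ← mul_assoc]
    gcongr
    exact norm_fdot_le _ _

/-- f⊗f - g⊗g = (f-g)⊗f + g⊗(f-g). It holds only almost everywhere, because the convolution
integrals converge only there. -/
theorem transport_sub_transport {f g : R3 → C3} (hf : Integrable f) (hg : Integrable g) :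
    ∀ᵐ ξ, transport f f ξ - transport g g ξ =
      transport (f - g) f ξ + transport g (f - g) ξ := by
  filter_upwards [ae_integrable_transport hf hf, ae_integrable_transport hg hg,
    ae_integrable_transport (hf.sub hg) hf, ae_integrable_transport hg (hf.sub hg)]
    with ξ h1 h2 h3 h4
  rw [transport, transport, transport, transport, ← integral_sub h1 h2, ← integral_add h3 h4]
  refine integral_congr_ae (Eventually.of_forall fun η => ?_)
  simp only [Pi.sub_apply, fdot_sub]
  module

theorem enorm_nlin_sub_nlin_le {f g : R3 → C3} (hf : Integrable f) (hg : Integrable g) :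
    ∀ᵐ ξ, ‖nlin f f ξ - nlin g g ξ‖ₑ ≤ nlinMaj (f - g) f ξ + nlinMaj g (f - g) ξ := by
  filter_upwards [transport_sub_transport hf hg] with ξ hξ
  have h : nlin f f ξ - nlin g g ξ = nlin (f - g) f ξ + nlin g (f - g) ξ := by
    simp only [nlin]
    rw [← smul_sub, ← map_sub, hξ, map_add, smul_add]
  rw [h]
  exact (enorm_add_le _ _).trans (add_le_add (enorm_nlin_le _ _ _) (enorm_nlin_le _ _ _))

theorem transport_coord {f g : R3 → C3} (hf : Integrable f) (hg : Integrable g) (i : Fin 3) :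
    ∀ᵐ ξ : R3, transport f g ξ i = ∑ j : Fin 3, (ξ j : ℂ) * ∫ η, f η j * g (ξ - η) i := by
  have h : ∀ j : Fin 3, ∀ᵐ ξ, Integrable fun η => f η j * g (ξ - η) i := by
    intro j
    have := (integrable_coord hf j).ae_convolution_exists (ContinuousLinearMap.mul ℂ ℂ)
      (integrable_coord hg i)
    exact this
  filter_upwards [ae_integrable_transport hf hg, ae_all_iff.2 h] with ξ h1 h2
  rw [transport, integral_coord h1]
  simp only [PiLp.smul_apply, smul_eq_mul, fdot, Finset.sum_mul, mul_assoc]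
  rw [integral_finsetSum _ fun j _ => (h2 j).const_mul _]
  simp only [integral_const_mul]

/-! ### Linear estimates for the heat flow -/

/-- Duhamel's formula for the heat equation on the Fourier side. -/
noncomputable def mild (ν : ℝ) (g : R3 → C3) (N : ℝ → R3 → C3) (t : ℝ) (ξ : R3) : C3 :=
  duh (ν * ‖ξ‖ ^ 2) (g ξ) (fun s => N s ξ) t

/-! ### Joint measurability of time integrals and of Duhamel's formula. -/

theorem measurableSet_Ioc_fst {α : Type*} [MeasurableSpace α] {τ : α → ℝ} (hτ : Measurable τ) :
    MeasurableSet {q : α × ℝ | q.2 ∈ Ioc 0 (τ q.1)} :=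
  (measurableSet_lt measurable_const measurable_snd).inter
    (measurableSet_le measurable_snd (hτ.comp measurable_fst))

/-- The moving endpoint is absorbed into the indicator of a measurable set of pairs, leaving an
ordinary parameter integral. -/
theorem measurable_setIntegral_Ioc {α E : Type*} [MeasurableSpace α] [NormedAddCommGroup E]
    [NormedSpace ℝ E] [MeasurableSpace E] [BorelSpace E] [SecondCountableTopology E]
    {τ : α → ℝ} (hτ : Measurable τ) {f : α → ℝ → E}
    (hf : Measurable (Function.uncurry f)) : Measurable fun p => ∫ s in Ioc 0 (τ p), f p s := by
  have h : (fun p => ∫ s in Ioc 0 (τ p), f p s) = fun p =>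
      ∫ s, {q : α × ℝ | q.2 ∈ Ioc 0 (τ q.1)}.indicator (Function.uncurry f) (p, s) := by
    funext p
    rw [← integral_indicator measurableSet_Ioc]
    rfl
  rw [h]
  exact (hf.indicator (measurableSet_Ioc_fst hτ)).stronglyMeasurable.integral_prod_right'.measurable

theorem measurable_setLIntegral_Ioc {α : Type*} [MeasurableSpace α]
    {τ : α → ℝ} (hτ : Measurable τ) {f : α → ℝ → ℝ≥0∞}
    (hf : Measurable (Function.uncurry f)) : Measurable fun p => ∫⁻ s in Ioc 0 (τ p), f p s := by
  have h : (fun p => ∫⁻ s in Ioc 0 (τ p), f p s) = fun p =>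
      ∫⁻ s, {q : α × ℝ | q.2 ∈ Ioc 0 (τ q.1)}.indicator (Function.uncurry f) (p, s) := by
    funext p
    rw [← lintegral_indicator measurableSet_Ioc]
    rfl
  rw [h]
  exact (hf.indicator (measurableSet_Ioc_fst hτ)).lintegral_prod_right'

theorem measurable_mild (ν : ℝ) {g : R3 → C3} (hg : Measurable g) {N : ℝ → R3 → C3}
    (hN : Measurable (Function.uncurry N)) :
    Measurable (Function.uncurry (mild ν g N)) := by
  have h1 : Measurable fun q : (ℝ × R3) × ℝ => N q.2 q.1.2 :=
    hN.comp (measurable_snd.prodMk (measurable_snd.comp measurable_fst))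
  have h2 : Measurable fun q : (ℝ × R3) × ℝ => Real.exp (-(ν * ‖q.1.2‖ ^ 2 * (q.1.1 - q.2))) := by
    fun_prop
  have h3 := measurable_setIntegral_Ioc (measurable_fst : Measurable fun p : ℝ × R3 => p.1)
    (f := fun p s => Real.exp (-(ν * ‖p.2‖ ^ 2 * (p.1 - s))) • N s p.2) (h2.smul h1)
  have h4 : Measurable fun p : ℝ × R3 => Real.exp (-(ν * ‖p.2‖ ^ 2 * p.1)) • g p.2 := by
    fun_prop
  exact h4.add h3

theorem measurable_duhMajorant (ν : ℝ) {y : R3 → ℝ≥0∞} (hy : Measurable y)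
    {n : ℝ → R3 → ℝ≥0∞} (hn : Measurable (Function.uncurry n)) :
    Measurable fun p : ℝ × R3 => duhMajorant (ν * ‖p.2‖ ^ 2) (y p.2) (fun s => n s p.2) p.1 := by
  have h1 : Measurable fun q : (ℝ × R3) × ℝ => n q.2 q.1.2 :=
    hn.comp (measurable_snd.prodMk (measurable_snd.comp measurable_fst))
  have h2 : Measurable fun q : (ℝ × R3) × ℝ =>
      ENNReal.ofReal (Real.exp (-(ν * ‖q.1.2‖ ^ 2 * (q.1.1 - q.2)))) := by
    fun_prop
  have h3 := measurable_setLIntegral_Ioc (measurable_fst : Measurable fun p : ℝ × R3 => p.1)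
    (f := fun p s => ENNReal.ofReal (Real.exp (-(ν * ‖p.2‖ ^ 2 * (p.1 - s)))) * n s p.2)
    (h2.mul h1)
  have h4 : Measurable fun p : ℝ × R3 =>
      ENNReal.ofReal (Real.exp (-(ν * ‖p.2‖ ^ 2 * p.1))) * y p.2 := by
    fun_prop
  exact h4.add h3

theorem measurable_zInt (ρ a σ : ℝ) {V : ℝ → R3 → C3} (hV : Measurable (Function.uncurry V)) :
    Measurable fun t => zInt ρ a σ (V t) :=
  (((measurable_wt ρ a σ).comp measurable_snd).mul hV.enorm).lintegral_prod_right'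

theorem lintegral_wt_swap (ρ a σ : ℝ) {n : ℝ → R3 → ℝ≥0∞}
    (hn : Measurable (Function.uncurry n)) (S : Set ℝ) :
    ∫⁻ s in S, ∫⁻ ξ, wt ρ a σ ξ * n s ξ = ∫⁻ ξ, wt ρ a σ ξ * ∫⁻ s in S, n s ξ := by
  have hm : Measurable (Function.uncurry fun (s : ℝ) (ξ : R3) => wt ρ a σ ξ * n s ξ) :=
    ((measurable_wt ρ a σ).comp measurable_snd).mul hn
  rw [lintegral_lintegral_swap hm.aemeasurable]
  refine lintegral_congr fun ξ => ?_
  rw [lintegral_const_mul' _ _ (wt_ne_top _ _ _ _)]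

/-- The `L^∞ Z⁻¹ ∩ L¹ Z¹` estimate for the heat equation. -/
theorem zInt_add_integral_le {ν : ℝ} (hν : 0 < ν) {a σ : ℝ} {V : ℝ → R3 → C3}
    {y : R3 → ℝ≥0∞} (hy : Measurable y)
    {n : ℝ → R3 → ℝ≥0∞} (hn : Measurable (Function.uncurry n))
    (hV : ∀ s, 0 ≤ s → ∀ᵐ ξ, ‖V s ξ‖ₑ ≤ duhMajorant (ν * ‖ξ‖ ^ 2) (y ξ) (fun r => n r ξ) s)
    {t : ℝ} (ht : 0 ≤ t) :
    zInt (-1) a σ (V t) + ENNReal.ofReal ν * ∫⁻ s in Ioc 0 t, zInt 1 a σ (V s) ≤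
      (∫⁻ ξ, wt (-1) a σ ξ * y ξ) + ∫⁻ s in Ioc 0 t, ∫⁻ ξ, wt (-1) a σ ξ * n s ξ := by
  obtain ⟨Y, hY⟩ : ∃ Y : ℝ → R3 → ℝ≥0∞, ∀ s ξ, Y s ξ =
    duhMajorant (ν * ‖ξ‖ ^ 2) (y ξ) (fun r => n r ξ) s := ⟨_, fun _ _ => rfl⟩
  have hYm : Measurable (Function.uncurry Y) := by
    convert! measurable_duhMajorant ν hy hn with p
    exact hY p.1 p.2
  simp only [← hY] at hV
  have h1 : zInt (-1) a σ (V t) ≤ ∫⁻ ξ, wt (-1) a σ ξ * Y t ξ :=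
    lintegral_mono_ae ((hV t ht).mono fun ξ hξ => mul_le_mul_right hξ _)
  have h3 : ∫⁻ s in Ioc 0 t, zInt 1 a σ (V s) ≤
      ∫⁻ s in Ioc 0 t, ∫⁻ ξ, wt 1 a σ ξ * Y s ξ :=
    setLIntegral_mono' measurableSet_Ioc fun s hs =>
      lintegral_mono_ae ((hV s hs.1.le).mono fun ξ hξ => mul_le_mul_right hξ _)
  have h2 : ENNReal.ofReal ν * ∫⁻ s in Ioc 0 t, zInt 1 a σ (V s) ≤
      ∫⁻ ξ, wt (-1) a σ ξ * (ENNReal.ofReal (ν * ‖ξ‖ ^ 2) * ∫⁻ s in Ioc 0 t, Y s ξ) := by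
    refine (mul_le_mul_right h3 _).trans_eq ?_
    rw [lintegral_wt_swap 1 a σ hYm, ← lintegral_const_mul' _ _ ENNReal.ofReal_ne_top]
    refine lintegral_congr fun ξ => ?_
    -- Here |ξ|⁻¹ · ν|ξ|² = ν|ξ|: the damping seen in Z⁻¹ is ν times the Z¹ norm.
    rw [← wt_neg_one_mul_sq, ENNReal.ofReal_mul hν.le]
    ring
  refine (add_le_add h1 h2).trans_eq ?_
  have hYt : Measurable (Y t) := hYm.comp measurable_prodMk_left
  have hm1 : Measurable fun ξ => wt (-1) a σ ξ * Y t ξ := (measurable_wt _ _ _).mul hYt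
  have hm2 : Measurable fun ξ => wt (-1) a σ ξ * y ξ := (measurable_wt _ _ _).mul hy
  rw [lintegral_wt_swap (-1) a σ hn, ← lintegral_add_left hm1, ← lintegral_add_left hm2]
  refine lintegral_congr fun ξ => ?_
  have hnξ : Measurable fun s => n s ξ := hn.comp measurable_prodMk_right
  simp only [hY]
  -- After Tonelli the claim is the scalar identity at each frequency with λ = ν‖ξ‖².
  rw [← mul_add, ← mul_add, duhMajorant_add (by positivity) _ hnξ ht]

/-- Bound for the norm of `L^∞(ℝ⁺, Z⁻¹) ∩ L¹(ℝ⁺, Z¹)`. -/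
structure SizeLE (ν a σ : ℝ) (V : ℝ → R3 → C3) (M : ℝ≥0∞) : Prop where
  sup : ∀ t, 0 ≤ t → zInt (-1) a σ (V t) ≤ M
  int : ENNReal.ofReal ν * ∫⁻ t in Ioi 0, zInt 1 a σ (V t) ≤ M

/-! ### Size bounds on the whole half-line. -/

theorem iUnion_Ioc_natCast : ⋃ n : ℕ, Ioc (0 : ℝ) n = Ioi 0 := by
  ext t
  simp only [mem_iUnion, mem_Ioc, mem_Ioi]
  constructor
  · rintro ⟨n, h, -⟩
    exact h
  · intro h
    obtain ⟨n, hn⟩ := exists_nat_ge t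
    exact ⟨n, h, hn⟩

theorem setLIntegral_Ioi_le {f : ℝ → ℝ≥0∞} {M : ℝ≥0∞}
    (h : ∀ t, 0 ≤ t → ∫⁻ s in Ioc 0 t, f s ≤ M) : ∫⁻ s in Ioi 0, f s ≤ M := by
  rw [← iUnion_Ioc_natCast, setLIntegral_iUnion_of_directed]
  · exact iSup_le fun n => h n (Nat.cast_nonneg n)
  · refine Monotone.directed_le fun m n hmn => Ioc_subset_Ioc_right ?_
    exact_mod_cast hmn

/-- The linear estimate bounds a sum of nonnegative terms, hence each of them. The bound is uniform
in t, so monotone convergence carries it to (0, ∞). -/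
theorem sizeLE_of_le {ν : ℝ} (hν : 0 < ν) {a σ : ℝ} {V : ℝ → R3 → C3}
    {y : R3 → ℝ≥0∞} (hy : Measurable y)
    {n : ℝ → R3 → ℝ≥0∞} (hn : Measurable (Function.uncurry n))
    (hV : ∀ s, 0 ≤ s → ∀ᵐ ξ, ‖V s ξ‖ₑ ≤ duhMajorant (ν * ‖ξ‖ ^ 2) (y ξ) (fun r => n r ξ) s) :
    SizeLE ν a σ V
      ((∫⁻ ξ, wt (-1) a σ ξ * y ξ) + ∫⁻ s in Ioi 0, ∫⁻ ξ, wt (-1) a σ ξ * n s ξ) := by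
  have h := fun t (ht : 0 ≤ t) => (zInt_add_integral_le hν (a := a) (σ := σ) hy hn hV ht).trans
    (add_le_add le_rfl (lintegral_mono_set (Ioc_subset_Ioi_self (a := t) (b := (0 : ℝ)))))
  refine ⟨fun t ht => le_self_add.trans (h t ht), ?_⟩
  rw [← lintegral_const_mul' _ _ ENNReal.ofReal_ne_top]
  refine setLIntegral_Ioi_le fun t ht => ?_
  rw [lintegral_const_mul' _ _ ENNReal.ofReal_ne_top]
  exact le_add_self.trans (h t ht)

theorem SizeLE.mono {ν a σ : ℝ} {V : ℝ → R3 → C3} {M M' : ℝ≥0∞} (h : SizeLE ν a σ V M)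
    (hM : M ≤ M') : SizeLE ν a σ V M' :=
  ⟨fun t ht => (h.sup t ht).trans hM, h.int.trans hM⟩

theorem SizeLE.int_le {ν a σ : ℝ} (hν : 0 < ν) {V : ℝ → R3 → C3} {M : ℝ≥0∞}
    (h : SizeLE ν a σ V M) : ∫⁻ t in Ioi 0, zInt 1 a σ (V t) ≤ (ENNReal.ofReal ν)⁻¹ * M := by
  exact (ENNReal.mul_le_iff_le_inv (by simpa using hν) ENNReal.ofReal_ne_top).1 h.int

/-- The time-integrated bilinear estimate. -/
theorem lintegral_nlinMaj_time_le {ν a σ : ℝ} (hν : 0 < ν) (ha : 0 < a) (hσ : 1 < σ)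
    {V W : ℝ → R3 → C3} (hVm : Measurable (Function.uncurry V))
    (hWm : Measurable (Function.uncurry W)) {M M' : ℝ≥0∞} (hV : SizeLE ν a σ V M)
    (hW : SizeLE ν a σ W M') :
    ∫⁻ s in Ioi 0, ∫⁻ ξ, wt (-1) a σ ξ * nlinMaj (V s) (W s) ξ ≤
      ENNReal.ofReal (2 * fourConst) * ((ENNReal.ofReal ν)⁻¹ * (M * M')) := by
  have h1 : ∀ s ∈ Ioi (0 : ℝ), ∫⁻ ξ, wt (-1) a σ ξ * nlinMaj (V s) (W s) ξ ≤
      ENNReal.ofReal fourConst * (zInt 1 a σ (V s) * M' + M * zInt 1 a σ (W s)) := by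
    intro s hs
    -- The choice ε = 1 suffices: in each product one factor is bounded uniformly in time and the
    -- other is integrated.
    have := lintegral_nlinMaj_le ha hσ one_pos (f := V s) (g := W s)
      (hVm.comp measurable_prodMk_left) (hWm.comp measurable_prodMk_left)
    rw [inv_one, ENNReal.ofReal_one, one_mul, one_mul] at this
    refine this.trans ?_
    gcongr
    · exact hW.sup s (le_of_lt hs)
    · exact hV.sup s (le_of_lt hs)
  refine (setLIntegral_mono' measurableSet_Ioi h1).trans ?_
  have hz1 := measurable_zInt 1 a σ hVm
  have hz2 := measurable_zInt 1 a σ hWm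
  rw [lintegral_const_mul' _ _ ENNReal.ofReal_ne_top, lintegral_add_left (hz1.mul_const _),
    lintegral_mul_const _ hz1, lintegral_const_mul _ hz2]
  calc _ ≤ ENNReal.ofReal fourConst * ((ENNReal.ofReal ν)⁻¹ * M * M' +
        M * ((ENNReal.ofReal ν)⁻¹ * M')) := by
        gcongr
        · exact hV.int_le hν
        · exact hW.int_le hν
    _ = _ := by
        rw [ENNReal.ofReal_mul (by norm_num), ENNReal.ofReal_ofNat]
        ring

theorem SizeLE.zero (ν a σ : ℝ) : SizeLE ν a σ (0 : ℝ → R3 → C3) 0 := by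
  constructor <;> simp [zInt]

theorem SizeLE.integrable {ν a σ : ℝ} (ha : 0 < a) (hσ : 1 < σ)
    {V : ℝ → R3 → C3} (hVm : Measurable (Function.uncurry V)) {M : ℝ≥0∞} (hM : M < ∞)
    (hV : SizeLE ν a σ V M) {t : ℝ} (ht : 0 ≤ t) : Integrable (V t) :=
  integrable_of_zInt ha hσ (hVm.comp measurable_prodMk_left).aestronglyMeasurable
    ((hV.sup t ht).trans_lt hM)

theorem ae_lintegral_lt_top_of_wt {ρ a σ : ℝ} {n : ℝ → R3 → ℝ≥0∞}
    (hn : Measurable (Function.uncurry n)) {s : Set ℝ}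
    (h : ∫⁻ t in s, ∫⁻ ξ, wt ρ a σ ξ * n t ξ < ∞) : ∀ᵐ ξ, ∫⁻ t in s, n t ξ < ∞ := by
  rw [lintegral_wt_swap ρ a σ hn] at h
  have hn' : Measurable fun p : R3 × ℝ => n p.2 p.1 := hn.comp measurable_swap
  have hm : Measurable fun ξ => wt ρ a σ ξ * ∫⁻ t in s, n t ξ :=
    (measurable_wt ρ a σ).mul hn'.lintegral_prod_right'
  filter_upwards [ae_lt_top hm h.ne, ae_ne_zero] with ξ hξ h0
  exact ENNReal.lt_top_of_mul_ne_top_right hξ.ne (wt_ne_zero _ _ _ h0)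

/-- The quadratic term is integrable in time for almost every frequency. -/
theorem ae_integrableOn_nlin {ν a σ : ℝ} (hν : 0 < ν) (ha : 0 < a) (hσ : 1 < σ)
    {V : ℝ → R3 → C3} (hVm : Measurable (Function.uncurry V)) {M : ℝ≥0∞} (hM : M < ∞)
    (hV : SizeLE ν a σ V M) : ∀ᵐ ξ, IntegrableOn (fun s => nlin (V s) (V s) ξ) (Ioi 0) := by
  have h := (lintegral_nlinMaj_time_le hν ha hσ hVm hVm hV hV).trans_lt
    (ENNReal.mul_lt_top ENNReal.ofReal_lt_top (ENNReal.mul_lt_top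
      (ENNReal.inv_lt_top.2 (by simpa using hν)) (ENNReal.mul_lt_top hM hM)))
  filter_upwards [ae_lintegral_lt_top_of_wt (measurable_nlinMaj hVm hVm) h] with ξ hξ
  refine ⟨((measurable_nlin hVm hVm).comp measurable_prodMk_right).aestronglyMeasurable, ?_⟩
  exact (lintegral_mono fun s => enorm_nlin_le _ _ _).trans_lt hξ

theorem duhMajorant_mono {l : ℝ} {y y' : ℝ≥0∞} {n n' : ℝ → ℝ≥0∞} {t : ℝ} (hy : y ≤ y')
    (hn : ∀ᵐ s ∂(volume.restrict (Ioc 0 t)), n s ≤ n' s) :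
    duhMajorant l y n t ≤ duhMajorant l y' n' t := by
  unfold duhMajorant
  gcongr 1
  · gcongr
  · refine lintegral_mono_ae (hn.mono fun s hs => ?_)
    gcongr

theorem duh_sub_duh {E : Type*} [NormedAddCommGroup E] [NormedSpace ℝ E] {l t : ℝ} {y y' : E}
    {n n' : ℝ → E} (hn : IntegrableOn n (Ioc 0 t)) (hn' : IntegrableOn n' (Ioc 0 t)) :
    duh l y n t - duh l y' n' t = duh l (y - y') (fun s => n s - n' s) t := by
  have h1 := integral_sub (integrableOn_exp_smul hn l) (integrableOn_exp_smul hn' l)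
  simp only [duh, exp_smul_setIntegral]
  simp only [smul_sub, h1]
  abel

/-- Estimates are obtained for each time at almost every frequency, but Duhamel's formula is used at
a fixed frequency for almost every time. Fubini for null sets needs the measurability of the
relation. -/
theorem ae_comm_Ioc {p : ℝ → R3 → Prop} (hp : MeasurableSet {q : ℝ × R3 | p q.1 q.2}) (t : ℝ)
    (h : ∀ s, 0 ≤ s → ∀ᵐ ξ, p s ξ) : ∀ᵐ ξ, ∀ᵐ s ∂(volume.restrict (Ioc 0 t)), p s ξ := by
  refine (Measure.ae_ae_comm hp).1 ?_
  filter_upwards [ae_restrict_mem measurableSet_Ioc] with s hs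
  exact h s hs.1.le

/-! ### The Picard scheme -/

/-- The Picard map `U ↦ exp(νtΔ) g + ∫₀ᵗ exp(ν(t-s)Δ) N(U(s)) ds` on the Fourier side. -/
noncomputable def picardMap (ν : ℝ) (g : R3 → C3) (U : ℝ → R3 → C3) : ℝ → R3 → C3 :=
  mild ν g fun s => nlin (U s) (U s)

theorem measurable_picardMap (ν : ℝ) {g : R3 → C3} (hg : Measurable g) {U : ℝ → R3 → C3}
    (hU : Measurable (Function.uncurry U)) : Measurable (Function.uncurry (picardMap ν g U)) :=
  measurable_mild ν hg (measurable_nlin hU hU)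

theorem enorm_picardMap_le (ν : ℝ) (g : R3 → C3) (U : ℝ → R3 → C3) (t : ℝ) (ξ : R3) :
    ‖picardMap ν g U t ξ‖ₑ ≤
      duhMajorant (ν * ‖ξ‖ ^ 2) ‖g ξ‖ₑ (fun s => nlinMaj (U s) (U s) ξ) t :=
  (enorm_duh_le _ _ _ _).trans
    (duhMajorant_mono le_rfl (Eventually.of_forall fun _ => enorm_nlin_le _ _ _))

/-- The smallness of the constant in the contraction estimates. -/
theorem fourConst_mul_le {ν : ℝ} {m : ℝ≥0∞} (hm : m ≤ ENNReal.ofReal ν) (x : ℝ≥0∞) :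
    ENNReal.ofReal (2 * fourConst) * ((ENNReal.ofReal ν)⁻¹ * (m * x)) ≤ 8⁻¹ * x := by
  have h1 : (ENNReal.ofReal ν)⁻¹ * m ≤ 1 := by
    refine (mul_le_mul_right hm _).trans ?_
    exact ENNReal.inv_mul_le_one _
  have h2 : ENNReal.ofReal (2 * fourConst) ≤ 8⁻¹ := by
    have h3 : (8⁻¹ : ℝ≥0∞) = ENNReal.ofReal 8⁻¹ := by
      rw [ENNReal.ofReal_inv_of_pos (by norm_num), ENNReal.ofReal_ofNat]
    rw [h3]
    refine ENNReal.ofReal_le_ofReal ?_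
    have := fourConst_le
    norm_num at this ⊢
    linarith
  calc _ ≤ 8⁻¹ * ((ENNReal.ofReal ν)⁻¹ * m * x) := by
        rw [← mul_assoc (ENNReal.ofReal ν)⁻¹]
        gcongr
    _ ≤ 8⁻¹ * (1 * x) := by gcongr
    _ = _ := by rw [one_mul]

theorem SizeLE.picardMap {ν a σ : ℝ} (hν : 0 < ν) (ha : 0 < a) (hσ : 1 < σ) {g : R3 → C3}
    (hg : Measurable g) {U : ℝ → R3 → C3} (hUm : Measurable (Function.uncurry U)) {M : ℝ≥0∞}
    (hU : SizeLE ν a σ U M) :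
    SizeLE ν a σ (picardMap ν g U) (zInt (-1) a σ g +
      ENNReal.ofReal (2 * fourConst) * ((ENNReal.ofReal ν)⁻¹ * (M * M))) := by
  refine (sizeLE_of_le hν hg.enorm (measurable_nlinMaj hUm hUm) fun s _ =>
    Eventually.of_forall fun ξ => enorm_picardMap_le ν g U s ξ).mono ?_
  exact add_le_add le_rfl (lintegral_nlinMaj_time_le hν ha hσ hUm hUm hU hU)

/-- The quadratic term on the ball of radius 2m has size at most 2(2π)⁻³ν⁻¹(2m)² ≤ m/2, because m ≤
ν and 2(2π)⁻³ ≤ 1/8. Together with the linear part m this stays below 2m. -/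
theorem SizeLE.picardMap_two {ν a σ : ℝ} (hν : 0 < ν) (ha : 0 < a) (hσ : 1 < σ) {g : R3 → C3}
    (hg : Measurable g) (hsmall : zInt (-1) a σ g ≤ ENNReal.ofReal ν)
    {U : ℝ → R3 → C3} (hUm : Measurable (Function.uncurry U))
    (hU : SizeLE ν a σ U (2 * zInt (-1) a σ g)) :
    SizeLE ν a σ (LeiLinGevrey.picardMap ν g U) (2 * zInt (-1) a σ g) := by
  refine (hU.picardMap hν ha hσ hg hUm).mono ?_
  have h := fourConst_mul_le hsmall (4 * zInt (-1) a σ g)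
  have h2 : (8⁻¹ : ℝ≥0∞) * (4 * zInt (-1) a σ g) ≤ zInt (-1) a σ g := by
    rw [← mul_assoc]
    have : (8⁻¹ : ℝ≥0∞) * 4 ≤ 1 := by
      calc (8⁻¹ : ℝ≥0∞) * 4 ≤ 8⁻¹ * 8 := by gcongr; norm_num
        _ ≤ 1 := ENNReal.inv_mul_le_one _
    calc _ ≤ 1 * zInt (-1) a σ g := by gcongr
      _ = _ := one_mul _
  rw [two_mul (zInt (-1) a σ g)]
  refine add_le_add le_rfl ((le_of_eq ?_).trans (h.trans h2))
  ring

/-- The Picard map is a contraction on small balls. -/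
theorem SizeLE.picardMap_sub {ν a σ : ℝ} (hν : 0 < ν) (ha : 0 < a) (hσ : 1 < σ) {g : R3 → C3}
    {m : ℝ≥0∞} (hm : m ≤ ENNReal.ofReal ν)
    {U V : ℝ → R3 → C3} (hUm : Measurable (Function.uncurry U))
    (hVm : Measurable (Function.uncurry V)) (hU : SizeLE ν a σ U (2 * m))
    (hV : SizeLE ν a σ V (2 * m)) {d : ℝ≥0∞} (hd : SizeLE ν a σ (U - V) d) :
    SizeLE ν a σ (LeiLinGevrey.picardMap ν g U - LeiLinGevrey.picardMap ν g V) (2⁻¹ * d) := by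
  have hDm : Measurable (Function.uncurry (U - V)) := hUm.sub hVm
  have hM : 2 * m < ∞ := ENNReal.mul_lt_top (by simp) (hm.trans_lt ENNReal.ofReal_lt_top)
  have hn1 := measurable_nlinMaj hDm hUm
  have hn2 := measurable_nlinMaj hVm hDm
  obtain ⟨n, hn⟩ : ∃ n : ℝ → R3 → ℝ≥0∞, ∀ s ξ, n s ξ =
    nlinMaj ((U - V) s) (U s) ξ + nlinMaj (V s) ((U - V) s) ξ := ⟨_, fun _ _ => rfl⟩
  have hnm : Measurable (Function.uncurry n) := by
    convert! hn1.add hn2 using 1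
    funext p
    exact hn p.1 p.2
  have hpt : ∀ s, 0 ≤ s → ∀ᵐ ξ, ‖nlin (U s) (U s) ξ - nlin (V s) (V s) ξ‖ₑ ≤ n s ξ := by
    intro s hs
    simp only [hn]
    exact enorm_nlin_sub_nlin_le (hU.integrable ha hσ hUm hM hs) (hV.integrable ha hσ hVm hM hs)
  have hset : MeasurableSet {q : ℝ × R3 |
      ‖nlin (U q.1) (U q.1) q.2 - nlin (V q.1) (V q.1) q.2‖ₑ ≤ n q.1 q.2} :=
    measurableSet_le ((measurable_nlin hUm hUm).sub (measurable_nlin hVm hVm)).enorm hnm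
  have hbound : ∀ t, 0 ≤ t → ∀ᵐ ξ,
      ‖(LeiLinGevrey.picardMap ν g U - LeiLinGevrey.picardMap ν g V) t ξ‖ₑ ≤
        duhMajorant (ν * ‖ξ‖ ^ 2) 0 (fun s => n s ξ) t := by
    intro t ht
    filter_upwards [ae_integrableOn_nlin hν ha hσ hUm hM hU,
      ae_integrableOn_nlin hν ha hσ hVm hM hV, ae_comm_Ioc hset t hpt] with ξ h1 h2 h3
    have h4 : (LeiLinGevrey.picardMap ν g U - LeiLinGevrey.picardMap ν g V) t ξ =
        duh (ν * ‖ξ‖ ^ 2) (g ξ - g ξ) (fun s => nlin (U s) (U s) ξ - nlin (V s) (V s) ξ) t :=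
      duh_sub_duh (h1.mono_set Ioc_subset_Ioi_self) (h2.mono_set Ioc_subset_Ioi_self)
    -- The initial data cancel, so only the difference of the quadratic terms drives the difference.
    rw [h4, sub_self]
    exact (enorm_duh_le _ _ _ _).trans (duhMajorant_mono (by simp) h3)
  refine (sizeLE_of_le hν measurable_const hnm hbound).mono ?_
  simp only [mul_zero, lintegral_zero, zero_add, hn, mul_add]
  have hw1 : Measurable (Function.uncurry fun (s : ℝ) (ξ : R3) =>
      wt (-1) a σ ξ * nlinMaj ((U - V) s) (U s) ξ) :=
    ((measurable_wt (-1) a σ).comp measurable_snd).mul hn1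
  have e1 : ∀ s, ∫⁻ ξ, (wt (-1) a σ ξ * nlinMaj ((U - V) s) (U s) ξ +
      wt (-1) a σ ξ * nlinMaj (V s) ((U - V) s) ξ) =
      (∫⁻ ξ, wt (-1) a σ ξ * nlinMaj ((U - V) s) (U s) ξ) +
      ∫⁻ ξ, wt (-1) a σ ξ * nlinMaj (V s) ((U - V) s) ξ := fun s =>
    lintegral_add_left (hw1.comp measurable_prodMk_left) _
  simp only [e1]
  have hm1 : Measurable fun s => ∫⁻ ξ, wt (-1) a σ ξ * nlinMaj ((U - V) s) (U s) ξ :=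
    hw1.lintegral_prod_right'
  rw [lintegral_add_left hm1]
  have h5 := lintegral_nlinMaj_time_le hν ha hσ hDm hUm hd hU
  have h6 := lintegral_nlinMaj_time_le hν ha hσ hVm hDm hV hd
  -- Each of the two pieces of the difference contributes at most (1/8)(2d), which gives d/2 in
  -- total.
  have h7 := fourConst_mul_le hm (2 * d)
  have h8 : d * (2 * m) = m * (2 * d) := by ring
  have h9 : 2 * m * d = m * (2 * d) := by ring
  rw [h8] at h5
  rw [h9] at h6
  refine (add_le_add (h5.trans h7) (h6.trans h7)).trans_eq ?_
  have h10 : (8⁻¹ : ℝ≥0∞) * (2 * d) + 8⁻¹ * (2 * d) = (8⁻¹ * 4) * d := by ring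
  rw [h10]
  congr 1
  have : (8 : ℝ≥0∞) = 4 * 2 := by norm_num
  rw [this, ENNReal.mul_inv (by simp) (by simp), mul_right_comm,
    ENNReal.inv_mul_cancel (by simp) (by simp), one_mul]

/-- The Picard iterates. -/
noncomputable def picard (ν : ℝ) (g : R3 → C3) : ℕ → ℝ → R3 → C3
  | 0 => 0
  | n + 1 => picardMap ν g (picard ν g n)

section Iterates

variable {ν a σ : ℝ} {g : R3 → C3}

theorem measurable_picard (hg : Measurable g) (n : ℕ) :
    Measurable (Function.uncurry (picard ν g n)) := by
  induction n with
  | zero => exact measurable_const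
  | succ n ih => exact measurable_picardMap ν hg ih

theorem sizeLE_picard (hν : 0 < ν) (ha : 0 < a) (hσ : 1 < σ) (hg : Measurable g)
    (hsmall : zInt (-1) a σ g ≤ ENNReal.ofReal ν) (n : ℕ) :
    SizeLE ν a σ (picard ν g n) (2 * zInt (-1) a σ g) := by
  induction n with
  | zero => exact (SizeLE.zero ν a σ).mono zero_le
  | succ n ih => exact ih.picardMap_two hν ha hσ hg hsmall (measurable_picard hg n)

/-- The first increment is the heat flow of g, of size at most m, and each further application of
the Picard map halves the increment. -/
theorem sizeLE_picard_sub (hν : 0 < ν) (ha : 0 < a) (hσ : 1 < σ) (hg : Measurable g)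
    (hsmall : zInt (-1) a σ g ≤ ENNReal.ofReal ν) (n : ℕ) :
    SizeLE ν a σ (picard ν g (n + 1) - picard ν g n) (2⁻¹ ^ n * zInt (-1) a σ g) := by
  induction n with
  | zero =>
    have h := (SizeLE.zero ν a σ).picardMap hν ha hσ hg (U := 0) measurable_const
    simpa [picard] using h
  | succ n ih =>
    have h := SizeLE.picardMap_sub hν ha hσ (g := g) hsmall (measurable_picard hg (n + 1))
      (measurable_picard hg n) (sizeLE_picard hν ha hσ hg hsmall (n + 1))
      (sizeLE_picard hν ha hσ hg hsmall n) ih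
    rw [pow_succ', mul_assoc]
    exact h

/-- The sum of the increments of the Picard iterates. -/
noncomputable def picardLimit (ν : ℝ) (g : R3 → C3) (t : ℝ) (ξ : R3) : C3 :=
  ∑' n : ℕ, (picard ν g (n + 1) t ξ - picard ν g n t ξ)

theorem measurable_picardLimit (hg : Measurable g) :
    Measurable (Function.uncurry (picardLimit ν g)) :=
  Measurable.tsum fun n => (measurable_picard hg (n + 1)).sub (measurable_picard hg n)

theorem zInt_tsum_le {ρ : ℝ} {f : ℕ → R3 → C3} (hf : ∀ n, Measurable (f n)) :
    ∫⁻ ξ, wt ρ a σ ξ * ∑' n, ‖f n ξ‖ₑ = ∑' n, zInt ρ a σ (f n) := by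
  simp only [← ENNReal.tsum_mul_left]
  exact lintegral_tsum fun n => aemeasurable_wt_mul ρ a σ (hf n).aestronglyMeasurable

theorem tsum_geometric_half (n : ℕ) (x : ℝ≥0∞) :
    ∑' k : ℕ, (2⁻¹ : ℝ≥0∞) ^ (n + k) * x = 2⁻¹ ^ n * (2 * x) := by
  simp only [pow_add, mul_assoc]
  rw [ENNReal.tsum_mul_left, ENNReal.tsum_mul_right, ENNReal.tsum_geometric,
    ENNReal.one_sub_inv_two, inv_inv]

/-- The difference is the tail of the telescoping series, dominated by a geometric series in both
norms. Weighted summability yields absolute convergence at almost every frequency. -/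
theorem sizeLE_picardLimit_sub (hν : 0 < ν) (ha : 0 < a) (hσ : 1 < σ) (hg : Measurable g)
    (hsmall : zInt (-1) a σ g ≤ ENNReal.ofReal ν) (n : ℕ) :
    SizeLE ν a σ (picardLimit ν g - picard ν g n) (2⁻¹ ^ n * (2 * zInt (-1) a σ g)) := by
  obtain ⟨D, hD⟩ : ∃ D : ℕ → ℝ → R3 → C3, ∀ k, picard ν g (k + 1) - picard ν g k = D k :=
    ⟨_, fun _ => rfl⟩
  have hD' : ∀ k t ξ, picard ν g (k + 1) t ξ - picard ν g k t ξ = D k t ξ := fun k t ξ => by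
    rw [← hD]; rfl
  have hDm : ∀ k, Measurable (Function.uncurry (D k)) := fun k => by
    rw [← hD]
    exact (measurable_picard hg (k + 1)).sub (measurable_picard hg k)
  have hDt : ∀ k t, Measurable (D k t) := fun k t => (hDm k).comp measurable_prodMk_left
  have hDs := sizeLE_picard_sub hν ha hσ hg hsmall
  simp only [hD] at hDs
  have hfin : zInt (-1) a σ g < ∞ := hsmall.trans_lt ENNReal.ofReal_lt_top
  have hpt : ∀ t, 0 ≤ t → ∀ᵐ ξ, ‖(picardLimit ν g - picard ν g n) t ξ‖ₑ ≤
      ∑' k, ‖D (n + k) t ξ‖ₑ := by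
    intro t ht
    have h1 : ∫⁻ ξ, wt (-1) a σ ξ * ∑' k, ‖D k t ξ‖ₑ < ∞ := by
      rw [zInt_tsum_le fun k => hDt k t]
      have h2 := tsum_geometric_half 0 (zInt (-1) a σ g)
      simp only [zero_add, pow_zero, one_mul] at h2
      refine (ENNReal.tsum_le_tsum fun k => (hDs k).sup t ht).trans_lt ?_
      rw [h2]
      exact ENNReal.mul_lt_top (by simp) hfin
    have hm : Measurable fun ξ => wt (-1) a σ ξ * ∑' k, ‖D k t ξ‖ₑ :=
      (measurable_wt _ _ _).mul (Measurable.tsum fun k => (hDt k t).enorm)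
    -- On the exceptional null set, which depends on t, the series may diverge. The value given to
    -- its sum there is irrelevant.
    filter_upwards [ae_lt_top hm h1.ne, ae_ne_zero] with ξ hξ h0
    have h3 : ∑' k, ‖D k t ξ‖ₑ < ∞ :=
      ENNReal.lt_top_of_mul_ne_top_right hξ.ne (wt_ne_zero _ _ _ h0)
    have h4 : Summable fun k => ‖D k t ξ‖ := by
      have := ENNReal.summable_toReal h3.ne
      simpa only [toReal_enorm] using this
    have h5 : ∑ k ∈ Finset.range n, D k t ξ = picard ν g n t ξ := by
      have := Finset.sum_range_sub (fun k => picard ν g k t ξ) n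
      simp only [hD'] at this
      rw [this]
      exact sub_zero _
    have h6 : (picardLimit ν g - picard ν g n) t ξ = ∑' k, D (k + n) t ξ := by
      have h7 := h4.of_norm.sum_add_tsum_nat_add n
      have h8 : picardLimit ν g t ξ = ∑' k, D k t ξ := tsum_congr fun k => hD' k t ξ
      simp only [Pi.sub_apply]
      rw [h8, ← h7, h5, add_sub_cancel_left]
    rw [h6]
    refine (enorm_tsum_le_tsum_enorm).trans_eq ?_
    simp only [add_comm n]
  have hsum : ∀ ρ t, 0 ≤ t → zInt ρ a σ ((picardLimit ν g - picard ν g n) t) ≤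
      ∑' k, zInt ρ a σ (D (n + k) t) := by
    intro ρ t ht
    rw [← zInt_tsum_le fun k => hDt _ t]
    exact lintegral_mono_ae ((hpt t ht).mono fun ξ hξ => mul_le_mul_right hξ _)
  refine ⟨fun t ht => ?_, ?_⟩
  · refine (hsum _ t ht).trans ?_
    rw [← tsum_geometric_half]
    exact ENNReal.tsum_le_tsum fun k => (hDs (n + k)).sup t ht
  · have h1 : ∫⁻ t in Ioi 0, zInt 1 a σ ((picardLimit ν g - picard ν g n) t) ≤
        ∑' k, ∫⁻ t in Ioi 0, zInt 1 a σ (D (n + k) t) := by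
      rw [← lintegral_tsum fun k => (measurable_zInt 1 a σ (hDm (n + k))).aemeasurable]
      exact setLIntegral_mono' measurableSet_Ioi fun t ht => hsum 1 t (le_of_lt ht)
    refine (mul_le_mul_right h1 _).trans ?_
    rw [← ENNReal.tsum_mul_left, ← tsum_geometric_half]
    exact ENNReal.tsum_le_tsum fun k => (hDs (n + k)).int

theorem sizeLE_picardLimit (hν : 0 < ν) (ha : 0 < a) (hσ : 1 < σ) (hg : Measurable g)
    (hsmall : zInt (-1) a σ g ≤ ENNReal.ofReal ν) :
    SizeLE ν a σ (picardLimit ν g) (2 * zInt (-1) a σ g) := by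
  have h := sizeLE_picardLimit_sub hν ha hσ hg hsmall 0
  rw [pow_zero, one_mul] at h
  have h2 : picardLimit ν g - picard ν g 0 = picardLimit ν g := sub_zero _
  rwa [h2] at h

/-- Write V - Φ(V) = (V - Uₙ₊₁) - (Φ(V) - Φ(Uₙ)) with Uₙ the iterates. Both differences tend to 0,
the second by contraction. -/
theorem ae_eq_picardMap_of_sizeLE_sub (hν : 0 < ν) (ha : 0 < a) (hσ : 1 < σ) (hg : Measurable g)
    (hsmall : zInt (-1) a σ g ≤ ENNReal.ofReal ν) {V : ℝ → R3 → C3}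
    (hVm : Measurable (Function.uncurry V)) (hVs : SizeLE ν a σ V (2 * zInt (-1) a σ g))
    (hVd : ∀ n, SizeLE ν a σ (V - picard ν g n) (2⁻¹ ^ n * (2 * zInt (-1) a σ g)))
    {t : ℝ} (ht : 0 ≤ t) : V t =ᵐ[volume] picardMap ν g V t := by
  have hfin : zInt (-1) a σ g < ∞ := hsmall.trans_lt ENNReal.ofReal_lt_top
  have hPm := measurable_picardMap ν hg hVm
  have hVt : Measurable (V t) := hVm.comp measurable_prodMk_left
  have hPt : Measurable (picardMap ν g V t) := hPm.of_uncurry_left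
  have key : zInt (-1) a σ (V t - picardMap ν g V t) = 0 := by
    have hle : ∀ n : ℕ, zInt (-1) a σ (V t - picardMap ν g V t) ≤
        2⁻¹ ^ n * (4 * zInt (-1) a σ g) := by
      intro n
      have hpm : Measurable (picard ν g (n + 1) t) :=
        (measurable_picard hg (n + 1)).of_uncurry_left
      have h1 := (hVd (n + 1)).sup t ht
      have h2 := (SizeLE.picardMap_sub hν ha hσ (g := g) hsmall hVm (measurable_picard hg n) hVs
        (sizeLE_picard hν ha hσ hg hsmall n)
        (hVd n)).sup t ht
      have h3 : V t - picardMap ν g V t = (V - picard ν g (n + 1)) t +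
          -((picardMap ν g V - picardMap ν g (picard ν g n)) t) := by
        have : picard ν g (n + 1) t = picardMap ν g (picard ν g n) t := rfl
        rw [Pi.sub_apply, Pi.sub_apply, this, neg_sub, sub_add_sub_cancel]
      rw [h3]
      refine (zInt_add_le (hVt.sub hpm).aestronglyMeasurable).trans ?_
      rw [zInt_neg]
      refine (add_le_add h1 h2).trans ?_
      have h4 : (2⁻¹ : ℝ≥0∞) ≤ 1 := by simp
      calc _ = 2⁻¹ * (2⁻¹ ^ n * (4 * zInt (-1) a σ g)) := by rw [pow_succ']; ring
        _ ≤ 1 * (2⁻¹ ^ n * (4 * zInt (-1) a σ g)) := mul_le_mul_left h4 _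
        _ = _ := one_mul _
    have h5 : Tendsto (fun n : ℕ => (2⁻¹ : ℝ≥0∞) ^ n * (4 * zInt (-1) a σ g)) atTop
        (𝓝 (0 * (4 * zInt (-1) a σ g))) :=
      ENNReal.Tendsto.mul_const
        (ENNReal.tendsto_pow_atTop_nhds_zero_of_lt_one ENNReal.one_half_lt_one)
        (Or.inr (ENNReal.mul_lt_top (by simp) hfin).ne)
    rw [zero_mul] at h5
    exact le_antisymm (ge_of_tendsto' h5 hle) zero_le
  have := ae_eq_zero_of_zInt_eq_zero (hVt.sub hPt).aestronglyMeasurable key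
  filter_upwards [this] with ξ hξ
  exact sub_eq_zero.1 hξ

theorem picardLimit_ae_eq (hν : 0 < ν) (ha : 0 < a) (hσ : 1 < σ) (hg : Measurable g)
    (hsmall : zInt (-1) a σ g ≤ ENNReal.ofReal ν) {t : ℝ} (ht : 0 ≤ t) :
    picardLimit ν g t =ᵐ[volume] picardMap ν g (picardLimit ν g) t :=
  ae_eq_picardMap_of_sizeLE_sub hν ha hσ hg hsmall (measurable_picardLimit hg)
    (sizeLE_picardLimit hν ha hσ hg hsmall) (sizeLE_picardLimit_sub hν ha hσ hg hsmall) ht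

/-! ### Incompressibility and reality along the Picard scheme. -/

theorem leray_duh {l t : ℝ} {ξ : R3} {y : C3} {n : ℝ → C3} (hy : leray ξ y = y)
    (hn : ∀ s, leray ξ (n s) = n s) : leray ξ (duh l y n t) = duh l y n t := by
  rw [duh, map_add]
  congr 1
  · rw [← Complex.coe_smul, map_smul, hy]
  · by_cases h : IntegrableOn (fun s => Real.exp (-(l * (t - s))) • n s) (Ioc 0 t)
    · rw [← ContinuousLinearMap.integral_comp_comm _ h]
      congr 1
      funext s
      rw [← Complex.coe_smul, map_smul, hn]
    -- If the integral diverges, its default value 0 is fixed by the projector, so the identity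
    -- needs no integrability and holds at every frequency.
    · rw [integral_undef h, map_zero]

theorem conjC3_duh (l t : ℝ) (y : C3) (n : ℝ → C3) :
    conjC3 (duh l y n t) = duh l (conjC3 y) (fun s => conjC3 (n s)) t := by
  rw [duh, duh, map_add]
  congr 1
  · rw [map_smul]
  · have := conjC3.toContinuousLinearEquiv.integral_comp_comm (μ := volume.restrict (Ioc 0 t))
      (fun s => Real.exp (-(l * (t - s))) • n s)
    refine this.symm.trans ?_
    congr 1
    funext s
    exact map_smul conjC3 _ _

theorem picardMap_neg_conj {U : ℝ → R3 → C3} (hg : ∀ ξ, g (-ξ) = conjC3 (g ξ))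
    (hU : ∀ t ξ, U t (-ξ) = conjC3 (U t ξ)) (t : ℝ) (ξ : R3) :
    picardMap ν g U t (-ξ) = conjC3 (picardMap ν g U t ξ) := by
  rw [picardMap, mild, mild, conjC3_duh, norm_neg, hg]
  congr 1
  funext s
  exact nlin_neg_conj (hU s) (hU s) ξ

theorem picardLimit_neg_conj (hg : ∀ ξ, g (-ξ) = conjC3 (g ξ)) (t : ℝ) (ξ : R3) :
    picardLimit ν g t (-ξ) = conjC3 (picardLimit ν g t ξ) := by
  have hp : ∀ n t ξ, picard ν g n t (-ξ) = conjC3 (picard ν g n t ξ) := by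
    intro n
    induction n with
    | zero => intro t ξ; simp [picard]
    | succ n ih => exact picardMap_neg_conj hg ih
  have := conjC3.toContinuousLinearEquiv.map_tsum
    (L := SummationFilter.unconditional ℕ) (f := fun n : ℕ => picard ν g (n + 1) t ξ - picard ν g n t ξ)
  refine Eq.trans ?_ this.symm
  refine tsum_congr fun n => ?_
  rw [hp, hp]
  exact (map_sub conjC3 _ _).symm

/-- Global mild solutions for small data. -/
theorem exists_mild_solution (hν : 0 < ν) (ha : 0 < a) (hσ : 1 < σ) (hg : Measurable g)
    (hsmall : zInt (-1) a σ g ≤ ENNReal.ofReal ν) (hconj : ∀ ξ, g (-ξ) = conjC3 (g ξ))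
    (hdiv : ∀ ξ, leray ξ (g ξ) = g ξ) :
    ∃ U : ℝ → R3 → C3, Measurable (Function.uncurry U) ∧
      SizeLE ν a σ U (2 * zInt (-1) a σ g) ∧
      (∀ t, 0 ≤ t → ∀ ξ, U t ξ = picardMap ν g U t ξ) ∧
      (∀ t ξ, U t (-ξ) = conjC3 (U t ξ)) ∧ ∀ t ξ, leray ξ (U t ξ) = U t ξ := by
  have hVm := measurable_picardLimit (ν := ν) hg
  -- The solution is the image of the limit, not the limit itself. The two agree almost everywhere
  -- and the quadratic term ignores null sets, so the fixed-point identity and the projection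
  -- identity hold at every frequency.
  refine ⟨picardMap ν g (picardLimit ν g), measurable_picardMap ν hg hVm,
    (sizeLE_picardLimit hν ha hσ hg hsmall).picardMap_two hν ha hσ hg hsmall hVm,
    fun t ht ξ => ?_, picardMap_neg_conj hconj (picardLimit_neg_conj hconj), fun t ξ => ?_⟩
  · simp only [picardMap, mild, duh]
    congr 1
    refine setIntegral_congr_fun measurableSet_Ioc fun s hs => ?_
    have h := picardLimit_ae_eq hν ha hσ hg hsmall hs.1.le
    rw [nlin_congr h h]
    rfl
  · exact leray_duh (hdiv ξ) fun s => leray_nlin _ _ ξ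

end Iterates

/-- The energy inequality for mild solutions of small size. -/
theorem mild_energy {ν a σ : ℝ} (hν : 0 < ν) (ha : 0 < a) (hσ : 1 < σ) {g : R3 → C3}
    (hg : Measurable g) (hsmall : zInt (-1) a σ g ≤ ENNReal.ofReal ν) {U : ℝ → R3 → C3}
    (hUm : Measurable (Function.uncurry U)) (hU : SizeLE ν a σ U (2 * zInt (-1) a σ g))
    (hmild : ∀ t, 0 ≤ t → ∀ ξ, U t ξ = picardMap ν g U t ξ) {t : ℝ} (ht : 0 ≤ t) :
    zInt (-1) a σ (U t) + (ENNReal.ofReal ν - zInt (-1) a σ g) / 2 *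
      ∫⁻ s in Ioc 0 t, zInt 1 a σ (U s) ≤ zInt (-1) a σ g := by
  set m := zInt (-1) a σ g with hm
  have hmfin : m < ∞ := hsmall.trans_lt ENNReal.ofReal_lt_top
  set J := ∫⁻ s in Ioc 0 t, zInt 1 a σ (U s) with hJ
  have hJfin : J < ∞ := by
    refine (lintegral_mono_set Ioc_subset_Ioi_self).trans_lt ((hU.int_le hν).trans_lt ?_)
    exact ENNReal.mul_lt_top (ENNReal.inv_lt_top.2 (by simpa using hν))
      (ENNReal.mul_lt_top (by simp) hmfin)
  have h1 := zInt_add_integral_le hν (a := a) (σ := σ) hg.enorm (measurable_nlinMaj hUm hUm)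
    (V := U) (fun s hs => Eventually.of_forall fun ξ => by
      rw [hmild s hs]
      exact enorm_picardMap_le ν g U s ξ) ht
  -- The size bound 2m on both factors gives (1/16)·4m = m/4 as the coefficient of the Z¹ norm.
  have h2 : ∫⁻ s in Ioc 0 t, ∫⁻ ξ, wt (-1) a σ ξ * nlinMaj (U s) (U s) ξ ≤ 4⁻¹ * m * J := by
    rw [hJ, ← lintegral_const_mul _ (measurable_zInt 1 a σ hUm)]
    refine setLIntegral_mono' measurableSet_Ioc fun s hs => ?_
    have h3 := lintegral_nlinMaj_le ha hσ one_pos (f := U s) (g := U s)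
      (hUm.comp measurable_prodMk_left) (hUm.comp measurable_prodMk_left)
    rw [inv_one, ENNReal.ofReal_one, one_mul, one_mul] at h3
    refine h3.trans ?_
    have h4 : ENNReal.ofReal fourConst ≤ 16⁻¹ := by
      have : (16⁻¹ : ℝ≥0∞) = ENNReal.ofReal 16⁻¹ := by
        rw [ENNReal.ofReal_inv_of_pos (by norm_num), ENNReal.ofReal_ofNat]
      rw [this]
      refine ENNReal.ofReal_le_ofReal ?_
      have := fourConst_le
      norm_num at this ⊢
      linarith
    calc _ ≤ 16⁻¹ * (zInt 1 a σ (U s) * (2 * m) + 2 * m * zInt 1 a σ (U s)) := by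
          gcongr
          · exact hU.sup s hs.1.le
          · exact hU.sup s hs.1.le
      _ = 16⁻¹ * 4 * (m * zInt 1 a σ (U s)) := by ring
      _ = 4⁻¹ * (m * zInt 1 a σ (U s)) := by
          congr 1
          have : (16 : ℝ≥0∞) = 4 * 4 := by norm_num
          rw [this, ENNReal.mul_inv (by simp) (by simp), mul_assoc,
            ENNReal.inv_mul_cancel (by simp) (by simp), mul_one]
      _ = _ := by rw [mul_assoc]
  -- The dissipation ν covers both the claimed coefficient and the quadratic term. Truncated
  -- subtraction is harmless since m ≤ ν.
  have h5 : (ENNReal.ofReal ν - m) / 2 + 4⁻¹ * m ≤ ENNReal.ofReal ν := by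
    calc _ ≤ (ENNReal.ofReal ν - m) + m := by
          gcongr
          · exact ENNReal.div_le_of_le_mul (by
              rw [mul_two]
              exact le_self_add)
          · calc 4⁻¹ * m ≤ 1 * m := by
                  gcongr
                  simp
              _ = m := one_mul m
      _ = _ := tsub_add_cancel_of_le hsmall
  have h6 : zInt (-1) a σ (U t) + (ENNReal.ofReal ν - m) / 2 * J + 4⁻¹ * m * J ≤
      m + 4⁻¹ * m * J := by
    calc _ = zInt (-1) a σ (U t) + ((ENNReal.ofReal ν - m) / 2 + 4⁻¹ * m) * J := by ring
      _ ≤ zInt (-1) a σ (U t) + ENNReal.ofReal ν * J := by gcongr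
      _ ≤ _ := h1
      _ ≤ _ := add_le_add le_rfl h2
  -- Cancelling a common term in [0, ∞] requires it to be finite, hence the earlier bound on J.
  have h7 : 4⁻¹ * m * J ≠ ∞ :=
    (ENNReal.mul_lt_top (ENNReal.mul_lt_top (by simp) hmfin) hJfin).ne
  exact (ENNReal.add_le_add_iff_right h7).1 h6

/-! ### The Fourier transform of the initial velocity -/

theorem integrable_norm_smul {a σ : ℝ} (ha : 0 < a) (hσ : 1 < σ) (N : ℕ) {g : R3 → C3}
    (hg : AEStronglyMeasurable g) (h : zInt (-1) a σ g < ∞) :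
    Integrable fun ξ => ‖ξ‖ ^ N • g ξ := by
  obtain ⟨C, hC, hle⟩ := lintegral_pow_mul_enorm_le ha hσ N
  refine ⟨by fun_prop, lt_of_le_of_lt ?_ ((hle g).trans_lt
    (ENNReal.mul_lt_top ENNReal.ofReal_lt_top h))⟩
  refine lintegral_mono fun ξ => ?_
  rw [enorm_smul, Real.enorm_of_nonneg (by positivity)]

/-- The Fourier transform of a real, divergence-free vector field has a representative which is
symmetric and divergence-free at every frequency. -/
theorem exists_symm_rep {a σ : ℝ} (ha : 0 < a) (hσ : 1 < σ) {f : 𝓢'(R3, C3)}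
    (hreal : IsRealDist f) (hdiv : IsDivFree f) (hmem : MemZ (-1) a σ f) :
    ∃ g : R3 → C3, Measurable g ∧ IsRepresentedBy (fourierDist f) g ∧
      (∀ ξ, g (-ξ) = conjC3 (g ξ)) ∧ ∀ ξ, leray ξ (g ξ) = g ξ := by
  obtain ⟨g, hgm, hrep⟩ := hmem.exists_rep
  have hz : zInt (-1) a σ g < ∞ := by rw [← zNorm_eq_zInt hrep]; exact hmem
  have hg := integrable_of_zInt ha hσ hgm.aestronglyMeasurable hz
  have hg1 : Integrable fun ξ => ‖ξ‖ • g ξ := by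
    simpa using integrable_norm_smul ha hσ 1 hgm.aestronglyMeasurable hz
  -- Averaging with the reflected conjugate and then projecting changes g only on a null set, and
  -- makes both identities hold at every frequency.
  obtain ⟨h, hh⟩ : ∃ h : R3 → C3, ∀ ξ, h ξ =
    leray ξ ((2⁻¹ : ℝ) • (g ξ + conjC3 (g (-ξ)))) := ⟨_, fun _ => rfl⟩
  have hhm : Measurable h := by
    have h1 : Measurable fun ξ => (2⁻¹ : ℝ) • (g ξ + conjC3 (g (-ξ))) :=
      (hgm.fun_add (conjC3.continuous.measurable.comp (hgm.comp measurable_neg))).fun_const_smul _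
    have h2 := measurable_leray.comp (measurable_id.prodMk h1)
    convert! h2 using 1
    exact funext hh
  have hgh : g =ᵐ[volume] h := by
    have h1 : ∀ᵐ ξ, ∀ i, g (-ξ) i = (starRingEnd ℂ) (g ξ i) :=
      ae_all_iff.2 fun i => hreal.symm_rep hg hrep i
    filter_upwards [h1, hdiv.rep hg hg1 hrep] with ξ h2 h3
    have h4 : conjC3 (g (-ξ)) = g ξ := by
      ext i
      rw [conjC3_apply, h2 i, Complex.conj_conj]
    rw [hh, h4, ← two_smul ℝ (g ξ), inv_smul_smul₀ two_ne_zero]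
    exact ((leray_eq_self_iff ξ (g ξ)).2 h3).symm
  refine ⟨h, hhm, hrep.congr hgh, fun ξ => ?_, fun ξ => ?_⟩
  · rw [hh, hh, neg_neg, ← leray_neg_conj]
    congr 1
    rw [map_smul, map_add, conjC3_conjC3, add_comm]
  · rw [hh, leray_leray]

/-! ### The weak form of the momentum equation -/

theorem testFunction_lineDeriv_apply (φ : 𝓓(spaceTime, ℝ)) (v z : ℝ × R3) :
    (∂_{v} φ : 𝓓(spaceTime, ℝ)) z = fderiv ℝ φ z v := by
  rw [TestFunction.lineDerivOp_eq_lineDerivCLM (𝕜 := ℝ), TestFunction.lineDerivCLM_eq_fderivCLM,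
    TestFunction.fderivCLM_apply_of_le]
  simp

/-- The momentum equation tested against test functions. -/
theorem momentum_iff {ν : ℝ} {v : ℝ → R3 → R3} {p : 𝓓'(spaceTime, ℝ)}
    (h1 : ∀ i, LocallyIntegrableOn (fun z : ℝ × R3 => v z.1 z.2 i) spaceTime)
    (h2 : ∀ i j, LocallyIntegrableOn (fun z : ℝ × R3 => v z.1 z.2 j * v z.1 z.2 i) spaceTime)
    (i : Fin 3) :
    (∂_{timeDir} (regularDist fun z => v z.1 z.2 i)
      - ν • ∑ j : Fin 3, ∂_{spaceDir j} (∂_{spaceDir j} (regularDist fun z => v z.1 z.2 i))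
      + ∑ j : Fin 3, ∂_{spaceDir j} (regularDist fun z => v z.1 z.2 j * v z.1 z.2 i)
      = -∂_{spaceDir i} p) ↔
    ∀ φ : 𝓓(spaceTime, ℝ),
      (∫ z : ℝ × R3, (∂_{timeDir} φ : 𝓓(spaceTime, ℝ)) z * v z.1 z.2 i) +
      ν * (∑ j : Fin 3, ∫ z : ℝ × R3,
        (∂_{spaceDir j} (∂_{spaceDir j} φ) : 𝓓(spaceTime, ℝ)) z * v z.1 z.2 i) +
      (∑ j : Fin 3, ∫ z : ℝ × R3,
        (∂_{spaceDir j} φ : 𝓓(spaceTime, ℝ)) z * (v z.1 z.2 j * v z.1 z.2 i)) +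
      p (∂_{spaceDir i} φ) = 0 := by
  have key : ∀ φ : 𝓓(spaceTime, ℝ),
      (∂_{timeDir} (regularDist fun z => v z.1 z.2 i)
      - ν • ∑ j : Fin 3, ∂_{spaceDir j} (∂_{spaceDir j} (regularDist fun z => v z.1 z.2 i))
      + ∑ j : Fin 3, ∂_{spaceDir j} (regularDist fun z => v z.1 z.2 j * v z.1 z.2 i)) φ =
      -(∫ z : ℝ × R3, (∂_{timeDir} φ : 𝓓(spaceTime, ℝ)) z * v z.1 z.2 i) -
      ν * (∑ j : Fin 3, ∫ z : ℝ × R3,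
        (∂_{spaceDir j} (∂_{spaceDir j} φ) : 𝓓(spaceTime, ℝ)) z * v z.1 z.2 i) -
      (∑ j : Fin 3, ∫ z : ℝ × R3,
        (∂_{spaceDir j} φ : 𝓓(spaceTime, ℝ)) z * (v z.1 z.2 j * v z.1 z.2 i)) := by
    intro φ
    have e1 : ∀ (h : ℝ × R3 → ℝ) (ψ : 𝓓(spaceTime, ℝ)), regularDist h (-ψ) = -regularDist h ψ :=
      fun h ψ => map_neg (regularDist h) ψ
    simp only [Fin.sum_univ_three, add_apply, sub_apply, smul_apply,
      Distribution.lineDerivOp_apply_apply, e1, LineDeriv.lineDerivOp_neg, neg_neg,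
      regularDist_apply (h1 i), regularDist_apply (h2 i _), smul_eq_mul]
    ring
  have key2 : ∀ φ : 𝓓(spaceTime, ℝ), (-∂_{spaceDir i} p : 𝓓'(spaceTime, ℝ)) φ =
      p (∂_{spaceDir i} φ) := by
    intro φ
    have e1 : (-∂_{spaceDir i} p : 𝓓'(spaceTime, ℝ)) φ = -((∂_{spaceDir i} p : 𝓓'(spaceTime, ℝ)) φ) := rfl
    rw [e1, Distribution.lineDerivOp_apply_apply, map_neg, neg_neg]
  constructor
  · intro h φ
    have h3 := congrArg (fun T : 𝓓'(spaceTime, ℝ) => T φ) h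
    simp only at h3
    rw [key φ, key2 φ] at h3
    linarith
  · intro h
    refine DFunLike.ext _ _ fun φ => ?_
    rw [key, key2]
    linarith [h φ]

/-! ### Slices of test functions -/

theorem contDiff_slice (φ : 𝓓(spaceTime, ℝ)) (t : ℝ) :
    ContDiff ℝ (⊤ : ℕ∞) fun x : R3 => φ (t, x) :=
  φ.contDiff.comp (contDiff_const.prodMk contDiff_id)

theorem hasCompactSupport_slice (φ : 𝓓(spaceTime, ℝ)) (t : ℝ) :
    HasCompactSupport fun x : R3 => φ (t, x) := by
  refine HasCompactSupport.intro (φ.hasCompactSupport.image continuous_snd) fun x hx => ?_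
  by_contra h
  exact hx ⟨(t, x), subset_tsupport _ h, rfl⟩

/-- The slice `φ(t, ·)` of a space-time test function. -/
noncomputable def slice (φ : 𝓓(spaceTime, ℝ)) (t : ℝ) : 𝓢(R3, ℂ) :=
  schwartzOfReal _ (contDiff_slice φ t) (hasCompactSupport_slice φ t)

theorem slice_apply (φ : 𝓓(spaceTime, ℝ)) (t : ℝ) (x : R3) : slice φ t x = (φ (t, x) : ℂ) := rfl

theorem lineDeriv_slice (φ : 𝓓(spaceTime, ℝ)) (j : Fin 3) (t : ℝ) :
    (∂_{basisVec j} (slice φ t) : 𝓢(R3, ℂ)) = slice (∂_{spaceDir j} φ) t := by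
  ext x
  rw [slice, lineDeriv_schwartzOfReal, slice_apply, testFunction_lineDeriv_apply]
  congr 1
  have h1 : HasFDerivAt φ (fderiv ℝ φ (t, x)) (t, x) :=
    ((φ.contDiff.differentiable (by simp)) _).hasFDerivAt
  have h2 : HasFDerivAt (fun x : R3 => φ (t, x)) _ x := h1.comp x (hasFDerivAt_prodMk_right t x)
  rw [h2.fderiv]
  rfl

theorem hasDerivAt_test (φ : 𝓓(spaceTime, ℝ)) (t : ℝ) (x : R3) :
    HasDerivAt (fun s => φ (s, x)) ((∂_{timeDir} φ : 𝓓(spaceTime, ℝ)) (t, x)) t := by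
  rw [testFunction_lineDeriv_apply]
  have h1 : HasFDerivAt φ (fderiv ℝ φ (t, x)) (t, x) :=
    ((φ.contDiff.differentiable (by simp)) _).hasFDerivAt
  have h2 : HasDerivAt (fun s : ℝ => (s, x)) timeDir t :=
    (hasDerivAt_id t).prodMk (hasDerivAt_const t x)
  exact h1.comp_hasDerivAt t h2

theorem test_eq_zero (φ : 𝓓(spaceTime, ℝ)) {t : ℝ} (ht : t ≤ 0) (x : R3) : φ (t, x) = 0 := by
  by_contra h
  have h1 : (t, x) ∈ (spaceTime : Set (ℝ × R3)) := φ.tsupport_subset (subset_tsupport _ h)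
  exact absurd h1.1 (not_lt.2 ht)

theorem exists_test_bound (φ : 𝓓(spaceTime, ℝ)) :
    ∃ T K R : ℝ, 0 < T ∧ 0 ≤ K ∧ (∀ z, ‖φ z‖ ≤ K) ∧
      (∀ z : ℝ × R3, φ z ≠ 0 → z.1 ∈ Ioo 0 T ∧ z.2 ∈ Metric.closedBall (0 : R3) R) := by
  obtain ⟨K, hK⟩ := φ.continuous.bounded_above_of_compact_support φ.hasCompactSupport
  obtain ⟨R, hR⟩ := φ.hasCompactSupport.isBounded.subset_closedBall (0 : ℝ × R3)
  refine ⟨max R 0 + 1, K, R, by positivity, (norm_nonneg _).trans (hK 0), hK, fun z hz => ?_⟩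
  have h1 := hR (subset_tsupport _ hz)
  have h2 : ‖z.1‖ ≤ R ∧ ‖z.2‖ ≤ R := by
    rw [mem_closedBall_zero_iff, Prod.norm_def] at h1
    exact max_le_iff.1 h1
  refine ⟨⟨?_, ?_⟩, mem_closedBall_zero_iff.2 h2.2⟩
  · by_contra h
    exact hz (test_eq_zero φ (not_lt.1 h) z.2)
  · have := le_abs_self z.1
    have h3 : |z.1| ≤ R := h2.1
    have := le_max_left R 0
    linarith

/-- The test function has compact support in t > 0, so a bound by a function of time alone,
integrable on each (0, T], suffices. -/
theorem integrable_test_mul (φ : 𝓓(spaceTime, ℝ)) {h : ℝ × R3 → ℂ} (hm : Measurable h)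
    {b : ℝ → ℝ} (hb : ∀ T, IntegrableOn b (Ioc 0 T)) (hle : ∀ z, ‖h z‖ ≤ b z.1) :
    Integrable fun z => (φ z : ℂ) * h z := by
  obtain ⟨T, K, R, -, hK, hφ, hsupp⟩ := exists_test_bound φ
  have h1 : Integrable ((Ioc 0 T).indicator b) := (hb T).integrable_indicator measurableSet_Ioc
  have h2 : Integrable ((Metric.closedBall (0 : R3) R).indicator fun _ => K) :=
    (integrableOn_const (isCompact_closedBall _ _).measure_lt_top.ne).integrable_indicator
      Metric.isClosed_closedBall.measurableSet
  have h3 := h1.mul_prod h2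
  rw [← Measure.volume_eq_prod] at h3
  refine h3.mono' ?_ (Eventually.of_forall fun z => ?_)
  · exact ((Complex.continuous_ofReal.comp φ.continuous).measurable.mul hm).aestronglyMeasurable
  · by_cases hz : φ z = 0
    · have h0 : 0 ≤ b z.1 := (norm_nonneg _).trans (hle z)
      rw [hz]
      simp only [Complex.ofReal_zero, zero_mul, norm_zero]
      exact mul_nonneg (indicator_apply_nonneg fun _ => h0) (indicator_apply_nonneg fun _ => hK)
    · obtain ⟨h4, h5⟩ := hsupp z hz
      rw [indicator_of_mem (Ioo_subset_Ioc_self h4), indicator_of_mem h5, norm_mul,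
        Complex.norm_real, mul_comm (b z.1)]
      exact mul_le_mul (hφ z) (hle z) (norm_nonneg _) hK

/-- The fundamental theorem of calculus is applied only to the test function, which vanishes at
times 0 and T. The other factor is a primitive of a merely integrable function, handled by
exchanging integrals on the triangle. -/
theorem integral_timeDeriv_mul (φ : 𝓓(spaceTime, ℝ)) (x : R3) {y : ℂ} {T : ℝ} {m : ℝ → ℂ}
    (hT : φ (T, x) = 0) (hm : IntegrableOn m (Ioc 0 T)) :
    ∫ t in Ioc 0 T, ((∂_{timeDir} φ : 𝓓(spaceTime, ℝ)) (t, x) : ℂ) *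
      (y + ∫ s in Ioc 0 t, m s) = -∫ t in Ioc 0 T, (φ (t, x) : ℂ) * m t := by
  rcases lt_or_ge T 0 with hT0 | hT0
  · simp [Ioc_eq_empty (not_lt.2 hT0.le)]
  obtain ⟨K, hK⟩ : ∃ K : ℝ → ℝ, ∀ t, (∂_{timeDir} φ : 𝓓(spaceTime, ℝ)) (t, x) = K t :=
    ⟨_, fun _ => rfl⟩
  have hKc : Continuous K := by
    have : Continuous fun t : ℝ => (∂_{timeDir} φ : 𝓓(spaceTime, ℝ)) (t, x) :=
      (TestFunction.continuous _).comp (by fun_prop)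
    simpa only [hK] using this
  have hint : ∀ r ∈ Icc 0 T, ∫ s in Ioc r T, K s = -φ (r, x) := by
    intro r hr
    rw [← intervalIntegral.integral_of_le hr.2, intervalIntegral.integral_eq_sub_of_hasDerivAt
      (f := fun s => φ (s, x)) (fun s _ => by rw [← hK]; exact hasDerivAt_test φ s x)
      (hKc.intervalIntegrable _ _), hT, zero_sub]
  have h1 := integral_triangle_swap T (hKc.integrableOn_Ioc (a := 0) (b := T)) hm
  have h2 : ∫ t in Ioc 0 T, (K t : ℂ) * y = 0 := by
    rw [integral_mul_const]
    have : ∫ t in Ioc 0 T, (K t : ℂ) = ((∫ t in Ioc 0 T, K t : ℝ) : ℂ) := integral_ofReal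
    rw [this, hint 0 ⟨le_rfl, hT0⟩, test_eq_zero φ le_rfl]
    simp
  simp only [hK, mul_add]
  have i1 : IntegrableOn (fun t => (K t : ℂ) * y) (Ioc 0 T) :=
    ((Complex.continuous_ofReal.comp hKc).mul_const y).integrableOn_Ioc
  have i2 : IntegrableOn (fun t => (K t : ℂ) * ∫ s in Ioc 0 t, m s) (Ioc 0 T) := by
    have h3 : ContinuousOn (fun t => (K t : ℂ) * ∫ s in Ioc 0 t, m s) (Icc 0 T) :=
      (Complex.continuous_ofReal.comp hKc).continuousOn.mul (continuous_setIntegral_Ioc hm)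
    exact (h3.integrableOn_Icc).mono_set Ioc_subset_Icc_self
  rw [integral_add i1 i2, h2, zero_add]
  simp only [Complex.real_smul] at h1
  rw [h1, ← integral_neg]
  refine setIntegral_congr_fun measurableSet_Ioc fun r hr => ?_
  simp only [hint r ⟨hr.1.le, hr.2⟩]
  push_cast
  ring

theorem measurable_synth {f : ℝ → R3 → ℂ} (hf : Measurable (Function.uncurry f)) :
    Measurable fun z : ℝ × R3 => synth (f z.1) z.2 := by
  have h1 : Measurable fun q : (ℝ × R3) × R3 =>
      Complex.exp (Complex.I * (inner ℝ q.1.2 q.2 : ℝ)) • f q.1.1 q.2 := by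
    simp only [smul_eq_mul]
    refine Measurable.mul ?_ (hf.comp (by fun_prop : Measurable fun q : (ℝ × R3) × R3 =>
      (q.1.1, q.2)))
    exact (by fun_prop : Continuous fun q : (ℝ × R3) × R3 =>
      Complex.exp (Complex.I * (inner ℝ q.1.2 q.2 : ℝ))).measurable
  exact (h1.stronglyMeasurable.integral_prod_right').measurable.const_smul (fourConst : ℂ)

theorem synth_eq_add_setIntegral {u f : ℝ → R3 → ℂ} {t : ℝ} (h0 : Integrable (u 0))
    (hf : Integrable (Function.uncurry f) ((volume.restrict (Ioc 0 t)).prod volume))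
    (h : ∀ᵐ ξ, u t ξ = u 0 ξ + ∫ s in Ioc 0 t, f s ξ) (x : R3) :
    synth (u t) x = synth (u 0) x + ∫ s in Ioc 0 t, synth (f s) x := by
  have hi : Integrable fun ξ => ∫ s in Ioc 0 t, f s ξ := hf.integral_prod_right
  rw [synth_congr (h := fun ξ => u 0 ξ + ∫ s in Ioc 0 t, f s ξ) h, synth_add h0 hi]
  congr 1
  simp only [synth]
  rw [integral_smul]
  congr 1
  have hw : Integrable (Function.uncurry fun (s : ℝ) (ξ : R3) =>
      Complex.exp (Complex.I * (inner ℝ x ξ : ℝ)) • f s ξ)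
      ((volume.restrict (Ioc 0 t)).prod volume) := by
    refine (integrable_norm_iff ?_).1 (hf.norm.congr (Eventually.of_forall fun q => ?_))
    · exact (((continuous_wave' x).comp continuous_snd).aestronglyMeasurable).smul hf.1
    · simp only [Function.uncurry, norm_smul, norm_cexp_I_mul_ofReal, one_mul]
  rw [integral_integral_swap hw]
  refine integral_congr_ae (Eventually.of_forall fun ξ => ?_)
  simp only
  rw [integral_smul]

/-- Integration by parts in time for the inverse Fourier transform of an absolutely continuous
family. -/
theorem integral_timeDeriv_mul_synth (φ : 𝓓(spaceTime, ℝ)) {u f : ℝ → R3 → ℂ}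
    (hu : Measurable (Function.uncurry u)) (hf : Measurable (Function.uncurry f))
    (hb : ∀ T, IntegrableOn (fun t => ∫ ξ, ‖u t ξ‖) (Ioc 0 T)) (h0 : Integrable (u 0))
    (hfi : ∀ T, Integrable (Function.uncurry f) ((volume.restrict (Ioc 0 T)).prod volume))
    (h : ∀ t, 0 ≤ t → ∀ᵐ ξ, u t ξ = u 0 ξ + ∫ s in Ioc 0 t, f s ξ) :
    ∫ z : ℝ × R3, ((∂_{timeDir} φ : 𝓓(spaceTime, ℝ)) z : ℂ) * synth (u z.1) z.2 =
      -∫ z : ℝ × R3, (φ z : ℂ) * synth (f z.1) z.2 := by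
  have i1 := integrable_test_mul (∂_{timeDir} φ) (measurable_synth hu)
    (fun T => (hb T).const_mul fourConst) fun z => norm_synth_le _
  have hbf : ∀ T, IntegrableOn (fun t => fourConst * ∫ ξ, ‖f t ξ‖) (Ioc 0 T) := fun T =>
    ((hfi T).norm.integral_prod_left).const_mul _
  have i2 := integrable_test_mul φ (measurable_synth hf) hbf fun z => norm_synth_le _
  rw [Measure.volume_eq_prod] at i1 i2 ⊢
  rw [integral_prod_symm _ i1, integral_prod_symm _ i2, ← integral_neg]
  refine integral_congr_ae (Eventually.of_forall fun x => ?_)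
  beta_reduce
  obtain ⟨T, K, R, hT, -, -, hsupp⟩ := exists_test_bound φ
  obtain ⟨T', K', R', hT', -, -, hsupp'⟩ := exists_test_bound (∂_{timeDir} φ)
  have r1 : ∀ (ψ : 𝓓(spaceTime, ℝ)) (k : ℝ → ℂ) (S : ℝ),
      (∀ z : ℝ × R3, ψ z ≠ 0 → z.1 ∈ Ioc 0 S) →
      ∫ t, (ψ (t, x) : ℂ) * k t = ∫ t in Ioc 0 S, (ψ (t, x) : ℂ) * k t := by
    intro ψ k S hS
    refine (setIntegral_eq_integral_of_forall_compl_eq_zero fun t ht => ?_).symm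
    have : ψ (t, x) = 0 := by
      by_contra hne
      exact ht (hS _ hne)
    rw [this]
    simp
  obtain ⟨S, hS⟩ : ∃ S, S = max T T' := ⟨_, rfl⟩
  rw [r1 φ _ S fun z hz => ⟨(hsupp z hz).1.1, (hsupp z hz).1.2.le.trans (hS ▸ le_max_left _ _)⟩,
    r1 _ _ S fun z hz => ⟨(hsupp' z hz).1.1, (hsupp' z hz).1.2.le.trans (hS ▸ le_max_right _ _)⟩]
  have hSx : φ (S, x) = 0 := by
    by_contra hne
    have := (hsupp _ hne).1.2
    exact absurd this (not_lt.2 (hS ▸ le_max_left _ _))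
  have hm : IntegrableOn (fun s => synth (f s) x) (Ioc 0 S) := by
    refine (hbf S).mono' ?_ (Eventually.of_forall fun s => norm_synth_le _)
    exact ((measurable_synth hf).comp (measurable_id.prodMk measurable_const)).aestronglyMeasurable
  rw [← integral_timeDeriv_mul φ x (y := synth (u 0) x) hSx hm]
  refine setIntegral_congr_fun measurableSet_Ioc fun t ht => ?_
  simp only
  rw [synth_eq_add_setIntegral h0 (hfi t) (h t ht.1.le)]

/-! ### The spatial part of the weak formulation -/

/-- The Fourier transform of the pressure of the velocity field with Fourier transform `g`. -/
noncomputable def presHat (g : R3 → C3) (ξ : R3) : ℂ :=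
  -((fourConst : ℂ) * (fdot ξ (transport g g ξ) / ((‖ξ‖ ^ 2 : ℝ) : ℂ)))

/-- The time derivative of `û`, in terms of `g = û`. -/
noncomputable def forcing (ν : ℝ) (g : R3 → C3) (ξ : R3) : C3 :=
  -((ν * ‖ξ‖ ^ 2) • g ξ) + nlin g g ξ

theorem measurable_presHat {U : ℝ → R3 → C3} (hU : Measurable (Function.uncurry U)) :
    Measurable (Function.uncurry fun t => presHat (U t)) := by
  have h1 : Measurable fun q : ℝ × R3 => fdot q.2 (transport (U q.1) (U q.1) q.2) :=
    continuous_fdot.measurable.comp (measurable_snd.prodMk (measurable_transport hU hU))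
  have h2 : Measurable fun q : ℝ × R3 => ((‖q.2‖ ^ 2 : ℝ) : ℂ) := by fun_prop
  exact ((h1.div h2).const_mul _).neg

theorem measurable_forcing (ν : ℝ) {U : ℝ → R3 → C3} (hU : Measurable (Function.uncurry U)) :
    Measurable (Function.uncurry fun t => forcing ν (U t)) := by
  have h2 : Measurable fun q : ℝ × R3 => (ν * ‖q.2‖ ^ 2) • U q.1 q.2 :=
    Measurable.smul (by fun_prop : Measurable fun q : ℝ × R3 => ν * ‖q.2‖ ^ 2) hU
  exact h2.neg.add (measurable_nlin hU hU)

/-- The two factors of ξ in the numerator cancel the Laplacian, so the pressure is an operator of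
order 0 applied to u⊗u and its transform is integrable. -/
theorem enorm_presHat_le (g : R3 → C3) (ξ : R3) :
    ‖presHat g ξ‖ₑ ≤ ENNReal.ofReal fourConst * absConv g g ξ := by
  rw [presHat, enorm_neg, enorm_mul]
  have h1 : ‖(fourConst : ℂ)‖ₑ = ENNReal.ofReal fourConst := by
    rw [← ofReal_norm, Complex.norm_real, Real.norm_of_nonneg fourConst_pos.le]
  rw [h1]
  refine mul_le_mul_right ?_ _
  rcases eq_or_ne ξ 0 with rfl | hξ
  · simp
  have hn : 0 < ‖ξ‖ := norm_pos_iff.2 hξ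
  have h2 : ‖fdot ξ (transport g g ξ)‖ₑ ≤ ENNReal.ofReal (‖ξ‖ ^ 2) * absConv g g ξ := by
    refine (enorm_fdot_le _ _).trans ?_
    rw [pow_two, ENNReal.ofReal_mul hn.le, mul_assoc]
    exact mul_le_mul_right (enorm_transport_le _ _ _) _
  have h3 : ‖(((‖ξ‖ ^ 2 : ℝ) : ℂ))⁻¹‖ₑ = (ENNReal.ofReal (‖ξ‖ ^ 2))⁻¹ := by
    rw [← ofReal_norm, norm_inv, Complex.norm_real, Real.norm_of_nonneg (by positivity),
      ENNReal.ofReal_inv_of_pos (by positivity)]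
  rw [div_eq_mul_inv, enorm_mul, h3, mul_comm]
  refine (mul_le_mul_right h2 _).trans_eq ?_
  rw [← mul_assoc, ENNReal.inv_mul_cancel (by simpa using hξ) ENNReal.ofReal_ne_top, one_mul]

theorem integrable_presHat {g : R3 → C3} (hgm : Measurable g) (hg : Integrable g) :
    Integrable (presHat g) := by
  refine ⟨((measurable_presHat (U := fun _ => g) (hgm.comp measurable_snd)).of_uncurry_left
    (x := 0)).aestronglyMeasurable, (lintegral_mono (enorm_presHat_le g)).trans_lt ?_⟩
  rw [lintegral_const_mul' _ _ ENNReal.ofReal_ne_top, lintegral_absConv hgm hgm]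
  exact ENNReal.mul_lt_top ENNReal.ofReal_lt_top (ENNReal.mul_lt_top hg.2 hg.2)

theorem presHat_neg_conj {g : R3 → C3} (hg : ∀ ξ, g (-ξ) = conjC3 (g ξ)) (ξ : R3) :
    presHat g (-ξ) = (starRingEnd ℂ) (presHat g ξ) := by
  have h : ∀ v : C3, fdot (-ξ) (-v) = fdot ξ v := fun v => by simp [fdot]
  have h' : (starRingEnd ℂ) (fdot ξ (transport g g ξ)) = -fdot (-ξ) (conjC3 (transport g g ξ)) := by
    rw [fdot_neg_conj, neg_neg]
  have h'' : fdot (-ξ) (-conjC3 (transport g g ξ)) =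
      -fdot (-ξ) (conjC3 (transport g g ξ)) := by simp [fdot]
  rw [presHat, presHat, transport_neg_conj hg hg, h'', ← h', norm_neg]
  simp

theorem integral_mul_synth_add (S : 𝓢(R3, ℂ)) {f g : R3 → ℂ} (hf : Integrable f)
    (hg : Integrable g) : ∫ x, S x * synth (fun ξ => f ξ + g ξ) x =
      (∫ x, S x * synth f x) + ∫ x, S x * synth g x := by
  simp only [synth_add hf hg, mul_add]
  exact integral_add (integrable_schwartz_smul_synth S hf) (integrable_schwartz_smul_synth S hg)

theorem integral_mul_synth_const_mul (S : 𝓢(R3, ℂ)) (c : ℂ) (f : R3 → ℂ) :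
    ∫ x, S x * synth (fun ξ => c * f ξ) x = c * ∫ x, S x * synth f x := by
  have : ∀ x, synth (fun ξ => c * f ξ) x = c * synth f x := fun x => synth_smul c f x
  simp only [this]
  rw [← integral_const_mul]
  exact integral_congr_ae (Eventually.of_forall fun x => by ring)

theorem integral_mul_synth_neg (S : 𝓢(R3, ℂ)) (f : R3 → ℂ) :
    ∫ x, S x * synth (fun ξ => -f ξ) x = -∫ x, S x * synth f x := by
  simpa using integral_mul_synth_const_mul S (-1) f

theorem integral_mul_synth_sum (S : 𝓢(R3, ℂ)) {f : Fin 3 → R3 → ℂ} (hf : ∀ j, Integrable (f j)) :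
    ∫ x, S x * synth (fun ξ => ∑ j, f j ξ) x = ∑ j, ∫ x, S x * synth (f j) x := by
  simp only [synth_sum Finset.univ (fun j _ => hf j), Finset.mul_sum]
  exact integral_finsetSum _ fun j _ => integrable_schwartz_smul_synth S (hf j)

theorem enorm_conv_coord_le (g : R3 → C3) (j i : Fin 3) (ξ : R3) :
    ‖∫ η, g η j * g (ξ - η) i‖ₑ ≤ absConv g g ξ := by
  refine (enorm_integral_le_lintegral_enorm _).trans (lintegral_mono fun η => ?_)
  rw [enorm_mul]
  exact mul_le_mul' (enorm_coord_le _ _) (enorm_coord_le _ _)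

theorem enorm_I_mul_coord_le (ξ : R3) (j : Fin 3) :
    ‖Complex.I * (ξ j : ℂ)‖ₑ ≤ ENNReal.ofReal ‖ξ‖ := by
  rw [← ofReal_norm]
  refine ENNReal.ofReal_le_ofReal ?_
  rw [norm_mul, Complex.norm_I, one_mul, Complex.norm_real]
  exact abs_coord_le ξ j

theorem sum_coord_sq (ξ : R3) : ∑ j : Fin 3, (ξ j : ℂ) ^ 2 = ((‖ξ‖ ^ 2 : ℝ) : ℂ) := by
  rw [EuclideanSpace.real_norm_sq_eq]
  push_cast
  rfl

/-- The spatial part of the weak formulation of the Navier-Stokes equations, at a fixed time. -/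
theorem spatial_weak_form (ν : ℝ) {g : R3 → C3} (hgm : Measurable g) (hg : Integrable g)
    (hg1 : Integrable fun ξ => ‖ξ‖ • g ξ) (hg2 : Integrable fun ξ => ‖ξ‖ ^ 2 • g ξ)
    (hN : ∫⁻ ξ, nlinMaj g g ξ < ∞) (S : 𝓢(R3, ℂ)) (i : Fin 3) :
    ν * (∑ j : Fin 3, ∫ x, (∂_{basisVec j} (∂_{basisVec j} S) : 𝓢(R3, ℂ)) x * synth g x i) +
      (∑ j : Fin 3, ∫ x, (∂_{basisVec j} S : 𝓢(R3, ℂ)) x * (synth g x j * synth g x i)) +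
      ∫ x, (∂_{basisVec i} S : 𝓢(R3, ℂ)) x * synth (presHat g) x =
    ∫ x, S x * synth (fun ξ => forcing ν g ξ i) x := by
  have hgi := fun i => integrable_coord hg i
  have hd1 : ∀ j, Integrable fun ξ : R3 => (Complex.I * (ξ j : ℂ)) * g ξ i := fun j =>
    integrable_I_mul_coord (hgi i) (integrable_coord hg1 i) j
  have hd2 : ∀ j, Integrable fun ξ : R3 =>
      (Complex.I * (ξ j : ℂ)) * ((Complex.I * (ξ j : ℂ)) * g ξ i) := fun j => by
    refine Integrable.mono (integrable_coord hg2 i) (by fun_prop)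
      (Eventually.of_forall fun ξ => ?_)
    have h1 : ‖Complex.I * (ξ j : ℂ)‖ ≤ ‖ξ‖ := by
      rw [norm_mul, Complex.norm_I, one_mul, Complex.norm_real]
      exact abs_coord_le ξ j
    have h2 : ‖(‖ξ‖ ^ 2 • g ξ) i‖ = ‖ξ‖ ^ 2 * ‖g ξ i‖ := by
      rw [PiLp.smul_apply, norm_smul, Real.norm_of_nonneg (by positivity)]
    rw [h2, norm_mul, norm_mul (Complex.I * (ξ j : ℂ)), pow_two, mul_assoc]
    gcongr
  have hc : ∀ j, Integrable fun ξ => (fourConst : ℂ) * ∫ η, g η j * g (ξ - η) i := fun j =>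
    (integrable_conv (hgi j) (hgi i)).const_mul _
  have hfc : ‖(fourConst : ℂ)‖ₑ = ENNReal.ofReal fourConst := by
    rw [← ofReal_norm, Complex.norm_real, Real.norm_of_nonneg fourConst_pos.le]
  -- A derivative of uⱼuᵢ costs a factor |ξ|. The result is dominated by `nlinMaj`, which is assumed
  -- integrable.
  have hdc : ∀ j, Integrable fun ξ : R3 =>
      (Complex.I * (ξ j : ℂ)) * ((fourConst : ℂ) * ∫ η, g η j * g (ξ - η) i) := fun j => by
    refine ⟨AEStronglyMeasurable.mul (by fun_prop) (hc j).1, lt_of_le_of_lt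
      (lintegral_mono fun ξ => ?_) hN⟩
    rw [enorm_mul, enorm_mul (fourConst : ℂ), nlinMaj, hfc, mul_left_comm]
    exact mul_le_mul_right (mul_le_mul' (enorm_I_mul_coord_le ξ j) (enorm_conv_coord_le g j i ξ)) _
  have hp := integrable_presHat hgm hg
  have hdp : Integrable fun ξ : R3 => (Complex.I * (ξ i : ℂ)) * presHat g ξ := by
    refine ⟨AEStronglyMeasurable.mul (by fun_prop) hp.1, lt_of_le_of_lt
      (lintegral_mono fun ξ => ?_) hN⟩
    rw [enorm_mul, nlinMaj, mul_left_comm]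
    exact mul_le_mul' (enorm_I_mul_coord_le ξ i) (enorm_presHat_le g ξ)
  have e1 : ∀ j, ∫ x, (∂_{basisVec j} (∂_{basisVec j} S) : 𝓢(R3, ℂ)) x * synth g x i =
      ∫ x, S x * synth (fun ξ : R3 =>
        (Complex.I * (ξ j : ℂ)) * ((Complex.I * (ξ j : ℂ)) * g ξ i)) x := fun j => by
    simp only [synth_coord hg]
    rw [integral_lineDeriv_mul_synth _ j (hgi i) (hd1 j),
      integral_lineDeriv_mul_synth _ j (hd1 j) (hd2 j), neg_neg]
  have e2 : ∀ j, ∫ x, (∂_{basisVec j} S : 𝓢(R3, ℂ)) x * (synth g x j * synth g x i) =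
      -∫ x, S x * synth (fun ξ : R3 =>
        (Complex.I * (ξ j : ℂ)) * ((fourConst : ℂ) * ∫ η, g η j * g (ξ - η) i)) x := fun j => by
    simp only [synth_coord hg, synth_mul_synth (hgi j) (hgi i)]
    rw [integral_lineDeriv_mul_synth _ j (hc j) (hdc j)]
  rw [integral_lineDeriv_mul_synth _ i hp hdp]
  simp only [e1, e2, Finset.sum_neg_distrib]
  rw [← integral_mul_synth_sum S hd2, ← integral_mul_synth_sum S hdc,
    ← integral_mul_synth_const_mul, ← integral_mul_synth_neg, ← integral_mul_synth_neg,
    ← integral_mul_synth_add S ((integrable_finsetSum _ fun j _ => hd2 j).const_mul _)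
      (integrable_finsetSum _ fun j _ => hdc j).fun_neg,
    ← integral_mul_synth_add S (((integrable_finsetSum _ fun j _ => hd2 j).const_mul _).fun_add
      (integrable_finsetSum _ fun j _ => hdc j).fun_neg) hdp.fun_neg]
  congr 1
  funext x
  congr 1
  refine congrFun (synth_congr ?_) x
  filter_upwards [transport_coord hg hg i] with ξ hξ
  have h1 : ∑ j : Fin 3, Complex.I * (ξ j : ℂ) * (Complex.I * (ξ j : ℂ) * g ξ i) =
      -(((‖ξ‖ ^ 2 : ℝ) : ℂ) * g ξ i) := by
    rw [← sum_coord_sq, Finset.sum_mul, ← Finset.sum_neg_distrib]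
    refine Finset.sum_congr rfl fun j _ => ?_
    linear_combination ((ξ j : ℂ) ^ 2 * g ξ i) * Complex.I_sq
  have h2 : ∑ j : Fin 3, Complex.I * (ξ j : ℂ) * ((fourConst : ℂ) * ∫ η, g η j * g (ξ - η) i) =
      Complex.I * fourConst * transport g g ξ i := by
    rw [hξ, Finset.mul_sum]
    exact Finset.sum_congr rfl fun j _ => by ring
  -- All terms are now one Fourier multiplier against S. The part of the quadratic term parallel to
  -- ξ, removed by the Leray projector, is exactly the contribution of `presHat`.
  have h3 : forcing ν g ξ i = -((ν : ℂ) * ((‖ξ‖ ^ 2 : ℝ) : ℂ) * g ξ i) -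
      Complex.I * fourConst * (transport g g ξ i -
        fdot ξ (transport g g ξ) / ((‖ξ‖ ^ 2 : ℝ) : ℂ) * (ξ i : ℂ)) := by
    rw [forcing, nlin, leray_apply]
    simp only [PiLp.add_apply, PiLp.neg_apply, PiLp.smul_apply, PiLp.sub_apply, toC3_apply,
      Complex.real_smul, smul_eq_mul]
    push_cast
    ring
  rw [h1, h2, h3, presHat]
  ring

/-! ### Estimates of the time derivative -/

section Forcing

variable {ν a σ : ℝ} {U : ℝ → R3 → C3}

theorem lintegral_nlinMaj_set_le (ha : 0 < a) (hσ : 1 < σ) (hU : Measurable (Function.uncurry U))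
    {S : Set ℝ} (hS : MeasurableSet S) {M : ℝ≥0∞} (hb : ∀ t ∈ S, zInt (-1) a σ (U t) ≤ M) :
    ∫⁻ s in S, ∫⁻ ξ, wt (-1) a σ ξ * nlinMaj (U s) (U s) ξ ≤
      ENNReal.ofReal fourConst * (2 * M) * ∫⁻ s in S, zInt 1 a σ (U s) := by
  rw [← lintegral_const_mul _ (measurable_zInt 1 a σ hU)]
  refine setLIntegral_mono' hS fun s hs => ?_
  have h := lintegral_nlinMaj_le ha hσ one_pos (f := U s) (g := U s) hU.of_uncurry_left
    hU.of_uncurry_left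
  rw [inv_one, ENNReal.ofReal_one, one_mul, one_mul] at h
  refine h.trans ?_
  rw [mul_assoc]
  refine mul_le_mul_right ?_ _
  calc _ ≤ zInt 1 a σ (U s) * M + M * zInt 1 a σ (U s) :=
        add_le_add (mul_le_mul_right (hb s hs) _) (mul_le_mul_left (hb s hs) _)
    _ = _ := by ring

/-- The viscous term lies in L¹ with values in Z⁻¹ because u lies in L¹ with values in Z¹. The
quadratic term follows from the bilinear estimate and the bound in Z⁻¹. -/
theorem setLIntegral_zInt_forcing_lt_top (hν : 0 ≤ ν) (ha : 0 < a) (hσ : 1 < σ)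
    (hU : Measurable (Function.uncurry U)) {S : Set ℝ} (hS : MeasurableSet S) {M : ℝ≥0∞}
    (hM : M < ∞) (hb : ∀ t ∈ S, zInt (-1) a σ (U t) ≤ M)
    (hi : ∫⁻ s in S, zInt 1 a σ (U s) < ∞) :
    ∫⁻ s in S, zInt (-1) a σ (forcing ν (U s)) < ∞ := by
  have hle : ∀ s, zInt (-1) a σ (forcing ν (U s)) ≤ ENNReal.ofReal ν * zInt 1 a σ (U s) +
      ∫⁻ ξ, wt (-1) a σ ξ * nlinMaj (U s) (U s) ξ := by
    intro s
    have hm : Measurable fun ξ => ENNReal.ofReal ν * (wt 1 a σ ξ * ‖U s ξ‖ₑ) :=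
      ((measurable_wt _ _ _).mul hU.of_uncurry_left.enorm).const_mul _
    rw [zInt, zInt, ← lintegral_const_mul' _ _ ENNReal.ofReal_ne_top, ← lintegral_add_left hm]
    refine lintegral_mono fun ξ => ?_
    have h1 : ‖forcing ν (U s) ξ‖ₑ ≤
        ENNReal.ofReal ν * (ENNReal.ofReal (‖ξ‖ ^ 2) * ‖U s ξ‖ₑ) + nlinMaj (U s) (U s) ξ := by
      refine (enorm_add_le _ _).trans (add_le_add (le_of_eq ?_) (enorm_nlin_le _ _ _))
      rw [enorm_neg, enorm_smul, Real.enorm_of_nonneg (by positivity), ENNReal.ofReal_mul hν,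
        mul_assoc]
    refine (mul_le_mul_right h1 _).trans_eq ?_
    rw [← wt_neg_one_mul_sq]
    ring
  refine (lintegral_mono hle).trans_lt ?_
  rw [lintegral_add_left ((measurable_zInt 1 a σ hU).const_mul _),
    lintegral_const_mul' _ _ ENNReal.ofReal_ne_top]
  refine ENNReal.add_lt_top.2 ⟨ENNReal.mul_lt_top ENNReal.ofReal_lt_top hi,
    (lintegral_nlinMaj_set_le ha hσ hU hS hb).trans_lt (ENNReal.mul_lt_top
      (ENNReal.mul_lt_top ENNReal.ofReal_lt_top (ENNReal.mul_lt_top (by simp) hM)) hi)⟩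

theorem lintegral_le_mul_wt (ha : 0 < a) (hσ : 1 < σ) :
    ∃ C : ℝ, 0 < C ∧ ∀ n : R3 → ℝ≥0∞, ∫⁻ ξ, n ξ ≤ ENNReal.ofReal C * ∫⁻ ξ, wt (-1) a σ ξ * n ξ := by
  obtain ⟨C, hC, h⟩ := exists_norm_pow_le_wt ha hσ 0
  refine ⟨C, hC, fun n => ?_⟩
  rw [← lintegral_const_mul' _ _ ENNReal.ofReal_ne_top]
  refine lintegral_mono_ae (ae_ne_zero.mono fun ξ hξ => ?_)
  have h1 := h ξ hξ
  rw [pow_zero, ENNReal.ofReal_one] at h1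
  calc n ξ = 1 * n ξ := (one_mul _).symm
    _ ≤ ENNReal.ofReal C * wt (-1) a σ ξ * n ξ := mul_le_mul_left h1 _
    _ = _ := mul_assoc _ _ _

theorem integrable_uncurry_of_zInt (ha : 0 < a) (hσ : 1 < σ) {F : ℝ → R3 → C3}
    (hF : Measurable (Function.uncurry F)) {S : Set ℝ}
    (h : ∫⁻ s in S, zInt (-1) a σ (F s) < ∞) :
    Integrable (Function.uncurry F) ((volume.restrict S).prod volume) := by
  obtain ⟨C, hC, hle⟩ := lintegral_le_mul_wt ha hσ
  refine ⟨hF.aestronglyMeasurable, ?_⟩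
  rw [HasFiniteIntegral, lintegral_prod _ hF.enorm.aemeasurable]
  refine (lintegral_mono fun s => hle fun ξ => ‖F s ξ‖ₑ).trans_lt ?_
  rw [lintegral_const_mul' _ _ ENNReal.ofReal_ne_top]
  exact ENNReal.mul_lt_top ENNReal.ofReal_lt_top h

/-- A family with integrable time derivative is continuous in time. -/
theorem tendsto_zInt_sub (ha : 0 < a) (hσ : 1 < σ) {F : ℝ → R3 → C3}
    (hF : Measurable (Function.uncurry F))
    (hi : ∀ T, ∫⁻ s in Ioc 0 T, zInt (-1) a σ (F s) < ∞)
    (h : ∀ t, 0 ≤ t → ∀ᵐ ξ, U t ξ = U 0 ξ + ∫ s in Ioc 0 t, F s ξ) {t : ℝ} (ht : 0 ≤ t) :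
    Tendsto (fun s => zInt (-1) a σ (U s - U t)) (𝓝[Ici 0] t) (𝓝 0) := by
  have hz := measurable_zInt (-1) a σ hF
  have key : ∀ r s, 0 ≤ r → r ≤ s →
      zInt (-1) a σ (U s - U r) ≤ ∫⁻ τ in Ioc r s, zInt (-1) a σ (F τ) := by
    intro r s hr hrs
    have hint := (integrable_uncurry_of_zInt ha hσ hF (hi s)).prod_left_ae
    have hpt : ∀ᵐ ξ, ‖(U s - U r) ξ‖ₑ ≤ ∫⁻ τ in Ioc r s, ‖F τ ξ‖ₑ := by
      filter_upwards [h r hr, h s (hr.trans hrs), hint] with ξ h1 h2 h3'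
      have h3 : IntegrableOn (fun τ => F τ ξ) (Ioc 0 s) := h3'
      have h4 : (U s - U r) ξ = ∫ τ in Ioc r s, F τ ξ := by
        rw [Pi.sub_apply, h1, h2, add_sub_add_left_eq_sub, ← Ioc_union_Ioc_eq_Ioc hr hrs,
          setIntegral_union (Ioc_disjoint_Ioc_of_le le_rfl) measurableSet_Ioc
          (h3.mono_set (Ioc_subset_Ioc_right hrs)) (h3.mono_set (Ioc_subset_Ioc_left hr)),
          add_sub_cancel_left]
      rw [h4]
      exact enorm_integral_le_lintegral_enorm _
    calc zInt (-1) a σ (U s - U r) ≤ ∫⁻ ξ, wt (-1) a σ ξ * ∫⁻ τ in Ioc r s, ‖F τ ξ‖ₑ :=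
          lintegral_mono_ae (hpt.mono fun ξ hξ => mul_le_mul_right hξ _)
      _ = _ := (lintegral_wt_swap (-1) a σ (n := fun τ ξ => ‖F τ ξ‖ₑ) hF.enorm (Ioc r s)).symm
  have hfin : ∫⁻ s, zInt (-1) a σ (F s) ∂(volume.restrict (Ioc 0 (t + 1))) ≠ ∞ := (hi (t + 1)).ne
  have hvol : Tendsto (fun s => (volume.restrict (Ioc 0 (t + 1))) (uIoc t s)) (𝓝[Ici 0] t) (𝓝 0) := by
    have h1 : Tendsto (fun s => ENNReal.ofReal |s - t|) (𝓝[Ici 0] t) (𝓝 0) := by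
      have : Tendsto (fun s => ENNReal.ofReal |s - t|) (𝓝 t) (𝓝 (ENNReal.ofReal |t - t|)) :=
        (ENNReal.continuous_ofReal.comp (by fun_prop : Continuous fun s : ℝ => |s - t|)).tendsto t
      rw [sub_self, abs_zero, ENNReal.ofReal_zero] at this
      exact this.mono_left nhdsWithin_le_nhds
    refine tendsto_of_tendsto_of_tendsto_of_le_of_le tendsto_const_nhds h1
      (fun _ => zero_le) fun s => ?_
    refine (Measure.restrict_apply_le _ _).trans ?_
    rw [Real.volume_uIoc]
  -- Absolute continuity of the integral: the increment is bounded by the integral over the interval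
  -- between t and s, whose length tends to 0.
  have h2 := tendsto_setLIntegral_zero hfin hvol
  refine tendsto_of_tendsto_of_tendsto_of_le_of_le' tendsto_const_nhds h2
    (Eventually.of_forall fun _ => zero_le) ?_
  have h3 : ∀ᶠ s in 𝓝[Ici 0] t, s < t + 1 :=
    nhdsWithin_le_nhds (Iio_mem_nhds (by linarith))
  filter_upwards [self_mem_nhdsWithin, h3] with s hs hs1
  have hs0 : 0 ≤ s := hs
  rcases le_total t s with hts | hts
  · refine (key t s ht hts).trans_eq ?_
    rw [uIoc_of_le hts, Measure.restrict_restrict measurableSet_Ioc,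
      inter_eq_left.2 (Ioc_subset_Ioc ht hs1.le)]
  · have h4 : U s - U t = -(U t - U s) := (neg_sub _ _).symm
    rw [h4, zInt_neg]
    refine (key s t hs0 hts).trans_eq ?_
    rw [uIoc_of_ge hts, Measure.restrict_restrict measurableSet_Ioc,
      inter_eq_left.2 (Ioc_subset_Ioc hs0 (by linarith))]

end Forcing

/-! ### The weak formulation on the Fourier side -/

theorem integral_norm_presHat_le {g : R3 → C3} (hgm : Measurable g) (hg : Integrable g) :
    ∫ ξ, ‖presHat g ξ‖ ≤ fourConst * ((∫ ξ, ‖g ξ‖) * ∫ ξ, ‖g ξ‖) := by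
  have h1 : ∫⁻ ξ, ‖presHat g ξ‖ₑ ≤
      ENNReal.ofReal fourConst * ((∫⁻ ξ, ‖g ξ‖ₑ) * ∫⁻ ξ, ‖g ξ‖ₑ) := by
    refine (lintegral_mono (enorm_presHat_le g)).trans_eq ?_
    rw [lintegral_const_mul' _ _ ENNReal.ofReal_ne_top, lintegral_absConv hgm hgm]
  have h2 : (∫⁻ ξ, ‖g ξ‖ₑ) ≠ ∞ := hg.2.ne
  rw [integral_norm_eq_lintegral_enorm (integrable_presHat hgm hg).1,
    integral_norm_eq_lintegral_enorm hg.1]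
  refine (ENNReal.toReal_mono (by finiteness) h1).trans_eq ?_
  rw [ENNReal.toReal_mul, ENNReal.toReal_mul, ENNReal.toReal_ofReal fourConst_pos.le]

/-- Fubini turns an identity at almost every time into one on space-time. Each term has to be
integrable separately, since they are split. -/
theorem integral_prod_combination {c : ℂ} {A B : Fin 3 → ℝ × R3 → ℂ} {C D : ℝ × R3 → ℂ}
    (hA : ∀ j, Integrable (A j)) (hB : ∀ j, Integrable (B j)) (hC : Integrable C)
    (hD : Integrable D)
    (h : ∀ᵐ t : ℝ, c * (∑ j, ∫ x, A j (t, x)) + (∑ j, ∫ x, B j (t, x)) + ∫ x, C (t, x) =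
      ∫ x, D (t, x)) :
    c * (∑ j, ∫ z, A j z) + (∑ j, ∫ z, B j z) + ∫ z, C z = ∫ z, D z := by
  rw [Measure.volume_eq_prod] at hA hB hC hD ⊢
  have i1 : Integrable fun t : ℝ => c * ∑ j, ∫ x, A j (t, x) :=
    (integrable_finsetSum _ fun j _ => (hA j).integral_prod_left).const_mul _
  have i2 : Integrable fun t : ℝ => ∑ j, ∫ x, B j (t, x) :=
    integrable_finsetSum _ fun j _ => (hB j).integral_prod_left
  rw [integral_prod _ hD, integral_prod _ hC]
  simp only [fun j => integral_prod _ (hA j), fun j => integral_prod _ (hB j)]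
  rw [← integral_finsetSum _ fun j _ => (hA j).integral_prod_left,
    ← integral_finsetSum _ fun j _ => (hB j).integral_prod_left, ← integral_const_mul,
    ← integral_add i1 i2, ← integral_add (i1.fun_add i2) hC.integral_prod_left]
  exact integral_congr_ae h

theorem integrableOn_of_bdd {f : ℝ → ℝ} (hf : Measurable f) (h0 : ∀ t, 0 ≤ f t) {T : ℝ}
    (hB : ∃ B, ∀ t ∈ Ioc 0 T, f t ≤ B) : IntegrableOn f (Ioc 0 T) := by
  obtain ⟨B, hB⟩ := hB
  refine Measure.integrableOn_of_bounded (M := B) (by simp) hf.aestronglyMeasurable ?_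
  filter_upwards [ae_restrict_mem measurableSet_Ioc] with t ht
  rw [Real.norm_of_nonneg (h0 t)]
  exact hB t ht

theorem measurable_integral_norm {U : ℝ → R3 → C3} (hU : Measurable (Function.uncurry U)) :
    Measurable fun t => ∫ ξ, ‖U t ξ‖ :=
  (hU.norm.stronglyMeasurable.integral_prod_right').measurable

theorem integrableOn_integral_norm {U : ℝ → R3 → C3} (hU : Measurable (Function.uncurry U))
    (hB : ∀ T, ∃ B, ∀ t ∈ Ioc 0 T, ∫ ξ, ‖U t ξ‖ ≤ B) (T : ℝ) :
    IntegrableOn (fun t => ∫ ξ, ‖U t ξ‖) (Ioc 0 T) :=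
  integrableOn_of_bdd (measurable_integral_norm hU)
    (fun _ => integral_nonneg fun _ => norm_nonneg _) (hB T)

theorem integrableOn_integral_norm_mul {U : ℝ → R3 → C3} (hU : Measurable (Function.uncurry U))
    (hB : ∀ T, ∃ B, ∀ t ∈ Ioc 0 T, ∫ ξ, ‖U t ξ‖ ≤ B) (T : ℝ) :
    IntegrableOn (fun t => (∫ ξ, ‖U t ξ‖) * ∫ ξ, ‖U t ξ‖) (Ioc 0 T) := by
  have h0 : ∀ t, 0 ≤ ∫ ξ, ‖U t ξ‖ := fun t => integral_nonneg fun _ => norm_nonneg _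
  refine integrableOn_of_bdd ((measurable_integral_norm hU).mul (measurable_integral_norm hU))
    (fun t => mul_nonneg (h0 t) (h0 t)) ?_
  obtain ⟨B, hB⟩ := hB T
  exact ⟨B * B, fun t ht => mul_le_mul (hB t ht) (hB t ht) (h0 t) ((h0 t).trans (hB t ht))⟩

/-- The spatial part of the weak formulation of the Navier-Stokes equations. -/
theorem spatial_weak_form_integral {ν : ℝ} {U : ℝ → R3 → C3} (hU : Measurable (Function.uncurry U))
    (hUi : ∀ t, Integrable (U t)) (hB : ∀ T, ∃ B, ∀ t ∈ Ioc 0 T, ∫ ξ, ‖U t ξ‖ ≤ B)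
    (hU1 : ∀ t, Integrable fun ξ => ‖ξ‖ • U t ξ) (hU2 : ∀ t, Integrable fun ξ => ‖ξ‖ ^ 2 • U t ξ)
    (hN : ∀ᵐ t ∂(volume.restrict (Ioi 0)), ∫⁻ ξ, nlinMaj (U t) (U t) ξ < ∞)
    (hF : ∀ T, Integrable (Function.uncurry fun t => forcing ν (U t))
      ((volume.restrict (Ioc 0 T)).prod volume))
    (φ : 𝓓(spaceTime, ℝ)) (i : Fin 3) :
    ν * (∑ j : Fin 3, ∫ z : ℝ × R3,
        ((∂_{spaceDir j} (∂_{spaceDir j} φ) : 𝓓(spaceTime, ℝ)) z : ℂ) * synth (U z.1) z.2 i) +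
      (∑ j : Fin 3, ∫ z : ℝ × R3, ((∂_{spaceDir j} φ : 𝓓(spaceTime, ℝ)) z : ℂ) *
        (synth (U z.1) z.2 j * synth (U z.1) z.2 i)) +
      (∫ z : ℝ × R3, ((∂_{spaceDir i} φ : 𝓓(spaceTime, ℝ)) z : ℂ) *
        synth (presHat (U z.1)) z.2) =
      ∫ z : ℝ × R3, (φ z : ℂ) * synth (fun ξ => forcing ν (U z.1) ξ i) z.2 := by
  have hFm0 := measurable_forcing ν hU
  obtain ⟨F, hF0⟩ : ∃ F : ℝ → R3 → C3, ∀ t, forcing ν (U t) = F t := ⟨_, fun _ => rfl⟩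
  simp only [hF0] at hF hFm0 ⊢
  have hUci : ∀ j, Measurable (Function.uncurry fun t ξ => U t ξ j) := fun j =>
    (by fun_prop : Measurable fun v : C3 => v j).comp hU
  have hVm : ∀ j, Measurable fun z : ℝ × R3 => synth (U z.1) z.2 j := fun j => by
    have : (fun z : ℝ × R3 => synth (U z.1) z.2 j) = fun z : ℝ × R3 =>
        synth (fun ξ => U z.1 ξ j) z.2 := funext fun z => synth_coord (hUi z.1) z.2 j
    rw [this]
    exact measurable_synth (hUci j)
  have hVb : ∀ j (z : ℝ × R3), ‖synth (U z.1) z.2 j‖ ≤ fourConst * ∫ ξ, ‖U z.1 ξ‖ :=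
    fun j z => (norm_coord_le _ j).trans (norm_synth_le _)
  have hPb : ∀ z : ℝ × R3, ‖synth (presHat (U z.1)) z.2‖ ≤
      fourConst * (fourConst * ((∫ ξ, ‖U z.1 ξ‖) * ∫ ξ, ‖U z.1 ξ‖)) :=
    fun z => (norm_synth_le _).trans (mul_le_mul_of_nonneg_left
      (integral_norm_presHat_le hU.of_uncurry_left (hUi z.1)) fourConst_pos.le)
  have hb1 := integrableOn_integral_norm hU hB
  have hb2 := integrableOn_integral_norm_mul hU hB
  have iA : ∀ ψ : 𝓓(spaceTime, ℝ), Integrable fun z : ℝ × R3 =>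
      (ψ z : ℂ) * synth (U z.1) z.2 i := fun ψ =>
    integrable_test_mul ψ (hVm i) (fun T => (hb1 T).const_mul fourConst) (hVb i)
  have iB : ∀ (ψ : 𝓓(spaceTime, ℝ)) j, Integrable fun z : ℝ × R3 =>
      (ψ z : ℂ) * (synth (U z.1) z.2 j * synth (U z.1) z.2 i) := fun ψ j =>
    integrable_test_mul ψ ((hVm j).mul (hVm i))
      (fun T => (hb2 T).const_mul (fourConst * fourConst)) fun z => by
        rw [norm_mul, mul_mul_mul_comm]
        exact mul_le_mul (hVb j z) (hVb i z) (norm_nonneg _) ((norm_nonneg _).trans (hVb j z))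
  have iC : ∀ ψ : 𝓓(spaceTime, ℝ), Integrable fun z : ℝ × R3 =>
      (ψ z : ℂ) * synth (presHat (U z.1)) z.2 := fun ψ =>
    integrable_test_mul ψ (measurable_synth (measurable_presHat hU))
      (fun T => ((hb2 T).const_mul fourConst).const_mul fourConst) hPb
  have hFm : Measurable (Function.uncurry fun t ξ => F t ξ i) :=
    (by fun_prop : Measurable fun v : C3 => v i).comp hFm0
  have hFi : ∀ T, Integrable (Function.uncurry fun t ξ => F t ξ i)
      ((volume.restrict (Ioc 0 T)).prod volume) := fun T => integrable_coord (hF T) i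
  have iF : Integrable fun z : ℝ × R3 => (φ z : ℂ) * synth (fun ξ => F z.1 ξ i) z.2 :=
    integrable_test_mul φ (measurable_synth hFm)
      (fun T => ((hFi T).norm.integral_prod_left).const_mul fourConst) fun z => norm_synth_le _
  refine integral_prod_combination (fun j => iA _) (fun j => iB _ j) (iC _) iF ?_
  have hN' := (ae_restrict_iff' measurableSet_Ioi).1 hN
  refine hN'.mono fun t ht => ?_
  have hs := fun hn => spatial_weak_form ν (g := U t) hU.of_uncurry_left (hUi t) (hU1 t) (hU2 t)
    hn (slice φ t) i
  simp only [lineDeriv_slice, slice_apply, hF0] at hs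
  -- For t ≤ 0 every test function on the domain vanishes, so no information on U is needed there.
  rcases le_or_gt t 0 with h0 | h0
  · simp [test_eq_zero _ h0]
  · exact hs (ht h0)

/-- Integration by parts in time in the weak formulation. -/
theorem time_weak_form {u F : ℝ → R3 → C3} (hu : Measurable (Function.uncurry u))
    (hFm : Measurable (Function.uncurry F)) (hui : ∀ t, Integrable (u t))
    (hb : ∀ T, IntegrableOn (fun t => ∫ ξ, ‖u t ξ‖) (Ioc 0 T))
    (hF : ∀ T, Integrable (Function.uncurry F) ((volume.restrict (Ioc 0 T)).prod volume))
    (h : ∀ t, 0 ≤ t → ∀ᵐ ξ, u t ξ = u 0 ξ + ∫ s in Ioc 0 t, F s ξ)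
    (φ : 𝓓(spaceTime, ℝ)) (i : Fin 3) :
    ∫ z : ℝ × R3, ((∂_{timeDir} φ : 𝓓(spaceTime, ℝ)) z : ℂ) * synth (u z.1) z.2 i =
      -∫ z : ℝ × R3, (φ z : ℂ) * synth (fun ξ => F z.1 ξ i) z.2 := by
  have huc : Measurable (Function.uncurry fun t ξ => u t ξ i) :=
    (by fun_prop : Measurable fun v : C3 => v i).comp hu
  have hFc : Measurable (Function.uncurry fun t ξ => F t ξ i) :=
    (by fun_prop : Measurable fun v : C3 => v i).comp hFm
  have hFi : ∀ T, Integrable (Function.uncurry fun t ξ => F t ξ i)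
      ((volume.restrict (Ioc 0 T)).prod volume) := fun T => integrable_coord (hF T) i
  have h1 : ∀ T, IntegrableOn (fun t => ∫ ξ, ‖u t ξ i‖) (Ioc 0 T) := fun T => by
    refine (hb T).mono' ?_ (Eventually.of_forall fun t => ?_)
    · exact (huc.norm.stronglyMeasurable.integral_prod_right').aestronglyMeasurable
    · rw [Real.norm_of_nonneg (integral_nonneg fun _ => norm_nonneg _)]
      exact integral_mono (integrable_coord (hui t) i).norm (hui t).norm
        fun ξ => norm_coord_le _ i
  have h2 : ∀ t, 0 ≤ t → ∀ᵐ ξ, u t ξ i = u 0 ξ i + ∫ s in Ioc 0 t, F s ξ i := fun t ht => by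
    filter_upwards [h t ht, (hF t).prod_left_ae] with ξ h1 h2
    rw [h1, PiLp.add_apply]
    exact congrArg _ (integral_coord h2 i)
  have h3 := integral_timeDeriv_mul_synth φ (u := fun t ξ => u t ξ i) (f := fun t ξ => F t ξ i)
    huc hFc h1 (integrable_coord (hui 0) i) hFi h2
  rw [← h3]
  refine integral_congr_ae (Eventually.of_forall fun z => ?_)
  exact congrArg _ (synth_coord (hui z.1) z.2 i)

theorem weak_form_of_integral_eq {ν : ℝ} {U : ℝ → R3 → C3} (hU : Measurable (Function.uncurry U))
    (hUi : ∀ t, Integrable (U t)) (hB : ∀ T, ∃ B, ∀ t ∈ Ioc 0 T, ∫ ξ, ‖U t ξ‖ ≤ B)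
    (hU1 : ∀ t, Integrable fun ξ => ‖ξ‖ • U t ξ) (hU2 : ∀ t, Integrable fun ξ => ‖ξ‖ ^ 2 • U t ξ)
    (hN : ∀ᵐ t ∂(volume.restrict (Ioi 0)), ∫⁻ ξ, nlinMaj (U t) (U t) ξ < ∞)
    (hF : ∀ T, Integrable (Function.uncurry fun t => forcing ν (U t))
      ((volume.restrict (Ioc 0 T)).prod volume))
    (h : ∀ t, 0 ≤ t → ∀ᵐ ξ, U t ξ = U 0 ξ + ∫ s in Ioc 0 t, forcing ν (U s) ξ)
    (φ : 𝓓(spaceTime, ℝ)) (i : Fin 3) :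
    (∫ z : ℝ × R3, ((∂_{timeDir} φ : 𝓓(spaceTime, ℝ)) z : ℂ) * synth (U z.1) z.2 i) +
      ν * (∑ j : Fin 3, ∫ z : ℝ × R3,
        ((∂_{spaceDir j} (∂_{spaceDir j} φ) : 𝓓(spaceTime, ℝ)) z : ℂ) * synth (U z.1) z.2 i) +
      (∑ j : Fin 3, ∫ z : ℝ × R3, ((∂_{spaceDir j} φ : 𝓓(spaceTime, ℝ)) z : ℂ) *
        (synth (U z.1) z.2 j * synth (U z.1) z.2 i)) +
      (∫ z : ℝ × R3, ((∂_{spaceDir i} φ : 𝓓(spaceTime, ℝ)) z : ℂ) *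
        synth (presHat (U z.1)) z.2) = 0 := by
  have h1 := time_weak_form hU (measurable_forcing ν hU) hUi (integrableOn_integral_norm hU hB) hF h
    φ i
  have h2 := spatial_weak_form_integral hU hUi hB hU1 hU2 hN hF φ i
  rw [h1]
  linear_combination h2

/-! ### Existence -/

theorem picardMap_zero (ν : ℝ) (g : R3 → C3) (U : ℝ → R3 → C3) (ξ : R3) :
    picardMap ν g U 0 ξ = g ξ := duh_zero _ _ _

/-- Mild solutions are absolutely continuous in time at almost every frequency. -/
theorem eq_add_integral_forcing {ν a σ : ℝ} (hν : 0 < ν) (ha : 0 < a) (hσ : 1 < σ) {g : R3 → C3}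
    {U : ℝ → R3 → C3} (hUm : Measurable (Function.uncurry U)) {M : ℝ≥0∞} (hM : M < ∞)
    (hU : SizeLE ν a σ U M) (hmild : ∀ t, 0 ≤ t → ∀ ξ, U t ξ = picardMap ν g U t ξ)
    {t : ℝ} (ht : 0 ≤ t) :
    ∀ᵐ ξ, U t ξ = U 0 ξ + ∫ s in Ioc 0 t, forcing ν (U s) ξ := by
  filter_upwards [ae_integrableOn_nlin hν ha hσ hUm hM hU] with ξ hξ
  have h := duh_eq_add_integral (l := ν * ‖ξ‖ ^ 2) ht (hξ.mono_set Ioc_subset_Ioi_self) (g ξ)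
  have h0 : U 0 ξ = g ξ := by rw [hmild 0 le_rfl, picardMap_zero]
  rw [h0]
  refine (hmild t ht ξ).trans (h.trans (congrArg _ ?_))
  refine setIntegral_congr_fun measurableSet_Ioc fun s hs => ?_
  have hs' : duh (ν * ‖ξ‖ ^ 2) (g ξ) (fun s => nlin (U s) (U s) ξ) s = U s ξ :=
    (hmild s hs.1.le ξ).symm
  rw [hs', forcing]

/-- The velocity field with Fourier transform `U t`. -/
noncomputable def velocity (U : ℝ → R3 → C3) (t : ℝ) (x : R3) : R3 :=
  WithLp.toLp 2 fun i => (synth (U t) x i).re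

/-- The conjugation symmetry makes the synthesis real, so nothing is lost by taking real parts. -/
theorem toC3_velocity {U : ℝ → R3 → C3} {t : ℝ} (hi : Integrable (U t))
    (hconj : ∀ ξ, U t (-ξ) = conjC3 (U t ξ)) (x : R3) : toC3 (velocity U t x) = synth (U t) x := by
  ext i
  rw [toC3_apply]
  refine Complex.ext rfl ?_
  rw [Complex.ofReal_im, synth_coord hi]
  exact (im_synth_eq_zero (Eventually.of_forall fun ξ => by rw [hconj, conjC3_apply]) x).symm

theorem locallyIntegrableOn_of_bdd {f : ℝ × R3 → ℝ} (hf : Measurable f) {C : ℝ}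
    (hC : ∀ z, ‖f z‖ ≤ C) : LocallyIntegrableOn f spaceTime := by
  refine LocallyIntegrable.locallyIntegrableOn ?_ _
  refine (locallyIntegrable_const C).mono hf.aestronglyMeasurable (Eventually.of_forall fun z => ?_)
  exact (hC z).trans (le_abs_self C)

/-- The velocity and the pressure are bounded functions, because their transforms are integrable
uniformly in time. All terms are therefore honest integrals, and the complex weak form is the real
one after coercion. -/
theorem solvesMomentum_of_integral_eq {ν : ℝ} {U : ℝ → R3 → C3}
    (hU : Measurable (Function.uncurry U))
    (hUi : ∀ t, Integrable (U t)) {B : ℝ} (hB : ∀ t, ∫ ξ, ‖U t ξ‖ ≤ B)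
    (hU1 : ∀ t, Integrable fun ξ => ‖ξ‖ • U t ξ) (hU2 : ∀ t, Integrable fun ξ => ‖ξ‖ ^ 2 • U t ξ)
    (hN : ∀ᵐ t ∂(volume.restrict (Ioi 0)), ∫⁻ ξ, nlinMaj (U t) (U t) ξ < ∞)
    (hF : ∀ T, Integrable (Function.uncurry fun t => forcing ν (U t))
      ((volume.restrict (Ioc 0 T)).prod volume))
    (h : ∀ t, 0 ≤ t → ∀ᵐ ξ, U t ξ = U 0 ξ + ∫ s in Ioc 0 t, forcing ν (U s) ξ)
    (hconj : ∀ t ξ, U t (-ξ) = conjC3 (U t ξ)) :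
    SolvesMomentum ν (velocity U)
      (regularDist fun z => (synth (presHat (U z.1)) z.2).re) := by
  have hB0 : 0 ≤ B := (integral_nonneg fun _ => norm_nonneg _).trans (hB 0)
  have hcB : 0 ≤ fourConst * B := mul_nonneg fourConst_pos.le hB0
  have hv : ∀ (z : ℝ × R3) i, ((velocity U z.1 z.2 i : ℝ) : ℂ) = synth (U z.1) z.2 i :=
    fun z i => by rw [← toC3_apply, toC3_velocity (hUi _) (hconj _)]
  have hp : ∀ z : ℝ × R3, (((synth (presHat (U z.1)) z.2).re : ℝ) : ℂ) =
      synth (presHat (U z.1)) z.2 := fun z => by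
    refine Complex.ext rfl ?_
    rw [Complex.ofReal_im]
    exact (im_synth_eq_zero (Eventually.of_forall fun ξ => presHat_neg_conj (hconj _) ξ) _).symm
  have hvm : ∀ i, Measurable fun z : ℝ × R3 => velocity U z.1 z.2 i := fun i => by
    have h0 : Measurable (Function.uncurry fun t ξ => U t ξ i) :=
      (by fun_prop : Measurable fun v : C3 => v i).comp hU
    have h1 : (fun z : ℝ × R3 => velocity U z.1 z.2 i) = fun z : ℝ × R3 =>
        (synth (fun ξ => U z.1 ξ i) z.2).re :=
      funext fun z => congrArg Complex.re (synth_coord (hUi z.1) z.2 i)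
    rw [h1]
    exact Complex.measurable_re.comp (measurable_synth h0)
  have hvb : ∀ i (z : ℝ × R3), ‖velocity U z.1 z.2 i‖ ≤ fourConst * B := fun i z =>
    (Complex.abs_re_le_norm _).trans ((norm_coord_le _ i).trans ((norm_synth_le _).trans
      (mul_le_mul_of_nonneg_left (hB _) fourConst_pos.le)))
  have h1 : ∀ i, LocallyIntegrableOn (fun z : ℝ × R3 => velocity U z.1 z.2 i) spaceTime :=
    fun i => locallyIntegrableOn_of_bdd (hvm i) (hvb i)
  have h2 : ∀ i j, LocallyIntegrableOn
      (fun z : ℝ × R3 => velocity U z.1 z.2 j * velocity U z.1 z.2 i) spaceTime :=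
    fun i j => locallyIntegrableOn_of_bdd ((hvm j).mul (hvm i))
      (C := (fourConst * B) * (fourConst * B)) fun z => by
        rw [norm_mul]
        exact mul_le_mul (hvb j z) (hvb i z) (norm_nonneg _) hcB
  have h3 : LocallyIntegrableOn (fun z : ℝ × R3 => (synth (presHat (U z.1)) z.2).re) spaceTime := by
    refine locallyIntegrableOn_of_bdd (C := fourConst * (fourConst * (B * B)))
      (Complex.measurable_re.comp (measurable_synth (measurable_presHat hU))) fun z => ?_
    exact (Complex.abs_re_le_norm _).trans ((norm_synth_le _).trans (mul_le_mul_of_nonneg_left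
      ((integral_norm_presHat_le hU.of_uncurry_left (hUi z.1)).trans
        (mul_le_mul_of_nonneg_left (mul_le_mul (hB _) (hB _)
          (integral_nonneg fun _ => norm_nonneg _) hB0) fourConst_pos.le)) fourConst_pos.le))
  refine ⟨h1, h2, fun i => (momentum_iff h1 h2 i).2 fun φ => ?_⟩
  obtain ⟨q, hq⟩ : ∃ q : ℝ × R3 → ℝ, ∀ z, (synth (presHat (U z.1)) z.2).re = q z :=
    ⟨_, fun _ => rfl⟩
  rw [regularDist_apply h3]
  simp only [hq] at hp ⊢
  have key := weak_form_of_integral_eq hU hUi (fun _ => ⟨B, fun t _ => hB t⟩) hU1 hU2 hN hF h φ i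
  simp only [← hv, ← hp] at key
  have hcast : ∀ f : ℝ × R3 → ℝ, ∫ z, (f z : ℂ) = ((∫ z, f z : ℝ) : ℂ) := fun f => integral_ofReal
  simp only [← Complex.ofReal_mul, hcast] at key
  exact_mod_cast key

/-- The Fourier-side fixed point is carried back to distributions. Every norm becomes a weighted
integral of its transform, so the estimates transfer without loss. -/
theorem exists_solution {ν a σ : ℝ} (hν : 0 < ν) (ha : 0 < a) (hσ : 1 < σ) {u₀ : 𝓢'(R3, C3)}
    (hreal : IsRealDist u₀) (hdiv : IsDivFree u₀) (hmem : MemZ (-1) a σ u₀)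
    (hsmall : zNorm (-1) a σ u₀ < ENNReal.ofReal ν) :
    ∃ u : ℝ → 𝓢'(R3, C3), MemCZ (-1) a σ u ∧ MemL1Z 1 a σ u ∧ IsNSESolution ν u₀ u ∧
      ∀ t, 0 ≤ t → zNorm (-1) a σ (u t) + (ENNReal.ofReal ν - zNorm (-1) a σ u₀) / 2
        * ∫⁻ τ in Icc 0 t, zNorm (-1) a σ (Δ (u τ)) ≤ zNorm (-1) a σ u₀ := by
  obtain ⟨g, hgm, hrep, hconj, hleray⟩ := exists_symm_rep ha hσ hreal hdiv hmem
  have hz0 := zNorm_eq_zInt hrep (-1) a σ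
  rw [hz0] at hsmall
  obtain ⟨V, hVm, hVs, hVmild, hVconj, hVleray⟩ :=
    exists_mild_solution hν ha hσ hgm hsmall.le hconj hleray
  have hm : zInt (-1) a σ g < ∞ := hsmall.trans ENNReal.ofReal_lt_top
  have hM : 2 * zInt (-1) a σ g < ∞ := ENNReal.mul_lt_top (by simp) hm
  have hVeq := fun t (ht : 0 ≤ t) => eq_add_integral_forcing hν ha hσ hVm hM hVs hVmild ht
  have henergy := fun t (ht : 0 ≤ t) =>
    mild_energy hν ha hσ hgm hsmall.le hVm hVs hVmild (t := t) ht
  have hV0 : V 0 = g := funext fun ξ => by rw [hVmild 0 le_rfl, picardMap_zero]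
  -- Freezing the solution at its initial value for negative times makes bounds and integrability
  -- valid for all t.
  obtain ⟨U, hUV⟩ : ∃ U : ℝ → R3 → C3, ∀ t, U t = V (max t 0) := ⟨_, fun _ => rfl⟩
  have hpos : ∀ t, 0 ≤ t → V t = U t := fun t ht => by rw [hUV, max_eq_left ht]
  have hUm : Measurable (Function.uncurry U) := by
    have h1 : Measurable fun q : ℝ × R3 => (max q.1 0, q.2) := by fun_prop
    have h2 := hVm.comp h1
    convert! h2 using 1
    exact funext fun q => congrFun (hUV q.1) q.2
  have hUs : ∀ t, zInt (-1) a σ (U t) ≤ 2 * zInt (-1) a σ g := fun t => by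
    rw [hUV]
    exact hVs.sup _ (le_max_right _ _)
  have hUint : ∫⁻ t in Ioi 0, zInt 1 a σ (U t) < ∞ := by
    have h1 : ∫⁻ t in Ioi 0, zInt 1 a σ (U t) = ∫⁻ t in Ioi 0, zInt 1 a σ (V t) :=
      setLIntegral_congr_fun measurableSet_Ioi fun t (ht : 0 < t) => by
        simp only [hpos t ht.le]
    rw [h1]
    exact (hVs.int_le hν).trans_lt (ENNReal.mul_lt_top
      (ENNReal.inv_lt_top.2 (by simpa using hν)) hM)
  have hUeq : ∀ t, 0 ≤ t → ∀ᵐ ξ, U t ξ = U 0 ξ + ∫ s in Ioc 0 t, forcing ν (U s) ξ := by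
    intro t ht
    filter_upwards [hVeq t ht] with ξ hξ
    rw [← hpos t ht, ← hpos 0 le_rfl, hξ]
    congr 1
    exact setIntegral_congr_fun measurableSet_Ioc fun s hs => by simp only [hpos s hs.1.le]
  have hUconj : ∀ t ξ, U t (-ξ) = conjC3 (U t ξ) := fun t ξ => by rw [hUV, hVconj]
  have hUleray : ∀ t ξ, leray ξ (U t ξ) = U t ξ := fun t ξ => by rw [hUV, hVleray]
  have hzfin := fun t => (hUs t).trans_lt hM
  have hUt : ∀ t, AEStronglyMeasurable (U t) := fun t => hUm.of_uncurry_left.aestronglyMeasurable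
  have hUi := fun t => integrable_of_zInt ha hσ (hUt t) (hzfin t)
  have hU1 : ∀ t, Integrable fun ξ => ‖ξ‖ • U t ξ := fun t => by
    simpa using integrable_norm_smul ha hσ 1 (hUt t) (hzfin t)
  have hU2 := fun t => integrable_norm_smul ha hσ 2 (hUt t) (hzfin t)
  have hFz : ∀ T, ∫⁻ s in Ioc 0 T, zInt (-1) a σ (forcing ν (U s)) < ∞ := fun T =>
    setLIntegral_zInt_forcing_lt_top hν.le ha hσ hUm measurableSet_Ioc hM (fun t _ => hUs t)
      ((lintegral_mono_set Ioc_subset_Ioi_self).trans_lt hUint)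
  have hFm := measurable_forcing ν hUm
  have hF := fun T => integrable_uncurry_of_zInt ha hσ hFm (hFz T)
  have hN : ∀ᵐ t ∂(volume.restrict (Ioi 0)), ∫⁻ ξ, nlinMaj (U t) (U t) ξ < ∞ := by
    obtain ⟨C, hC, hle⟩ := lintegral_le_mul_wt ha hσ
    have h1 := lintegral_nlinMaj_set_le ha hσ hUm (S := Ioi 0) measurableSet_Ioi
      fun t _ => hUs t
    have h2 := h1.trans_lt (ENNReal.mul_lt_top
      (ENNReal.mul_lt_top ENNReal.ofReal_lt_top (ENNReal.mul_lt_top (by simp) hM)) hUint)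
    have hm1 : Measurable fun s => ∫⁻ ξ, wt (-1) a σ ξ * nlinMaj (U s) (U s) ξ :=
      (((measurable_wt (-1) a σ).comp measurable_snd).mul
        (measurable_nlinMaj hUm hUm)).lintegral_prod_right'
    filter_upwards [ae_lt_top hm1 h2.ne] with t ht
    exact (hle _).trans_lt (ENNReal.mul_lt_top ENNReal.ofReal_lt_top ht)
  obtain ⟨C, hC, hCle⟩ := lintegral_enorm_le_zInt ha hσ
  have hB : ∀ t, ∫ ξ, ‖U t ξ‖ ≤ (ENNReal.ofReal C * (2 * zInt (-1) a σ g)).toReal := fun t => by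
    rw [integral_norm_eq_lintegral_enorm (hUt t)]
    exact ENNReal.toReal_mono (ENNReal.mul_lt_top ENNReal.ofReal_lt_top hM).ne
      ((hCle _).trans (mul_le_mul_right (hUs t) _))
  have hex := fun t => exists_fourierDist_rep (hUi t)
  choose u hu using hex
  have hzN := fun t ρ => zNorm_eq_zInt (hu t) ρ a σ
  have hzsub : ∀ t f h ρ, IsRepresentedBy (fourierDist f) h →
      zNorm ρ a σ (u t - f) = zInt ρ a σ (U t - h) := fun t f h ρ hf => by
    refine zNorm_eq_zInt ?_ ρ a σ
    rw [fourierDist_sub]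
    exact (hu t).sub hf
  refine ⟨u, ⟨fun t _ => ?_, fun t ht => ?_⟩, ⟨?_, fun f hf => ?_, ?_⟩, ⟨?_, fun t _ => ?_, ?_⟩,
    fun t ht => ?_⟩
  · rw [MemZ, hzN]
    exact hzfin t
  · simp only [fun s => hzsub s (u t) (U t) (-1) (hu t)]
    exact tendsto_zInt_sub ha hσ hFm hFz hUeq ht
  · rw [Measure.restrict_congr_set (Ioi_ae_eq_Ici (a := (0 : ℝ))).symm]
    filter_upwards [ae_lt_top (measurable_zInt 1 a σ hUm) hUint.ne] with t ht
    rw [MemZ, hzN]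
    exact ht
  · obtain ⟨h, hhm, hh⟩ := hf.exists_rep
    simp only [fun s => hzsub s f h 1 hh]
    have : Measurable (Function.uncurry fun t => U t - h) := hUm.sub (hhm.comp measurable_snd)
    exact (measurable_zInt 1 a σ this).aemeasurable
  · rw [Measure.restrict_congr_set (Ioi_ae_eq_Ici (a := (0 : ℝ))).symm]
    simp only [hzN]
    exact hUint
  · refine eq_of_fourierDist_rep (hu 0) hrep (Eventually.of_forall fun ξ => ?_)
    rw [← hpos 0 le_rfl, hV0]
  · exact isDivFree_of_rep (hUi t) (hU1 t) (hu t)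
      (Eventually.of_forall fun ξ => (leray_eq_self_iff ξ _).1 (hUleray t ξ))
  · refine ⟨velocity U, _, fun t _ => ?_, solvesMomentum_of_integral_eq hUm hUi hB hU1 hU2 hN hF
      hUeq hUconj⟩
    simp only [toC3_velocity (hUi _) (hUconj _)]
    exact isRepresentedBy_synth (hUi t) (hu t)
  · have hΔ : ∀ τ, zNorm (-1) a σ (Δ (u τ)) = zInt 1 a σ (U τ) := fun τ => by
      rw [zNorm_eq_zInt (fourierDist_laplacian_rep (hUi τ) (hU1 τ) (hU2 τ) (hu τ))]
      refine lintegral_congr fun ξ => ?_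
      rw [enorm_neg, enorm_smul, Real.enorm_of_nonneg (by positivity), ← mul_assoc,
        wt_neg_one_mul_sq]
    rw [hzN, hz0]
    simp only [hΔ]
    -- The interval [0, t] of the statement and (0, t] of the estimates differ by a null set.
    rw [Measure.restrict_congr_set (Ioc_ae_eq_Icc (a := (0 : ℝ)) (b := t)).symm]
    refine le_trans (le_of_eq ?_) (henergy t ht)
    rw [hpos t ht]
    congr 2
    exact setLIntegral_congr_fun measurableSet_Ioc fun s hs => by simp only [hpos s hs.1.le]

/-! ### Measurable versions of continuous curves -/

/-- Summable weighted L¹ distances force the pointwise distances to be summable almost everywhere,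
hence to tend to 0. -/
theorem tendsto_of_tsum_zInt {ρ a σ : ℝ} {f : ℕ → R3 → C3} {g : R3 → C3}
    (hf : ∀ n, Measurable (f n)) (hg : Measurable g)
    (h : ∑' n, zInt ρ a σ (f n - g) ≠ ∞) :
    ∀ᵐ ξ, Tendsto (fun n => f n ξ) atTop (𝓝 (g ξ)) := by
  have h1 : ∫⁻ ξ, wt ρ a σ ξ * ∑' n, ‖(f n - g) ξ‖ₑ ≠ ∞ := by
    rwa [zInt_tsum_le fun n => (hf n).sub hg]
  have hm : Measurable fun ξ => wt ρ a σ ξ * ∑' n, ‖(f n - g) ξ‖ₑ :=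
    (measurable_wt _ _ _).mul (Measurable.tsum fun n => ((hf n).sub hg).enorm)
  filter_upwards [ae_lt_top hm h1, ae_ne_zero] with ξ h2 h0
  have h3 : ∑' n, ‖(f n - g) ξ‖ₑ ≠ ∞ :=
    (ENNReal.lt_top_of_mul_ne_top_right h2.ne (wt_ne_zero _ _ _ h0)).ne
  have h4 := ENNReal.tendsto_atTop_zero_of_tsum_ne_top h3
  rw [tendsto_iff_edist_tendsto_0]
  refine h4.congr fun n => ?_
  rw [edist_eq_enorm_sub, Pi.sub_apply]

theorem zInt_sub_comm (ρ a σ : ℝ) (f g : R3 → C3) :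
    zInt ρ a σ (f - g) = zInt ρ a σ (g - f) := by
  rw [← zInt_neg, neg_sub]

theorem zInt_sub_le {ρ a σ : ℝ} {f g h : R3 → C3} (hf : Measurable f) (hg : Measurable g) :
    zInt ρ a σ (f - h) ≤ zInt ρ a σ (f - g) + zInt ρ a σ (g - h) := by
  rw [← sub_add_sub_cancel f g h]
  exact zInt_add_le (hf.sub hg).aestronglyMeasurable

theorem isOpen_zInt_sub_lt {ρ a σ : ℝ} {u : ℝ → R3 → C3} (hu : ∀ t, Measurable (u t))
    (hc : ∀ t, Tendsto (fun s => zInt ρ a σ (u s - u t)) (𝓝 t) (𝓝 0)) (q : ℝ) (ε : ℝ≥0∞) :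
    IsOpen {t | zInt ρ a σ (u q - u t) < ε} := by
  rw [isOpen_iff_mem_nhds]
  intro t ht
  have ht' : zInt ρ a σ (u q - u t) < ε := ht
  have hpos : 0 < ε - zInt ρ a σ (u q - u t) := tsub_pos_of_lt ht'
  filter_upwards [(hc t).eventually (Iio_mem_nhds hpos)] with s hs
  have hs' : zInt ρ a σ (u s - u t) < ε - zInt ρ a σ (u q - u t) := hs
  have h1 : zInt ρ a σ (u q - u s) ≤ zInt ρ a σ (u q - u t) + zInt ρ a σ (u s - u t) := by
    rw [zInt_sub_comm ρ a σ (u s)]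
    exact zInt_sub_le (hu q) (hu t)
  have h2 := lt_tsub_iff_left.1 hs'
  exact h1.trans_lt h2

/-- A curve which is continuous for the `Z`-distance has a jointly measurable version. -/
theorem exists_measurable_version {ρ a σ : ℝ} {u : ℝ → R3 → C3} (hu : ∀ t, Measurable (u t))
    (hc : ∀ t, Tendsto (fun s => zInt ρ a σ (u s - u t)) (𝓝 t) (𝓝 0)) :
    ∃ W : ℝ → R3 → C3, Measurable (Function.uncurry W) ∧ ∀ t, W t =ᵐ[volume] u t := by
  classical
  obtain ⟨q, hq⟩ := exists_dense_seq ℝ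
  have hex : ∀ (k : ℕ) (t : ℝ), ∃ j, zInt ρ a σ (u (q j) - u t) < 2⁻¹ ^ k := by
    intro k t
    have h1 : ∀ᶠ s in 𝓝 t, zInt ρ a σ (u s - u t) < 2⁻¹ ^ k :=
      (hc t).eventually (Iio_mem_nhds (ENNReal.pow_pos (by simp) k))
    obtain ⟨s, hsq, hs⟩ := hq.inter_nhds_nonempty h1
    obtain ⟨j, hj⟩ := hsq
    exact ⟨j, by rw [hj]; exact hs⟩
  -- J k t is the first index in a dense sequence of times whose value approximates u t within 2⁻ᵏ.
  -- It is measurable because approximation is an open condition in t, and the approximants take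
  -- countably many values, hence are jointly measurable.
  obtain ⟨J, hJ⟩ : ∃ J : ℕ → ℝ → ℕ, ∀ k t, J k t = Nat.find (hex k t) := ⟨_, fun _ _ => rfl⟩
  have hJm : ∀ k, Measurable (J k) := fun k => by
    have : J k = fun t => Nat.find (hex k t) := funext (hJ k)
    rw [this]
    exact measurable_find _ fun j => (isOpen_zInt_sub_lt hu hc (q j) _).measurableSet
  have hJlt : ∀ k t, zInt ρ a σ (u (q (J k t)) - u t) < 2⁻¹ ^ k := fun k t => by
    rw [hJ]
    exact Nat.find_spec (hex k t)
  have hm : ∀ k, Measurable fun p : ℝ × R3 => u (q (J k p.1)) p.2 := fun k => by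
    have h1 : Measurable fun p : ℕ × R3 => u (q p.1) p.2 :=
      measurable_from_prod_countable_right fun j => hu (q j)
    exact h1.comp (((hJm k).comp measurable_fst).prodMk measurable_snd)
  have hlim : ∀ t, ∀ᵐ ξ, Tendsto (fun k => u (q (J k t)) ξ) atTop (𝓝 (u t ξ)) := fun t => by
    refine tendsto_of_tsum_zInt (ρ := ρ) (a := a) (σ := σ) (fun k => hu _) (hu t) ?_
    refine ((ENNReal.tsum_le_tsum fun k => (hJlt k t).le).trans_lt ?_).ne
    rw [ENNReal.tsum_geometric, ENNReal.one_sub_inv_two, inv_inv]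
    simp
  refine ⟨fun t ξ => limUnder atTop fun k => u (q (J k t)) ξ, ?_, fun t => ?_⟩
  · exact (StronglyMeasurable.limUnder fun k => (hm k).stronglyMeasurable).measurable
  · filter_upwards [hlim t] with ξ hξ
    exact hξ.limUnder_eq

/-- The data of a solution on the Fourier side: a jointly measurable, divergence-free version of
the Fourier transform. -/
theorem exists_fourier_version {a σ : ℝ} (ha : 0 < a) (hσ : 1 < σ) {w : ℝ → 𝓢'(R3, C3)}
    (hw : MemCZ (-1) a σ w) (hw1 : MemL1Z 1 a σ w) (hdiv : ∀ t, 0 ≤ t → IsDivFree (w t)) :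
    ∃ W : ℝ → R3 → C3, Measurable (Function.uncurry W) ∧
      (∀ t, 0 ≤ t → IsRepresentedBy (fourierDist (w t)) (W t)) ∧
      (∀ t ξ, leray ξ (W t ξ) = W t ξ) ∧
      (∀ t, zInt (-1) a σ (W t) < ∞) ∧
      (∀ t, Tendsto (fun s => zInt (-1) a σ (W s - W t)) (𝓝 t) (𝓝 0)) ∧
      ∫⁻ t in Ioi 0, zInt 1 a σ (W t) < ∞ := by
  -- Composition with t ↦ max t 0 extends the curve continuously to all real times.
  have hmax : ∀ t : ℝ, 0 ≤ max t 0 := fun t => le_max_right _ _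
  have hex := fun t => (hw.1 (max t 0) (hmax t)).exists_rep
  choose u hum hurep using hex
  have hdist : ∀ s t, zInt (-1) a σ (u s - u t) = zNorm (-1) a σ (w (max s 0) - w (max t 0)) := by
    intro s t
    refine (zNorm_eq_zInt ?_ _ _ _).symm
    rw [fourierDist_sub]
    exact (hurep s).sub (hurep t)
  have hc : ∀ t, Tendsto (fun s => zInt (-1) a σ (u s - u t)) (𝓝 t) (𝓝 0) := by
    intro t
    simp only [hdist]
    refine (hw.2 (max t 0) (hmax t)).comp (tendsto_nhdsWithin_iff.2
      ⟨Continuous.tendsto (by fun_prop : Continuous fun s : ℝ => max s 0) t,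
        Eventually.of_forall hmax⟩)
  obtain ⟨V, hVm, hVu⟩ := exists_measurable_version hum hc
  have hVz : ∀ t, zInt (-1) a σ (V t) < ∞ := fun t => by
    rw [zInt_congr (hVu t), ← zNorm_eq_zInt (hurep t)]
    exact hw.1 _ (hmax t)
  have hVrep : ∀ t, IsRepresentedBy (fourierDist (w (max t 0))) (V t) := fun t =>
    (hurep t).congr (hVu t).symm
  -- Since V t is divergence-free almost everywhere, projecting changes only a null set and gives
  -- the identity at every frequency.
  obtain ⟨W, hW⟩ : ∃ W : ℝ → R3 → C3, ∀ t ξ, W t ξ = leray ξ (V t ξ) := ⟨_, fun _ _ => rfl⟩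
  have hWm : Measurable (Function.uncurry W) := by
    have h1 := measurable_leray.comp (measurable_snd.prodMk hVm)
    convert! h1 using 1
    exact funext fun p => hW p.1 p.2
  have hWV : ∀ t, W t =ᵐ[volume] V t := fun t => by
    have hmeas : AEStronglyMeasurable (V t) := hVm.of_uncurry_left.aestronglyMeasurable
    have h1 : Integrable fun ξ => ‖ξ‖ • V t ξ := by
      simpa using integrable_norm_smul ha hσ 1 hmeas (hVz t)
    filter_upwards [(hdiv _ (hmax t)).rep (integrable_of_zInt ha hσ hmeas (hVz t)) h1 (hVrep t)]
      with ξ hξ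
    rw [hW]
    exact (leray_eq_self_iff ξ _).2 hξ
  have hWu : ∀ t, W t =ᵐ[volume] u t := fun t => (hWV t).trans (hVu t)
  have hrep : ∀ t, 0 ≤ t → IsRepresentedBy (fourierDist (w t)) (W t) := fun t ht => by
    have := (hVrep t).congr (hWV t).symm
    rwa [max_eq_left ht] at this
  refine ⟨W, hWm, hrep, fun t ξ => ?_, fun t => ?_, fun t => ?_, ?_⟩
  · rw [hW, leray_leray]
  · rw [zInt_congr (hWV t)]
    exact hVz t
  · refine (hc t).congr fun s => (zInt_congr ?_).symm
    exact (hWu s).sub (hWu t)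
  · have h1 := hw1.2.2
    rw [Measure.restrict_congr_set (Ioi_ae_eq_Ici (a := (0 : ℝ))).symm] at h1
    refine lt_of_eq_of_lt (setLIntegral_congr_fun measurableSet_Ioi fun t (ht : 0 < t) => ?_) h1
    exact (zNorm_eq_zInt (hrep t ht.le) _ _ _).symm

/-! ### The lemma of du Bois-Reymond -/

/-- A test function on `(0, ∞)` with integral zero is the derivative of a test function. -/
theorem exists_primitive_test {k : ℝ → ℝ} (hk : ContDiff ℝ (⊤ : ℕ∞) k) (hc : HasCompactSupport k)
    (hs : tsupport k ⊆ Ioi 0) (h0 : ∫ t, k t = 0) :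
    ∃ θ : ℝ → ℝ, ContDiff ℝ (⊤ : ℕ∞) θ ∧ HasCompactSupport θ ∧ tsupport θ ⊆ Ioi 0 ∧
      deriv θ = k := by
  obtain ⟨α, hα, hα'⟩ : ∃ α, 0 < α ∧ ∀ t, k t ≠ 0 → α ≤ t := by
    rcases (tsupport k).eq_empty_or_nonempty with he | hne
    · exact ⟨1, one_pos, fun t ht => absurd (subset_tsupport k ht) (by simp [he])⟩
    · obtain ⟨α, hα⟩ := IsCompact.exists_isLeast hc hne
      exact ⟨α, hs hα.1, fun t ht => hα.2 (subset_tsupport k ht)⟩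
  obtain ⟨β, hβ⟩ := (IsCompact.bddAbove hc)
  have hβ' : ∀ t, k t ≠ 0 → t ≤ β := fun t ht => hβ (subset_tsupport k ht)
  have hd : ∀ t, HasDerivAt (fun t => ∫ s in (0 : ℝ)..t, k s) (k t) t := fun t =>
    intervalIntegral.integral_hasDerivAt_right (hk.continuous.intervalIntegrable _ _)
      (hk.continuous.stronglyMeasurableAtFilter _ _) hk.continuous.continuousAt
  have hderiv : deriv (fun t => ∫ s in (0 : ℝ)..t, k s) = k := funext fun t => (hd t).deriv
  have hzero : ∀ t, t ∉ Icc α β → ∫ s in (0 : ℝ)..t, k s = 0 := by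
    intro t ht
    rcases lt_or_ge t α with h1 | h1
    · have h2 : ∀ s ∈ uIcc 0 t, k s = 0 := fun s hs => by
        by_contra h3
        have h4 := hα' s h3
        have h5 : s ≤ max 0 t := hs.2
        have : max 0 t < α := max_lt hα h1
        linarith
      rw [intervalIntegral.integral_congr (g := fun _ => 0) h2]
      simp
    -- Past the support the primitive equals the full integral of k, which is 0.
    · have h2 : β < t := by
        by_contra h3
        exact ht ⟨h1, not_lt.1 h3⟩
      rw [intervalIntegral.integral_of_le (hα.le.trans h1)]
      refine (setIntegral_eq_integral_of_forall_compl_eq_zero fun s hs => ?_).trans h0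
      by_contra h3
      exact hs ⟨hα.trans_le (hα' s h3), (hβ' s h3).trans h2.le⟩
  refine ⟨_, ?_, HasCompactSupport.intro isCompact_Icc fun t ht => hzero t ht, ?_, hderiv⟩
  · rw [contDiff_infty_iff_deriv, hderiv]
    exact ⟨fun t => (hd t).differentiableAt, hk⟩
  · refine (closure_minimal (fun t ht => ?_) (isClosed_Icc (a := α) (b := β))).trans
      fun t ht => hα.trans_le ht.1
    by_contra h
    exact ht (hzero t h)

/-- Zero distributional derivative means constant. Fix η with integral 1 and set c = ∫ηy. Each θ -
(∫θ)η is the derivative of a test function, so θ does not see y - c. -/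
theorem eq_zero_of_integral_deriv_mul {y : ℝ → ℂ} (hy : ContinuousOn y (Ici 0)) (hy0 : y 0 = 0)
    (h : ∀ θ : ℝ → ℝ, ContDiff ℝ (⊤ : ℕ∞) θ → HasCompactSupport θ → tsupport θ ⊆ Ioi 0 →
      ∫ t, ((deriv θ t : ℝ) : ℂ) * y t = 0) {t : ℝ} (ht : 0 ≤ t) : y t = 0 := by
  -- A bump supported in [1, 3], inside (0, ∞).
  obtain ⟨b, hb⟩ : ∃ b : ContDiffBump (2 : ℝ), b.rOut = 1 :=
    ⟨⟨2⁻¹, 1, by norm_num, by norm_num⟩, rfl⟩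
  obtain ⟨η, hη1, hη2, hη3, hη4⟩ : ∃ η : ℝ → ℝ, ContDiff ℝ (⊤ : ℕ∞) η ∧ HasCompactSupport η ∧
      tsupport η ⊆ Ioi 0 ∧ ∫ t, η t = 1 := by
    refine ⟨b.normed volume, b.contDiff_normed, b.hasCompactSupport_normed, ?_,
      b.integral_normed⟩
    rw [b.tsupport_normed_eq, hb]
    intro s hs
    rw [Real.closedBall_eq_Icc] at hs
    have := hs.1
    simp only [mem_Ioi]
    linarith
  have hint : ∀ θ : ℝ → ℝ, Continuous θ → HasCompactSupport θ → tsupport θ ⊆ Ioi 0 →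
      Integrable fun t => (θ t : ℂ) * y t := by
    intro θ h1 h2 h3
    have h4 : IntegrableOn (fun t => (θ t : ℂ) * y t) (tsupport θ) :=
      (((Complex.continuous_ofReal.comp h1).continuousOn).mul
        (hy.mono (h3.trans Ioi_subset_Ici_self))).integrableOn_compact h2
    refine (integrableOn_iff_integrable_of_support_subset fun s hs => ?_).1 h4
    refine subset_tsupport θ fun h5 => hs ?_
    simp only [h5, Complex.ofReal_zero, zero_mul]
  obtain ⟨c, hc⟩ : ∃ c, c = ∫ t, (η t : ℂ) * y t := ⟨_, rfl⟩
  have key : ∀ θ : ℝ → ℝ, ContDiff ℝ (⊤ : ℕ∞) θ → HasCompactSupport θ → tsupport θ ⊆ Ioi 0 →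
      ∫ t, θ t • (y t - c) = 0 := by
    intro θ h1 h2 h3
    obtain ⟨m, hm⟩ : ∃ m, m = ∫ t, θ t := ⟨_, rfl⟩
    have i1 := h1.continuous.integrable_of_hasCompactSupport h2 (μ := volume)
    have i2 := hη1.continuous.integrable_of_hasCompactSupport hη2 (μ := volume)
    have hsupp : tsupport (fun t => θ t - m * η t) ⊆ tsupport θ ∪ tsupport η := by
      refine closure_minimal (fun t ht => ?_)
        ((isClosed_tsupport θ).union (isClosed_tsupport η))
      by_contra h4
      rw [mem_union, not_or] at h4
      refine ht ?_
      simp only [image_eq_zero_of_notMem_tsupport h4.1, image_eq_zero_of_notMem_tsupport h4.2,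
        mul_zero, sub_zero]
    obtain ⟨Θ, a1, a2, a3, a4⟩ := exists_primitive_test (k := fun t => θ t - m * η t)
      (h1.sub (contDiff_const.mul hη1))
      ((h2.union hη2).of_isClosed_subset (isClosed_tsupport _) hsupp)
      (hsupp.trans (union_subset h3 hη3)) (by
        rw [integral_sub i1 (i2.const_mul m), integral_const_mul, hη4, hm, mul_one, sub_self])
    have h5 := h Θ a1 a2 a3
    rw [a4] at h5
    have j1 := hint θ h1.continuous h2 h3
    have j2 := hint η hη1.continuous hη2 hη3
    have h6 : ∫ t, ((θ t - m * η t : ℝ) : ℂ) * y t = (∫ t, (θ t : ℂ) * y t) - m * c := by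
      rw [hc, ← integral_const_mul, ← integral_sub j1 (j2.const_mul _)]
      refine integral_congr_ae (Eventually.of_forall fun t => ?_)
      push_cast
      ring
    rw [h6] at h5
    have h7 : ∫ t, θ t • (y t - c) = (∫ t, (θ t : ℂ) * y t) - m * c := by
      have e1 : ∫ t, (θ t : ℂ) = (m : ℂ) := by rw [hm]; exact integral_ofReal
      have i3 : Integrable fun t => (θ t : ℂ) * c := i1.ofReal.mul_const c
      rw [← e1, ← integral_mul_const, ← integral_sub j1 i3]
      refine integral_congr_ae (Eventually.of_forall fun t => ?_)
      simp only [Complex.real_smul]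
      ring
    rw [h7, h5]
  have hlint : LocallyIntegrableOn (fun t => y t - c) (Ioi 0) :=
    ((hy.mono Ioi_subset_Ici_self).sub continuousOn_const).locallyIntegrableOn measurableSet_Ioi
  have hae := isOpen_Ioi.ae_eq_zero_of_integral_contDiff_smul_eq_zero hlint
    fun θ h1 h2 h3 => key θ h1 h2 h3
  have hae' : y =ᵐ[volume.restrict (Ioi 0)] fun _ => c := by
    refine (ae_restrict_iff' measurableSet_Ioi).2 (hae.mono fun t h1 h2 => sub_eq_zero.1 (h1 h2))
  -- Almost-everywhere equality becomes equality on (0, ∞) by continuity and extends to the closure.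
  -- The value at 0 then forces c = 0.
  have heq := Measure.eqOn_open_of_ae_eq hae' isOpen_Ioi (hy.mono Ioi_subset_Ici_self)
    continuousOn_const
  have heq' : EqOn y (fun _ => c) (Ici 0) :=
    heq.of_subset_closure hy continuousOn_const Ioi_subset_Ici_self (by rw [closure_Ioi])
  rw [heq' ht, ← heq' (le_refl (0 : ℝ)), hy0]

/-! ### Product test functions -/

/-- The test function `(t, x) ↦ θ(t) ψ(x)`. -/
noncomputable def tensorTest (θ : ℝ → ℝ) (ψ : R3 → ℝ) (hθ : ContDiff ℝ (⊤ : ℕ∞) θ)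
    (hθc : HasCompactSupport θ) (hθs : tsupport θ ⊆ Ioi 0) (hψ : ContDiff ℝ (⊤ : ℕ∞) ψ)
    (hψc : HasCompactSupport ψ) : 𝓓(spaceTime, ℝ) where
  toFun z := θ z.1 * ψ z.2
  contDiff' := (hθ.comp contDiff_fst).mul (hψ.comp contDiff_snd)
  hasCompactSupport' := by
    refine HasCompactSupport.intro (hθc.isCompact.prod hψc.isCompact) fun z hz => ?_
    rw [mem_prod, not_and_or] at hz
    rcases hz with hz | hz
    · rw [image_eq_zero_of_notMem_tsupport hz, zero_mul]
    · rw [image_eq_zero_of_notMem_tsupport hz, mul_zero]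
  tsupport_subset' := by
    have h1 : tsupport (fun z : ℝ × R3 => θ z.1 * ψ z.2) ⊆ tsupport θ ×ˢ univ := by
      refine closure_minimal (fun z hz => ⟨?_, mem_univ _⟩) ((isClosed_tsupport θ).prod isClosed_univ)
      refine subset_tsupport θ fun h => hz ?_
      simp only [h, zero_mul]
    exact h1.trans (prod_mono hθs subset_rfl)

theorem lineDeriv_tensorTest {θ : ℝ → ℝ} {ψ : R3 → ℝ} (hθ : ContDiff ℝ (⊤ : ℕ∞) θ)
    (hθc : HasCompactSupport θ) (hθs : tsupport θ ⊆ Ioi 0) (hψ : ContDiff ℝ (⊤ : ℕ∞) ψ)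
    (hψc : HasCompactSupport ψ) (k : Fin 3) (t : ℝ) (x : R3) :
    (∂_{spaceDir k} (tensorTest θ ψ hθ hθc hθs hψ hψc) : 𝓓(spaceTime, ℝ)) (t, x) =
      θ t * fderiv ℝ ψ x (basisVec k) := by
  have h := congrArg (fun S : 𝓢(R3, ℂ) => S x)
    (lineDeriv_slice (tensorTest θ ψ hθ hθc hθs hψ hψc) k t)
  simp only [slice, lineDeriv_schwartzOfReal, schwartzOfReal_apply] at h
  rw [← Complex.ofReal_inj.1 h]
  have h1 : HasFDerivAt ψ (fderiv ℝ ψ x) x := ((hψ.differentiable (by simp)) x).hasFDerivAt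
  have h2 : HasFDerivAt (fun x => tensorTest θ ψ hθ hθc hθs hψ hψc (t, x)) (θ t • fderiv ℝ ψ x) x :=
    h1.const_mul (θ t)
  rw [h2.fderiv]
  rfl

theorem timeDeriv_lineDeriv_tensorTest {θ : ℝ → ℝ} {ψ : R3 → ℝ} (hθ : ContDiff ℝ (⊤ : ℕ∞) θ)
    (hθc : HasCompactSupport θ) (hθs : tsupport θ ⊆ Ioi 0) (hψ : ContDiff ℝ (⊤ : ℕ∞) ψ)
    (hψc : HasCompactSupport ψ) (k : Fin 3) (t : ℝ) (x : R3) :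
    (∂_{timeDir} (∂_{spaceDir k} (tensorTest θ ψ hθ hθc hθs hψ hψc)) : 𝓓(spaceTime, ℝ)) (t, x) =
      deriv θ t * fderiv ℝ ψ x (basisVec k) := by
  have h1 := hasDerivAt_test (∂_{spaceDir k} (tensorTest θ ψ hθ hθc hθs hψ hψc)) t x
  simp only [lineDeriv_tensorTest] at h1
  have h2 : HasDerivAt θ (deriv θ t) t := ((hθ.differentiable (by simp)) t).hasDerivAt
  exact h1.unique (h2.mul_const _)

/-- Symmetry of second derivatives is what makes an unknown pressure drop out of the curl. -/
theorem lineDeriv_comm (χ : 𝓓(spaceTime, ℝ)) (v w : ℝ × R3) :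
    (∂_{v} (∂_{w} χ) : 𝓓(spaceTime, ℝ)) = ∂_{w} (∂_{v} χ) := by
  have h1 : ∀ v, ((∂_{v} χ : 𝓓(spaceTime, ℝ)) : ℝ × R3 → ℝ) = fun z => fderiv ℝ χ z v := fun v =>
    funext fun z => testFunction_lineDeriv_apply χ v z
  have hd : ∀ z, HasFDerivAt (fderiv ℝ χ) (fderiv ℝ (fderiv ℝ χ) z) z := fun z =>
    (((χ.contDiff.fderiv_right (m := ((⊤ : ℕ∞) : WithTop ℕ∞)) (by simp)).differentiable
      (by simp)) z).hasFDerivAt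
  have h2 : ∀ v w z, (∂_{v} (∂_{w} χ) : 𝓓(spaceTime, ℝ)) z = fderiv ℝ (fderiv ℝ χ) z v w := by
    intro v w z
    rw [testFunction_lineDeriv_apply, h1 w]
    have h3 : HasFDerivAt (fun z => fderiv ℝ χ z w)
        ((ContinuousLinearMap.apply ℝ ℝ w).comp (fderiv ℝ (fderiv ℝ χ) z)) z :=
      (ContinuousLinearMap.apply ℝ ℝ w).hasFDerivAt.comp z (hd z)
    rw [h3.fderiv]
    rfl
  refine TestFunction.ext fun z => ?_
  rw [h2, h2]
  have h3 : IsSymmSndFDerivAt ℝ χ z :=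
    χ.contDiff.contDiffAt.isSymmSndFDerivAt (by
      rw [minSmoothness_of_isRCLikeNormedField]
      exact WithTop.coe_le_coe.2 (le_top : (2 : ℕ∞) ≤ ⊤))
  exact h3 v w

/-! ### Curl-free families -/

section Curl

variable {a σ : ℝ} {R : ℝ → R3 → C3}

theorem norm_integral_mul_synth_coord_le (S : 𝓢(R3, ℂ)) {g : R3 → C3} (j : Fin 3) :
    ‖∫ x, S x * synth g x j‖ ≤ (∫ x, ‖S x‖) * (fourConst * ∫ ξ, ‖g ξ‖) := by
  rw [← integral_mul_const]
  refine norm_integral_le_of_norm_le (S.integrable.norm.mul_const _)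
    (Eventually.of_forall fun x => ?_)
  rw [norm_mul]
  exact mul_le_mul_of_nonneg_left ((norm_coord_le _ j).trans (norm_synth_le x)) (norm_nonneg _)

theorem integrable_mul_synth_coord (S : 𝓢(R3, ℂ)) {g : R3 → C3} (hg : Integrable g) (j : Fin 3) :
    Integrable fun x => S x * synth g x j := by
  simp only [synth_coord hg]
  exact integrable_schwartz_smul_synth S (integrable_coord hg j)

theorem tendsto_integral_norm_sub (ha : 0 < a) (hσ : 1 < σ) (hRi : ∀ t, Integrable (R t)) {t : ℝ}
    {l : Filter ℝ} (h : Tendsto (fun s => zInt (-1) a σ (R s - R t)) l (𝓝 0)) :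
    Tendsto (fun s => ∫ ξ, ‖R s ξ - R t ξ‖) l (𝓝 0) := by
  obtain ⟨C, hC, hle⟩ := lintegral_enorm_le_zInt ha hσ
  have h1 : Tendsto (fun s => ENNReal.ofReal C * zInt (-1) a σ (R s - R t)) l
      (𝓝 (ENNReal.ofReal C * 0)) :=
    ENNReal.Tendsto.const_mul h (Or.inr ENNReal.ofReal_ne_top)
  rw [mul_zero] at h1
  have h2 : Tendsto (fun s => ∫⁻ ξ, ‖(R s - R t) ξ‖ₑ) l (𝓝 0) :=
    tendsto_of_tendsto_of_tendsto_of_le_of_le tendsto_const_nhds h1 (fun _ => zero_le)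
      fun s => hle (R s - R t)
  have h3 := (ENNReal.tendsto_toReal ENNReal.zero_ne_top).comp h2
  rw [ENNReal.toReal_zero] at h3
  refine h3.congr fun s => ?_
  exact (integral_norm_eq_lintegral_enorm ((hRi s).sub (hRi t)).1).symm

theorem continuousOn_integral_mul_synth (ha : 0 < a) (hσ : 1 < σ) (hRi : ∀ t, Integrable (R t))
    (hRc : ∀ t, 0 ≤ t → Tendsto (fun s => zInt (-1) a σ (R s - R t)) (𝓝[Ici 0] t) (𝓝 0))
    (S : 𝓢(R3, ℂ)) (j : Fin 3) :
    ContinuousOn (fun t => ∫ x, S x * synth (R t) x j) (Ici 0) := by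
  intro t ht
  rw [ContinuousWithinAt, tendsto_iff_norm_sub_tendsto_zero]
  have h1 := tendsto_integral_norm_sub ha hσ hRi (hRc t ht)
  have h2 := (h1.const_mul fourConst).const_mul (∫ x, ‖S x‖)
  simp only [mul_zero] at h2
  refine squeeze_zero (fun _ => norm_nonneg _) (fun s => ?_) h2
  rw [← integral_sub (integrable_mul_synth_coord S (hRi s) j)
    (integrable_mul_synth_coord S (hRi t) j)]
  refine le_trans (le_of_eq ?_)
    (norm_integral_mul_synth_coord_le S (g := fun ξ => R s ξ - R t ξ) j)
  congr 2
  funext x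
  rw [synth_sub (hRi s) (hRi t), PiLp.sub_apply, mul_sub]

/-- A continuous family whose curl is independent of time in the sense of distributions, and
which vanishes initially, has vanishing Leray projections. -/
theorem leray_eq_zero_of_weak_curl (ha : 0 < a) (hσ : 1 < σ) (hRm : Measurable (Function.uncurry R))
    (hRz : ∀ t, zInt (-1) a σ (R t) < ∞)
    (hRc : ∀ t, 0 ≤ t → Tendsto (fun s => zInt (-1) a σ (R s - R t)) (𝓝[Ici 0] t) (𝓝 0))
    (hRb : ∀ T, IntegrableOn (fun t => ∫ ξ, ‖R t ξ‖) (Ioc 0 T)) (hR0 : ∀ ξ, R 0 ξ = 0)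
    (hsym : ∀ (χ : 𝓓(spaceTime, ℝ)) (i k : Fin 3),
      ∫ z : ℝ × R3, ((∂_{timeDir} (∂_{spaceDir k} χ) : 𝓓(spaceTime, ℝ)) z : ℂ) *
        synth (R z.1) z.2 i =
      ∫ z : ℝ × R3, ((∂_{timeDir} (∂_{spaceDir i} χ) : 𝓓(spaceTime, ℝ)) z : ℂ) *
        synth (R z.1) z.2 k) {t : ℝ} (ht : 0 ≤ t) :
    ∀ᵐ ξ, leray ξ (R t ξ) = 0 := by
  have hRt : ∀ t, AEStronglyMeasurable (R t) := fun t => hRm.of_uncurry_left.aestronglyMeasurable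
  have hRi := fun t => integrable_of_zInt ha hσ (hRt t) (hRz t)
  have hR1 : ∀ t, Integrable fun ξ => ‖ξ‖ • R t ξ := fun t => by
    simpa using integrable_norm_smul ha hσ 1 (hRt t) (hRz t)
  have hd1 : ∀ t (k i : Fin 3), Integrable fun ξ : R3 => (Complex.I * (ξ k : ℂ)) * R t ξ i :=
    fun t k i => integrable_I_mul_coord (integrable_coord (hRi t) i) (integrable_coord (hR1 t) i) k
  have hVm : ∀ j, Measurable fun z : ℝ × R3 => synth (R z.1) z.2 j := fun j => by
    have h1 : (fun z : ℝ × R3 => synth (R z.1) z.2 j) = fun z : ℝ × R3 =>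
        synth (fun ξ => R z.1 ξ j) z.2 := funext fun z => synth_coord (hRi z.1) z.2 j
    have h2 : Measurable (Function.uncurry fun t ξ => R t ξ j) :=
      (by fun_prop : Measurable fun v : C3 => v j).comp hRm
    rw [h1]
    exact measurable_synth h2
  have key : ∀ i k : Fin 3, ∀ᵐ ξ : R3, (ξ k : ℂ) * R t ξ i = (ξ i : ℂ) * R t ξ k := by
    intro i k
    have hG : Integrable fun ξ : R3 => (Complex.I * (ξ k : ℂ)) * R t ξ i -
        (Complex.I * (ξ i : ℂ)) * R t ξ k := (hd1 t k i).sub (hd1 t i k)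
    have h0 := ae_eq_zero_of_synth hG fun ψ hψ hψc => by
      obtain ⟨S, hS⟩ : ∃ S, S = schwartzOfReal ψ hψ hψc := ⟨_, rfl⟩
      have hSx : ∀ x, S x = (ψ x : ℂ) := fun x => by rw [hS, schwartzOfReal_apply]
      have hSd : ∀ j x, (∂_{basisVec j} S : 𝓢(R3, ℂ)) x = ((fderiv ℝ ψ x (basisVec j) : ℝ) : ℂ) :=
        fun j x => by rw [hS, lineDeriv_schwartzOfReal]
      -- The pairing of ψ with a component of the curl is continuous in time, vanishes at 0, and has
      -- zero weak derivative by `hsym` on the products θ(t)ψ(x).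
      have hy : ∀ s, 0 ≤ s → (∫ x, (∂_{basisVec k} S : 𝓢(R3, ℂ)) x * synth (R s) x i) -
          ∫ x, (∂_{basisVec i} S : 𝓢(R3, ℂ)) x * synth (R s) x k = 0 := by
        intro s hs
        refine eq_zero_of_integral_deriv_mul (y := fun s =>
          (∫ x, (∂_{basisVec k} S : 𝓢(R3, ℂ)) x * synth (R s) x i) -
          ∫ x, (∂_{basisVec i} S : 𝓢(R3, ℂ)) x * synth (R s) x k)
          ((continuousOn_integral_mul_synth ha hσ hRi hRc _ i).sub
            (continuousOn_integral_mul_synth ha hσ hRi hRc _ k)) ?_ (fun θ hθ hθc hθs => ?_) hs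
        · have : R 0 = fun _ => 0 := funext hR0
          simp [this, synth]
        · have hz : ∀ m j : Fin 3,
              Integrable (fun r => ((deriv θ r : ℝ) : ℂ) *
                ∫ x, (∂_{basisVec m} S : 𝓢(R3, ℂ)) x * synth (R r) x j) ∧
              ∫ z : ℝ × R3, ((∂_{timeDir} (∂_{spaceDir m}
                (tensorTest θ ψ hθ hθc hθs hψ hψc)) : 𝓓(spaceTime, ℝ)) z : ℂ) *
                synth (R z.1) z.2 j =
              ∫ r, ((deriv θ r : ℝ) : ℂ) *
                ∫ x, (∂_{basisVec m} S : 𝓢(R3, ℂ)) x * synth (R r) x j := by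
            intro m j
            have h1 := integrable_test_mul (∂_{timeDir} (∂_{spaceDir m}
              (tensorTest θ ψ hθ hθc hθs hψ hψc))) (hVm j)
              (fun T => (hRb T).const_mul fourConst)
              fun z => (norm_coord_le _ j).trans (norm_synth_le _)
            rw [Measure.volume_eq_prod] at h1 ⊢
            have h2 : ∀ r, ∫ x, ((∂_{timeDir} (∂_{spaceDir m}
                (tensorTest θ ψ hθ hθc hθs hψ hψc)) : 𝓓(spaceTime, ℝ)) (r, x) : ℂ) *
                synth (R r) x j = ((deriv θ r : ℝ) : ℂ) *
                ∫ x, (∂_{basisVec m} S : 𝓢(R3, ℂ)) x * synth (R r) x j := by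
              intro r
              rw [← integral_const_mul]
              refine integral_congr_ae (Eventually.of_forall fun x => ?_)
              beta_reduce
              rw [timeDeriv_lineDeriv_tensorTest, hSd]
              push_cast
              ring
            refine ⟨h1.integral_prod_left.congr (Eventually.of_forall h2), ?_⟩
            rw [integral_prod _ h1]
            exact integral_congr_ae (Eventually.of_forall h2)
          simp only [mul_sub]
          rw [integral_sub (hz k i).1 (hz i k).1, ← (hz k i).2, ← (hz i k).2, hsym, sub_self]
      -- Integrating by parts in space puts the symbols iξₖ and iξᵢ on the components of R.
      have h1 := hy t ht
      simp only [synth_coord (hRi t)] at h1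
      rw [integral_lineDeriv_mul_synth S k (integrable_coord (hRi t) i) (hd1 t k i),
        integral_lineDeriv_mul_synth S i (integrable_coord (hRi t) k) (hd1 t i k)] at h1
      simp only [synth_sub (hd1 t k i) (hd1 t i k), Complex.real_smul, ← hSx, mul_sub]
      have j1 := integrable_schwartz_smul_synth S (hd1 t k i)
      have j2 := integrable_schwartz_smul_synth S (hd1 t i k)
      simp only [smul_eq_mul] at j1 j2
      rw [integral_sub j1 j2]
      linear_combination -h1
    filter_upwards [h0] with ξ hξ
    have h1 : Complex.I * ((ξ k : ℂ) * R t ξ i - (ξ i : ℂ) * R t ξ k) = 0 := by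
      rw [← show _ = (0 : ℂ) from hξ]
      ring
    exact sub_eq_zero.1 ((mul_eq_zero.1 h1).resolve_left Complex.I_ne_zero)
  filter_upwards [ae_all_iff.2 fun i => ae_all_iff.2 (key i), ae_ne_zero] with ξ h1 h0
  exact leray_eq_zero_of_curl h0 h1

end Curl

/-! ### The integral equation for weak solutions -/

/-- The given velocity agrees with the synthesized one only almost everywhere at each time. Fubini
reduces the space-time integrals to these slices. -/
theorem integral_test_mul_congr (φ : 𝓓(spaceTime, ℝ)) {f : ℝ × R3 → ℝ}
    (hf : LocallyIntegrableOn f spaceTime) {h : ℝ × R3 → ℂ}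
    (hh : Integrable fun z => (φ z : ℂ) * h z)
    (hae : ∀ t, 0 < t → ∀ᵐ x, (f (t, x) : ℂ) = h (t, x)) :
    ((∫ z, φ z * f z : ℝ) : ℂ) = ∫ z, (φ z : ℂ) * h z := by
  have h1 : Integrable fun z => φ z * f z := φ.integrable_bilin (ContinuousLinearMap.mul ℝ ℝ) hf
  have h2 : Integrable fun z => ((φ z * f z : ℝ) : ℂ) := h1.ofReal
  have h3 : ((∫ z, φ z * f z : ℝ) : ℂ) = ∫ z, ((φ z * f z : ℝ) : ℂ) := integral_ofReal.symm
  rw [h3]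
  rw [Measure.volume_eq_prod] at h2 hh ⊢
  rw [integral_prod _ h2, integral_prod _ hh]
  refine integral_congr_ae (Eventually.of_forall fun t => ?_)
  beta_reduce
  rcases le_or_gt t 0 with ht | ht
  · simp [test_eq_zero φ ht]
  · refine integral_congr_ae ((hae t ht).mono fun x hx => ?_)
    beta_reduce
    rw [← hx, Complex.ofReal_mul]

section

variable {ν a σ : ℝ} {W : ℝ → R3 → C3}

/-- A continuous curve is bounded on compact intervals: near each time the bound 1 plus the norm
there holds, and finitely many neighbourhoods suffice. -/
theorem exists_zInt_bound (hWm : Measurable (Function.uncurry W))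
    (hWz : ∀ t, zInt (-1) a σ (W t) < ∞)
    (hWc : ∀ t, Tendsto (fun s => zInt (-1) a σ (W s - W t)) (𝓝 t) (𝓝 0)) (T : ℝ) :
    ∃ M < ∞, ∀ t ∈ Icc 0 T, zInt (-1) a σ (W t) ≤ M := by
  refine isCompact_Icc.induction_on (p := fun s => ∃ M < ∞, ∀ t ∈ s, zInt (-1) a σ (W t) ≤ M)
    ⟨0, by simp, by simp⟩ ?_ ?_ ?_
  · rintro s t hst ⟨M, hM, h⟩
    exact ⟨M, hM, fun r hr => h r (hst hr)⟩
  · rintro s t ⟨M, hM, h⟩ ⟨M', hM', h'⟩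
    refine ⟨max M M', max_lt hM hM', fun r hr => ?_⟩
    rcases hr with hr | hr
    · exact (h r hr).trans (le_max_left _ _)
    · exact (h' r hr).trans (le_max_right _ _)
  · intro t _
    refine ⟨_, mem_nhdsWithin_of_mem_nhds ((hWc t).eventually (Iio_mem_nhds one_pos)),
      1 + zInt (-1) a σ (W t), ENNReal.add_lt_top.2 ⟨by simp, hWz t⟩, fun s hs => ?_⟩
    have h1 : zInt (-1) a σ (W s - W t) < 1 := hs
    have h2 := zInt_add_le (ρ := -1) (a := a) (σ := σ) (g := W s - W t) (h := W t)
      (hWm.of_uncurry_left.sub hWm.of_uncurry_left).aestronglyMeasurable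
    rw [sub_add_cancel] at h2
    exact h2.trans (add_le_add h1.le le_rfl)

theorem lintegral_nlinMaj_lt_top (ha : 0 < a) (hσ : 1 < σ) {g : R3 → C3} (hg : Measurable g)
    (h0 : zInt (-1) a σ g < ∞) (h1 : zInt 1 a σ g < ∞) : ∫⁻ ξ, nlinMaj g g ξ < ∞ := by
  obtain ⟨C, hC, hle⟩ := lintegral_le_mul_wt ha hσ
  have h2 := lintegral_nlinMaj_le ha hσ one_pos hg hg
  have h3 : ∫⁻ ξ, wt (-1) a σ ξ * nlinMaj g g ξ < ∞ :=
    h2.trans_lt (by finiteness)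
  exact (hle _).trans_lt (ENNReal.mul_lt_top ENNReal.ofReal_lt_top h3)

theorem integral_norm_le_toReal (ha : 0 < a) (hσ : 1 < σ) : ∃ C : ℝ, 0 < C ∧
    ∀ (g : R3 → C3) (M : ℝ≥0∞), AEStronglyMeasurable g → M < ∞ → zInt (-1) a σ g ≤ M →
      ∫ ξ, ‖g ξ‖ ≤ (ENNReal.ofReal C * M).toReal := by
  obtain ⟨C, hC, hle⟩ := lintegral_enorm_le_zInt ha hσ
  refine ⟨C, hC, fun g M hg hM h => ?_⟩
  rw [integral_norm_eq_lintegral_enorm hg]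
  exact ENNReal.toReal_mono (ENNReal.mul_lt_top ENNReal.ofReal_lt_top hM).ne
    ((hle _).trans (mul_le_mul_right h _))

theorem zInt_setIntegral_le {F : ℝ → R3 → C3} (hF : Measurable (Function.uncurry F)) (T : ℝ) :
    zInt (-1) a σ (fun ξ => ∫ s in Ioc 0 T, F s ξ) ≤ ∫⁻ s in Ioc 0 T, zInt (-1) a σ (F s) := by
  refine (lintegral_mono fun ξ =>
    mul_le_mul_right (enorm_integral_le_lintegral_enorm _) _).trans_eq ?_
  exact (lintegral_wt_swap (-1) a σ (n := fun τ ξ => ‖F τ ξ‖ₑ) hF.enorm (Ioc 0 T)).symm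

/-- Weak solutions satisfy the momentum equation up to a pressure term which only depends on
`∂ᵢφ`. -/
theorem momentum_fourier (hU : Measurable (Function.uncurry W))
    (hUi : ∀ t, Integrable (W t)) (hB : ∀ T, ∃ B, ∀ t ∈ Ioc 0 T, ∫ ξ, ‖W t ξ‖ ≤ B)
    (hU1 : ∀ t, Integrable fun ξ => ‖ξ‖ • W t ξ) (hU2 : ∀ t, Integrable fun ξ => ‖ξ‖ ^ 2 • W t ξ)
    (hN : ∀ᵐ t ∂(volume.restrict (Ioi 0)), ∫⁻ ξ, nlinMaj (W t) (W t) ξ < ∞)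
    (hF : ∀ T, Integrable (Function.uncurry fun t => forcing ν (W t))
      ((volume.restrict (Ioc 0 T)).prod volume))
    {v : ℝ → R3 → R3} {p : 𝓓'(spaceTime, ℝ)} (hsol : SolvesMomentum ν v p)
    (hv : ∀ t, 0 < t → ∀ᵐ x, toC3 (v t x) = synth (W t) x) (φ : 𝓓(spaceTime, ℝ)) (i : Fin 3) :
    (∫ z : ℝ × R3, ((∂_{timeDir} φ : 𝓓(spaceTime, ℝ)) z : ℂ) * synth (W z.1) z.2 i) +
      (∫ z : ℝ × R3, (φ z : ℂ) * synth (fun ξ => forcing ν (W z.1) ξ i) z.2) =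
    (∫ z : ℝ × R3, ((∂_{spaceDir i} φ : 𝓓(spaceTime, ℝ)) z : ℂ) *
        synth (presHat (W z.1)) z.2) - (p (∂_{spaceDir i} φ) : ℂ) := by
  obtain ⟨h1, h2, h3⟩ := hsol
  have hmom := (momentum_iff h1 h2 i).1 (h3 i) φ
  have hsp := spatial_weak_form_integral hU hUi hB hU1 hU2 hN hF φ i
  have hVm : ∀ j, Measurable fun z : ℝ × R3 => synth (W z.1) z.2 j := fun j => by
    have h1 : (fun z : ℝ × R3 => synth (W z.1) z.2 j) = fun z : ℝ × R3 =>
        synth (fun ξ => W z.1 ξ j) z.2 := funext fun z => synth_coord (hUi z.1) z.2 j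
    have h2 : Measurable (Function.uncurry fun t ξ => W t ξ j) :=
      (by fun_prop : Measurable fun v : C3 => v j).comp hU
    rw [h1]
    exact measurable_synth h2
  have hVb : ∀ j (z : ℝ × R3), ‖synth (W z.1) z.2 j‖ ≤ fourConst * ∫ ξ, ‖W z.1 ξ‖ :=
    fun j z => (norm_coord_le _ j).trans (norm_synth_le _)
  have hb1 := integrableOn_integral_norm hU hB
  have hb2 := integrableOn_integral_norm_mul hU hB
  have iA : ∀ ψ : 𝓓(spaceTime, ℝ), Integrable fun z : ℝ × R3 =>
      (ψ z : ℂ) * synth (W z.1) z.2 i := fun ψ =>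
    integrable_test_mul ψ (hVm i) (fun T => (hb1 T).const_mul fourConst) (hVb i)
  have iB : ∀ (ψ : 𝓓(spaceTime, ℝ)) j, Integrable fun z : ℝ × R3 =>
      (ψ z : ℂ) * (synth (W z.1) z.2 j * synth (W z.1) z.2 i) := fun ψ j =>
    integrable_test_mul ψ ((hVm j).mul (hVm i))
      (fun T => (hb2 T).const_mul (fourConst * fourConst)) fun z => by
        rw [norm_mul, mul_mul_mul_comm]
        exact mul_le_mul (hVb j z) (hVb i z) (norm_nonneg _) ((norm_nonneg _).trans (hVb j z))
  have hvi : ∀ t, 0 < t → ∀ᵐ x, ∀ j, ((v t x j : ℝ) : ℂ) = synth (W t) x j := fun t ht => by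
    filter_upwards [hv t ht] with x hx j
    rw [← hx, toC3_apply]
  have eA : ∀ ψ : 𝓓(spaceTime, ℝ), ((∫ z : ℝ × R3, ψ z * v z.1 z.2 i : ℝ) : ℂ) =
      ∫ z : ℝ × R3, (ψ z : ℂ) * synth (W z.1) z.2 i := fun ψ =>
    integral_test_mul_congr ψ (h1 i) (iA ψ) fun t ht => (hvi t ht).mono fun x hx => hx i
  have eB : ∀ (ψ : 𝓓(spaceTime, ℝ)) j,
      ((∫ z : ℝ × R3, ψ z * (v z.1 z.2 j * v z.1 z.2 i) : ℝ) : ℂ) =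
      ∫ z : ℝ × R3, (ψ z : ℂ) * (synth (W z.1) z.2 j * synth (W z.1) z.2 i) := fun ψ j =>
    integral_test_mul_congr ψ (h2 i j) (iB ψ j) fun t ht => (hvi t ht).mono fun x hx => by
      rw [← hx i, ← hx j, Complex.ofReal_mul]
  have hmom' := congrArg (fun r : ℝ => (r : ℂ)) hmom
  simp only [Complex.ofReal_add, Complex.ofReal_mul, Complex.ofReal_sum, Complex.ofReal_zero,
    eA, eB] at hmom'
  rw [← hsp]
  linear_combination hmom'

/-- Weak solutions are mild: the Fourier transform satisfies the integral equation. -/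
theorem integral_eq_of_solvesMomentum (hν : 0 < ν) (ha : 0 < a) (hσ : 1 < σ)
    (hWm : Measurable (Function.uncurry W)) (hWl : ∀ t ξ, leray ξ (W t ξ) = W t ξ)
    (hWz : ∀ t, zInt (-1) a σ (W t) < ∞)
    (hWc : ∀ t, Tendsto (fun s => zInt (-1) a σ (W s - W t)) (𝓝 t) (𝓝 0))
    (hW1 : ∫⁻ t in Ioi 0, zInt 1 a σ (W t) < ∞)
    {v : ℝ → R3 → R3} {p : 𝓓'(spaceTime, ℝ)} (hsol : SolvesMomentum ν v p)
    (hv : ∀ t, 0 < t → ∀ᵐ x, toC3 (v t x) = synth (W t) x) {t : ℝ} (ht : 0 ≤ t) :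
    ∀ᵐ ξ, W t ξ = W 0 ξ + ∫ s in Ioc 0 t, forcing ν (W s) ξ := by
  have hWt : ∀ t, AEStronglyMeasurable (W t) := fun t => hWm.of_uncurry_left.aestronglyMeasurable
  have hWi := fun t => integrable_of_zInt ha hσ (hWt t) (hWz t)
  have hWd1 : ∀ t, Integrable fun ξ => ‖ξ‖ • W t ξ := fun t => by
    simpa using integrable_norm_smul ha hσ 1 (hWt t) (hWz t)
  have hWd2 := fun t => integrable_norm_smul ha hσ 2 (hWt t) (hWz t)
  have hbd := exists_zInt_bound hWm hWz hWc
  obtain ⟨C, hC, hCle⟩ := integral_norm_le_toReal ha hσ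
  have hB : ∀ T, ∃ B, ∀ t ∈ Ioc 0 T, ∫ ξ, ‖W t ξ‖ ≤ B := fun T => by
    obtain ⟨M, hM, h⟩ := hbd T
    exact ⟨_, fun t ht => hCle (W t) M (hWt t) hM (h t (Ioc_subset_Icc_self ht))⟩
  have hN : ∀ᵐ t ∂(volume.restrict (Ioi 0)), ∫⁻ ξ, nlinMaj (W t) (W t) ξ < ∞ := by
    filter_upwards [ae_lt_top (measurable_zInt 1 a σ hWm) hW1.ne] with t ht
    exact lintegral_nlinMaj_lt_top ha hσ hWm.of_uncurry_left (hWz t) ht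
  have hFz : ∀ T, ∫⁻ s in Ioc 0 T, zInt (-1) a σ (forcing ν (W s)) < ∞ := fun T => by
    obtain ⟨M, hM, h⟩ := hbd T
    exact setLIntegral_zInt_forcing_lt_top hν.le ha hσ hWm measurableSet_Ioc hM
      (fun t ht => h t (Ioc_subset_Icc_self ht))
      ((lintegral_mono_set Ioc_subset_Ioi_self).trans_lt hW1)
  have hFm := measurable_forcing ν hWm
  have hF := fun T => integrable_uncurry_of_zInt ha hσ hFm (hFz T)
  have hmom := fun χ i => momentum_fourier hWm hWi hB hWd1 hWd2 hN hF hsol hv χ i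
  have hFl : ∀ s ξ, leray ξ (forcing ν (W s) ξ) = forcing ν (W s) ξ := fun s ξ => by
    rw [forcing, map_add, map_neg, leray_nlin, ← Complex.coe_smul, map_smul, hWl]
  obtain ⟨F, hFdef⟩ : ∃ F : ℝ → R3 → C3, ∀ s, forcing ν (W s) = F s := ⟨_, fun _ => rfl⟩
  simp only [hFdef] at hFz hFm hF hmom hFl ⊢
  -- u is what W should be if the integral equation holds. The rest shows that R = W - u vanishes.
  obtain ⟨u, hu⟩ : ∃ u : ℝ → R3 → C3, ∀ t ξ, u t ξ = W 0 ξ + ∫ s in Ioc 0 t, F s ξ :=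
    ⟨_, fun _ _ => rfl⟩
  have hum : Measurable (Function.uncurry u) := by
    have h1 : Measurable fun q : ℝ × R3 => ∫ s in Ioc 0 q.1, F s q.2 :=
      measurable_setIntegral_Ioc (f := fun (q : ℝ × R3) s => F s q.2) measurable_fst
        (hFm.comp (by fun_prop : Measurable fun q : (ℝ × R3) × ℝ => (q.2, q.1.2)))
    have h2 : Measurable fun q : ℝ × R3 => W 0 q.2 :=
      (hWm.of_uncurry_left (x := 0)).comp measurable_snd
    convert! h2.add h1 using 1
    exact funext fun q => hu q.1 q.2
  have hut : ∀ t, AEStronglyMeasurable (u t) := fun t => hum.of_uncurry_left.aestronglyMeasurable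
  have hu0 : ∀ ξ, u 0 ξ = W 0 ξ := fun ξ => by simp [hu]
  have hueq : ∀ t, 0 ≤ t → ∀ᵐ ξ, u t ξ = u 0 ξ + ∫ s in Ioc 0 t, F s ξ := fun t _ =>
    Eventually.of_forall fun ξ => by rw [hu, hu0]
  have huz : ∀ t, zInt (-1) a σ (u t) ≤
      zInt (-1) a σ (W 0) + ∫⁻ s in Ioc 0 t, zInt (-1) a σ (F s) := fun t => by
    have h1 : u t = W 0 + fun ξ => ∫ s in Ioc 0 t, F s ξ := funext fun ξ => hu t ξ
    rw [h1]
    exact (zInt_add_le (hWt 0)).trans (add_le_add le_rfl (zInt_setIntegral_le hFm t))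
  have huz' : ∀ t, zInt (-1) a σ (u t) < ∞ := fun t =>
    (huz t).trans_lt (ENNReal.add_lt_top.2 ⟨hWz 0, hFz t⟩)
  have hui := fun t => integrable_of_zInt ha hσ (hut t) (huz' t)
  have huB : ∀ T, ∃ B, ∀ t ∈ Ioc 0 T, ∫ ξ, ‖u t ξ‖ ≤ B := fun T =>
    ⟨_, fun t ht => hCle (u t) _ (hut t) (ENNReal.add_lt_top.2 ⟨hWz 0, hFz T⟩)
      ((huz t).trans (add_le_add le_rfl (lintegral_mono_set (Ioc_subset_Ioc_right ht.2))))⟩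
  have hub := integrableOn_integral_norm hum huB
  have huc := fun t (ht : 0 ≤ t) => tendsto_zInt_sub ha hσ hFm hFz hueq ht
  obtain ⟨R, hR⟩ : ∃ R : ℝ → R3 → C3, ∀ t, R t = W t - u t := ⟨_, fun _ => rfl⟩
  have hRm : Measurable (Function.uncurry R) := by
    convert! hWm.sub hum using 1
    exact funext fun q => congrFun (hR q.1) q.2
  have hRz : ∀ t, zInt (-1) a σ (R t) ≤ zInt (-1) a σ (W t) + zInt (-1) a σ (u t) := fun t => by
    rw [hR, sub_eq_add_neg]
    refine (zInt_add_le (hWt t)).trans ?_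
    rw [zInt_neg]
  have hRB : ∀ T, ∃ B, ∀ t ∈ Ioc 0 T, ∫ ξ, ‖R t ξ‖ ≤ B := fun T => by
    obtain ⟨B1, h1⟩ := hB T
    obtain ⟨B2, h2⟩ := huB T
    refine ⟨B1 + B2, fun t ht => ?_⟩
    refine le_trans ?_ (add_le_add (h1 t ht) (h2 t ht))
    rw [← integral_add (hWi t).norm (hui t).norm]
    refine integral_mono (by rw [hR]; exact ((hWi t).sub (hui t)).norm)
      ((hWi t).norm.add (hui t).norm) fun ξ => ?_
    rw [hR]
    exact norm_sub_le _ _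
  have hRc : ∀ t, 0 ≤ t → Tendsto (fun s => zInt (-1) a σ (R s - R t)) (𝓝[Ici 0] t) (𝓝 0) := by
    intro t ht
    have h1 := ((hWc t).mono_left (nhdsWithin_le_nhds (s := Ici 0))).add (huc t ht)
    rw [add_zero] at h1
    refine tendsto_of_tendsto_of_tendsto_of_le_of_le tendsto_const_nhds h1 (fun _ => zero_le)
      fun s => ?_
    have h2 : R s - R t = (W s - W t) + -(u s - u t) := by
      rw [hR, hR]
      abel
    rw [h2]
    refine (zInt_add_le ((hWt s).sub (hWt t))).trans ?_
    rw [zInt_neg]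
  -- The right side depends on χ only through ∂ᵢ∂ₖχ, hence is symmetric in i and k. Nothing about
  -- the distribution p is used beyond this.
  have hsym : ∀ (χ : 𝓓(spaceTime, ℝ)) (i k : Fin 3),
      ∫ z : ℝ × R3, ((∂_{timeDir} (∂_{spaceDir k} χ) : 𝓓(spaceTime, ℝ)) z : ℂ) *
        synth (R z.1) z.2 i =
      (∫ z : ℝ × R3, ((∂_{spaceDir i} (∂_{spaceDir k} χ) : 𝓓(spaceTime, ℝ)) z : ℂ) *
        synth (presHat (W z.1)) z.2) - (p (∂_{spaceDir i} (∂_{spaceDir k} χ)) : ℂ) := by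
    intro χ i k
    rw [← hmom (∂_{spaceDir k} χ) i]
    have h1 := time_weak_form hum hFm hui hub hF hueq (∂_{spaceDir k} χ) i
    have hVm : ∀ {X : ℝ → R3 → C3}, Measurable (Function.uncurry X) → (∀ t, Integrable (X t)) →
        Measurable fun z : ℝ × R3 => synth (X z.1) z.2 i := fun {X} hX hXi => by
      have h1 : (fun z : ℝ × R3 => synth (X z.1) z.2 i) = fun z : ℝ × R3 =>
          synth (fun ξ => X z.1 ξ i) z.2 := funext fun z => synth_coord (hXi z.1) z.2 i
      have h2 : Measurable (Function.uncurry fun t ξ => X t ξ i) :=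
        (by fun_prop : Measurable fun v : C3 => v i).comp hX
      rw [h1]
      exact measurable_synth h2
    have i1 := integrable_test_mul (∂_{timeDir} (∂_{spaceDir k} χ)) (hVm hWm hWi)
      (fun T => (integrableOn_integral_norm hWm hB T).const_mul fourConst)
      fun z => (norm_coord_le _ i).trans (norm_synth_le _)
    have i2 := integrable_test_mul (∂_{timeDir} (∂_{spaceDir k} χ)) (hVm hum hui)
      (fun T => (hub T).const_mul fourConst)
      fun z => (norm_coord_le _ i).trans (norm_synth_le _)
    have h2 : ∫ z : ℝ × R3, ((∂_{timeDir} (∂_{spaceDir k} χ) : 𝓓(spaceTime, ℝ)) z : ℂ) *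
        synth (R z.1) z.2 i =
        (∫ z : ℝ × R3, ((∂_{timeDir} (∂_{spaceDir k} χ) : 𝓓(spaceTime, ℝ)) z : ℂ) *
          synth (W z.1) z.2 i) -
        ∫ z : ℝ × R3, ((∂_{timeDir} (∂_{spaceDir k} χ) : 𝓓(spaceTime, ℝ)) z : ℂ) *
          synth (u z.1) z.2 i := by
      rw [← integral_sub i1 i2]
      refine integral_congr_ae (Eventually.of_forall fun z => ?_)
      have h3 : synth (R z.1) z.2 = synth (W z.1) z.2 - synth (u z.1) z.2 := by
        rw [hR, ← synth_sub (hWi _) (hui _)]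
        rfl
      beta_reduce
      rw [h3, PiLp.sub_apply, mul_sub]
    rw [h2]
    linear_combination -h1
  have hcurl := leray_eq_zero_of_weak_curl ha hσ hRm
    (fun t => (hRz t).trans_lt (ENNReal.add_lt_top.2 ⟨hWz t, huz' t⟩)) hRc
    (integrableOn_integral_norm hRm hRB) (fun ξ => by rw [hR, Pi.sub_apply, hu0, sub_self])
    (fun χ i k => by rw [hsym, hsym, lineDeriv_comm]) ht
  -- The Leray projector kills R, but it also fixes both W and u, so R itself is 0.
  filter_upwards [hcurl, (hF t).prod_left_ae] with ξ h1 h2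
  have h3 : leray ξ (u t ξ) = u t ξ := by
    have h2' : IntegrableOn (fun s => F s ξ) (Ioc 0 t) := h2
    rw [hu, map_add, hWl, ← ContinuousLinearMap.integral_comp_comm _ h2']
    simp only [hFl]
  rw [hR, Pi.sub_apply, map_sub, h3, hWl] at h1
  rw [sub_eq_zero.1 h1, hu]

end

/-! ### Uniqueness -/

/-- A Gronwall lemma for bounded functions and an integrable weight. -/
theorem eq_zero_of_le_setLIntegral {T : ℝ} {d b : ℝ → ℝ≥0∞} {M : ℝ≥0∞} (hM : M < ∞)
    (hd : ∀ t ∈ Icc 0 T, d t ≤ M) (hb : ∫⁻ s in Ioc 0 T, b s ≠ ∞)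
    (h : ∀ t ∈ Icc 0 T, d t ≤ ∫⁻ s in Ioc 0 t, d s * b s) : ∀ t ∈ Icc 0 T, d t = 0 := by
  -- Choose a step r so that b has integral less than 1/2 on every interval of length r within (0,
  -- T], and advance by steps of length r.
  obtain ⟨δ, hδ, hsm⟩ := exists_pos_setLIntegral_lt_of_measure_lt hb (ε := 2⁻¹) (by simp)
  obtain ⟨r, hr0, hrδ⟩ : ∃ r : ℝ, 0 < r ∧ ENNReal.ofReal r < δ := by
    obtain ⟨q, hq0, hq⟩ := ENNReal.lt_iff_exists_nnreal_btwn.1 hδ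
    refine ⟨q, by simpa using hq0, by simpa using hq⟩
  have key : ∀ k : ℕ, ∀ t ∈ Icc 0 T, t ≤ k * r → d t = 0 := by
    intro k
    induction k with
    | zero =>
      intro t ht htk
      have h0 : t = 0 := le_antisymm (by simpa using htk) ht.1
      have h1 := h t ht
      rw [h0] at h1 ⊢
      simpa using h1
    | succ k ih =>
      obtain ⟨A, hA⟩ : ∃ A, A = ⨆ t ∈ Icc 0 T ∩ Iic ((k + 1 : ℕ) * r), d t := ⟨_, rfl⟩
      have hle : ∀ t ∈ Icc 0 T ∩ Iic ((k + 1 : ℕ) * r), d t ≤ A := fun t ht => by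
        rw [hA]
        exact le_iSup₂ (f := fun t (_ : t ∈ Icc 0 T ∩ Iic ((k + 1 : ℕ) * r)) => d t) t ht
      have hAM : A ≤ M := by
        rw [hA]
        exact iSup₂_le fun t ht => hd t ht.1
      -- By induction d vanishes up to time kr, so only the last step contributes. There d ≤ A and b
      -- has mass at most 1/2. Finiteness of A then gives A = 0.
      have hhalf : A ≤ A * 2⁻¹ := by
        conv_lhs => rw [hA]
        refine iSup₂_le fun t ht => (h t ht.1).trans ?_
        have h1 : ∫⁻ s in Ioc 0 t, d s * b s ≤
            ∫⁻ s in Ioc 0 t, (Ioc (k * r) t).indicator (fun s => A * b s) s := by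
          refine setLIntegral_mono' measurableSet_Ioc fun s hs => ?_
          have hsT : s ∈ Icc 0 T := ⟨hs.1.le, hs.2.trans ht.1.2⟩
          by_cases hk : s ≤ k * r
          · simp [ih s hsT hk]
          · have hmem : s ∈ Ioc (k * r) t := ⟨not_le.1 hk, hs.2⟩
            rw [indicator_of_mem hmem]
            gcongr
            exact hle s ⟨hsT, hs.2.trans ht.2⟩
        refine h1.trans ?_
        rw [lintegral_indicator measurableSet_Ioc, Measure.restrict_restrict measurableSet_Ioc,
          lintegral_const_mul' _ _ (hAM.trans_lt hM).ne]
        gcongr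
        have h2 : Ioc (k * r) t ∩ Ioc 0 t ⊆ Ioc (k * r) t ∩ Ioc 0 T :=
          inter_subset_inter_right _ (Ioc_subset_Ioc_right ht.1.2)
        refine (lintegral_mono_set h2).trans ?_
        rw [← Measure.restrict_restrict measurableSet_Ioc]
        refine (hsm _ ?_).le
        refine (Measure.restrict_apply_le _ _).trans_lt (lt_of_le_of_lt ?_ hrδ)
        rw [Real.volume_Ioc]
        refine ENNReal.ofReal_le_ofReal ?_
        have h3 : t ≤ (k + 1 : ℕ) * r := ht.2
        push_cast at h3
        linarith
      have hA0 : A = 0 := by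
        by_contra hne
        have h1 : A * 2⁻¹ < A := by
          rw [← div_eq_mul_inv]
          exact ENNReal.half_lt_self hne (hAM.trans_lt hM).ne
        exact absurd hhalf (not_le.2 h1)
      intro t ht htk
      have := hle t ⟨ht, htk⟩
      rw [hA0] at this
      exact le_antisymm this zero_le
  intro t ht
  obtain ⟨k, hk⟩ := exists_nat_ge (t / r)
  exact key k t ht ((div_le_iff₀ hr0).1 hk)

/-- At almost every frequency the integral equation holds for almost every time, which is all that
the scalar variation of constants requires. -/
theorem ae_eq_duh {ν : ℝ} {D N : ℝ → R3 → C3} (hDm : Measurable (Function.uncurry D))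
    (hNm : Measurable (Function.uncurry N))
    (hDi : ∀ t, Integrable (Function.uncurry D) ((volume.restrict (Ioc 0 t)).prod volume))
    (hNi : ∀ t, ∀ᵐ ξ, IntegrableOn (fun s => N s ξ) (Ioc 0 t))
    (h : ∀ t, 0 ≤ t → ∀ᵐ ξ, D t ξ = ∫ s in Ioc 0 t, (-((ν * ‖ξ‖ ^ 2) • D s ξ) + N s ξ))
    {t : ℝ} (ht : 0 ≤ t) :
    ∀ᵐ ξ, D t ξ = duh (ν * ‖ξ‖ ^ 2) 0 (fun s => N s ξ) t := by
  have hm : Measurable fun q : ℝ × R3 =>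
      ∫ s in Ioc 0 q.1, (-((ν * ‖q.2‖ ^ 2) • D s q.2) + N s q.2) := by
    refine measurable_setIntegral_Ioc
      (f := fun (q : ℝ × R3) s => -((ν * ‖q.2‖ ^ 2) • D s q.2) + N s q.2) measurable_fst ?_
    have h1 : Measurable fun q : (ℝ × R3) × ℝ => (q.2, q.1.2) := by fun_prop
    have h2 : Measurable fun q : (ℝ × R3) × ℝ => ν * ‖q.1.2‖ ^ 2 := by fun_prop
    have h3 : Measurable fun q : (ℝ × R3) × ℝ => D q.2 q.1.2 := hDm.comp h1
    have h4 : Measurable fun q : (ℝ × R3) × ℝ => N q.2 q.1.2 := hNm.comp h1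
    exact (h2.smul h3).neg.add h4
  have hset : MeasurableSet {q : ℝ × R3 | D q.1 q.2 =
      ∫ s in Ioc 0 q.1, (-((ν * ‖q.2‖ ^ 2) • D s q.2) + N s q.2)} :=
    measurableSet_eq_fun hDm hm
  filter_upwards [h t ht, (hDi t).prod_left_ae, hNi t, ae_comm_Ioc
    (p := fun s ξ => D s ξ = ∫ r in Ioc 0 s, (-((ν * ‖ξ‖ ^ 2) • D r ξ) + N r ξ)) hset t h]
    with ξ h1 h2 h3 h4
  have h2' : IntegrableOn (fun s => D s ξ) (Ioc 0 t) := h2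
  rw [h1]
  exact eq_duh_of_integral_eq h2' h3 h4

section

variable {ν a σ : ℝ} {U W : ℝ → R3 → C3}

/-- The difference of two solutions solves the heat equation with zero initial value, forced by the
difference of the quadratic terms. -/
theorem enorm_sub_le_duhMajorant (hν : 0 < ν) (ha : 0 < a) (hσ : 1 < σ)
    (hUm : Measurable (Function.uncurry U)) (hWm : Measurable (Function.uncurry W))
    (hUz : ∀ t, zInt (-1) a σ (U t) < ∞) (hWz : ∀ t, zInt (-1) a σ (W t) < ∞)
    (hUB : ∀ T, ∃ M < ∞, ∀ t ∈ Icc 0 T, zInt (-1) a σ (U t) ≤ M)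
    (hWB : ∀ T, ∃ M < ∞, ∀ t ∈ Icc 0 T, zInt (-1) a σ (W t) ≤ M)
    (hU1 : ∫⁻ t in Ioi 0, zInt 1 a σ (U t) < ∞) (hW1 : ∫⁻ t in Ioi 0, zInt 1 a σ (W t) < ∞)
    (hU : ∀ t, 0 ≤ t → ∀ᵐ ξ, U t ξ = U 0 ξ + ∫ s in Ioc 0 t, forcing ν (U s) ξ)
    (hW : ∀ t, 0 ≤ t → ∀ᵐ ξ, W t ξ = W 0 ξ + ∫ s in Ioc 0 t, forcing ν (W s) ξ)
    (h0 : U 0 =ᵐ[volume] W 0) {t : ℝ} (ht : 0 ≤ t) :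
    ∀ᵐ ξ, ‖(U t - W t) ξ‖ₑ ≤ duhMajorant (ν * ‖ξ‖ ^ 2) 0
      (fun s => nlinMaj (U s - W s) (U s) ξ + nlinMaj (W s) (U s - W s) ξ) t := by
  have hDz : ∀ {V : ℝ → R3 → C3}, (∀ T, ∃ M < ∞, ∀ t ∈ Icc 0 T, zInt (-1) a σ (V t) ≤ M) →
      ∀ T, ∫⁻ s in Ioc 0 T, zInt (-1) a σ (V s) < ∞ := fun {V} hV T => by
    obtain ⟨M, hM, hle⟩ := hV T
    refine (setLIntegral_mono' (g := fun _ => M) measurableSet_Ioc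
      fun s hs => hle s (Ioc_subset_Icc_self hs)).trans_lt ?_
    rw [setLIntegral_const, Real.volume_Ioc]
    finiteness
  have hFz : ∀ {V : ℝ → R3 → C3}, Measurable (Function.uncurry V) →
      (∀ T, ∃ M < ∞, ∀ t ∈ Icc 0 T, zInt (-1) a σ (V t) ≤ M) →
      ∫⁻ t in Ioi 0, zInt 1 a σ (V t) < ∞ →
      ∀ T, ∫⁻ s in Ioc 0 T, zInt (-1) a σ (forcing ν (V s)) < ∞ := fun {V} hVm hVB hV1 T => by
    obtain ⟨M, hM, h⟩ := hVB T
    exact setLIntegral_zInt_forcing_lt_top hν.le ha hσ hVm measurableSet_Ioc hM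
      (fun t ht => h t (Ioc_subset_Icc_self ht))
      ((lintegral_mono_set Ioc_subset_Ioi_self).trans_lt hV1)
  have hUf := fun T => integrable_uncurry_of_zInt ha hσ (measurable_forcing ν hUm)
    (hFz hUm hUB hU1 T)
  have hWf := fun T => integrable_uncurry_of_zInt ha hσ (measurable_forcing ν hWm)
    (hFz hWm hWB hW1 T)
  have hUi := fun T => integrable_uncurry_of_zInt ha hσ hUm (hDz hUB T)
  have hWi := fun T => integrable_uncurry_of_zInt ha hσ hWm (hDz hWB T)
  obtain ⟨D, hD⟩ : ∃ D : ℝ → R3 → C3, ∀ s, U s - W s = D s := ⟨_, fun _ => rfl⟩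
  obtain ⟨N, hN⟩ : ∃ N : ℝ → R3 → C3, ∀ s ξ, nlin (U s) (U s) ξ - nlin (W s) (W s) ξ = N s ξ :=
    ⟨_, fun _ _ => rfl⟩
  have hDm : Measurable (Function.uncurry D) := by
    convert! hUm.sub hWm using 1
    exact funext fun q => (congrFun (hD q.1) q.2).symm
  have hNm : Measurable (Function.uncurry N) := by
    convert! (measurable_nlin hUm hUm).sub (measurable_nlin hWm hWm) using 1
    exact funext fun q => (hN q.1 q.2).symm
  have hDi : ∀ T, Integrable (Function.uncurry D) ((volume.restrict (Ioc 0 T)).prod volume) := by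
    intro T
    convert! (hUi T).sub (hWi T) using 1
    exact funext fun q => (congrFun (hD q.1) q.2).symm
  have hfD : ∀ s ξ, forcing ν (U s) ξ - forcing ν (W s) ξ =
      -((ν * ‖ξ‖ ^ 2) • D s ξ) + N s ξ := fun s ξ => by
    rw [← hN, ← hD, forcing, forcing, Pi.sub_apply, smul_sub]
    abel
  obtain ⟨F, hF⟩ : ∃ F : ℝ → R3 → C3, ∀ s, forcing ν (U s) = F s := ⟨_, fun _ => rfl⟩
  obtain ⟨G, hG⟩ : ∃ G : ℝ → R3 → C3, ∀ s, forcing ν (W s) = G s := ⟨_, fun _ => rfl⟩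
  simp only [hF, hG] at hUf hWf hfD hU hW
  -- The forcing N is recovered as the difference of the full time derivatives plus ν|ξ|²D, all
  -- integrable in time at almost every fixed frequency.
  have hNi : ∀ T, ∀ᵐ ξ, IntegrableOn (fun s => N s ξ) (Ioc 0 T) := by
    intro T
    filter_upwards [(hUf T).prod_left_ae, (hWf T).prod_left_ae, (hDi T).prod_left_ae]
      with ξ h1 h2 h3
    have h1' : IntegrableOn (fun s => F s ξ) (Ioc 0 T) := h1
    have h2' : IntegrableOn (fun s => G s ξ) (Ioc 0 T) := h2
    have h3' : IntegrableOn (fun s => D s ξ) (Ioc 0 T) := h3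
    have h4 : (fun s => N s ξ) = fun s => (F s ξ - G s ξ) + (ν * ‖ξ‖ ^ 2) • D s ξ :=
      funext fun s => by rw [hfD]; abel
    rw [h4]
    exact (h1'.sub h2').add (h3'.fun_smul _)
  have heq : ∀ t, 0 ≤ t → ∀ᵐ ξ, D t ξ = ∫ s in Ioc 0 t, (-((ν * ‖ξ‖ ^ 2) • D s ξ) + N s ξ) := by
    intro t ht
    filter_upwards [hU t ht, hW t ht, h0, (hUf t).prod_left_ae, (hWf t).prod_left_ae]
      with ξ h1 h2 h3 h4 h5
    have h4' : IntegrableOn (fun s => F s ξ) (Ioc 0 t) := h4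
    have h5' : IntegrableOn (fun s => G s ξ) (Ioc 0 t) := h5
    simp only [← hfD]
    rw [integral_sub h4' h5', ← hD, Pi.sub_apply, h1, h2, h3]
    abel
  have hUint := fun t =>
    integrable_of_zInt ha hσ hUm.of_uncurry_left.aestronglyMeasurable (hUz t)
  have hWint := fun t =>
    integrable_of_zInt ha hσ hWm.of_uncurry_left.aestronglyMeasurable (hWz t)
  have hset : MeasurableSet {q : ℝ × R3 | ‖N q.1 q.2‖ₑ ≤
      nlinMaj (D q.1) (U q.1) q.2 + nlinMaj (W q.1) (D q.1) q.2} :=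
    measurableSet_le hNm.enorm ((measurable_nlinMaj hDm hUm).add (measurable_nlinMaj hWm hDm))
  have hle : ∀ s, 0 ≤ s → ∀ᵐ ξ, ‖N s ξ‖ₑ ≤
      nlinMaj (D s) (U s) ξ + nlinMaj (W s) (D s) ξ := fun s _ => by
    filter_upwards [enorm_nlin_sub_nlin_le (hUint s) (hWint s)] with ξ h1
    rwa [hN, hD] at h1
  filter_upwards [ae_eq_duh hDm hNm hDi hNi heq ht, ae_comm_Ioc
    (p := fun s ξ => ‖N s ξ‖ₑ ≤ nlinMaj (D s) (U s) ξ + nlinMaj (W s) (D s) ξ) hset t hle]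
    with ξ h1 h2
  rw [hD, h1]
  simp only [hD]
  refine (enorm_duh_le _ _ _ _).trans (duhMajorant_mono (by simp) h2)

/-- With ε small, the terms containing the Z¹ norm of the difference are absorbed by the
dissipation. What remains is the Z⁻¹ norm of the difference times an integrable weight, so Gronwall
applies to solutions of any size. -/
theorem zInt_sub_eq_zero (hν : 0 < ν) (ha : 0 < a) (hσ : 1 < σ)
    (hUm : Measurable (Function.uncurry U)) (hWm : Measurable (Function.uncurry W))
    (hUB : ∀ T, ∃ M < ∞, ∀ t ∈ Icc 0 T, zInt (-1) a σ (U t) ≤ M)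
    (hWB : ∀ T, ∃ M < ∞, ∀ t ∈ Icc 0 T, zInt (-1) a σ (W t) ≤ M)
    (hU1 : ∫⁻ t in Ioi 0, zInt 1 a σ (U t) < ∞) (hW1 : ∫⁻ t in Ioi 0, zInt 1 a σ (W t) < ∞)
    (hmaj : ∀ t, 0 ≤ t → ∀ᵐ ξ, ‖(U t - W t) ξ‖ₑ ≤ duhMajorant (ν * ‖ξ‖ ^ 2) 0
      (fun s => nlinMaj (U s - W s) (U s) ξ + nlinMaj (W s) (U s - W s) ξ) t)
    {t : ℝ} (ht : 0 ≤ t) : zInt (-1) a σ (U t - W t) = 0 := by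
  have hle : ∀ (ρ : ℝ) (s : ℝ), zInt ρ a σ (U s - W s) ≤ zInt ρ a σ (U s) + zInt ρ a σ (W s) :=
    fun ρ s => by
      rw [sub_eq_add_neg]
      refine (zInt_add_le hUm.of_uncurry_left.aestronglyMeasurable).trans ?_
      rw [zInt_neg]
  obtain ⟨D, hD⟩ : ∃ D : ℝ → R3 → C3, ∀ s, U s - W s = D s := ⟨_, fun _ => rfl⟩
  have hDm : Measurable (Function.uncurry D) := by
    convert! hUm.sub hWm using 1
    exact funext fun q => (congrFun (hD q.1) q.2).symm
  simp only [hD] at hmaj hle ⊢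
  obtain ⟨A, hA, hUA⟩ := hUB t
  obtain ⟨B, hB, hWB⟩ := hWB t
  lift A to NNReal using hA.ne
  lift B to NNReal using hB.ne
  -- A and B bound the two solutions in Z⁻¹ on [0, t]. The added 1 in the witness keeps the
  -- denominator positive.
  obtain ⟨ε, hε, hεν⟩ : ∃ ε : ℝ, 0 < ε ∧ fourConst * (ε * (A + B)) ≤ ν := by
    have h1 : 0 < fourConst * (A + B + 1) := mul_pos fourConst_pos (by positivity)
    refine ⟨ν / (fourConst * (A + B + 1)), div_pos hν h1, ?_⟩
    have h2 : fourConst * (ν / (fourConst * (A + B + 1)) * (A + B)) =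
        ν * ((fourConst * (A + B)) / (fourConst * (A + B + 1))) := by ring
    rw [h2]
    refine mul_le_of_le_one_right hν.le ((div_le_one h1).2 ?_)
    exact mul_le_mul_of_nonneg_left (by linarith) fourConst_pos.le
  obtain ⟨K, hK, hKtop⟩ : ∃ K, ENNReal.ofReal fourConst * ENNReal.ofReal ε⁻¹ = K ∧ K ≠ ∞ :=
    ⟨_, rfl, by finiteness⟩
  have hnl : ∀ s ∈ Ioc 0 t,
      ∫⁻ ξ, wt (-1) a σ ξ * (nlinMaj (D s) (U s) ξ + nlinMaj (W s) (D s) ξ) ≤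
      ENNReal.ofReal ν * zInt 1 a σ (D s) +
        zInt (-1) a σ (D s) * (K * (zInt 1 a σ (U s) + zInt 1 a σ (W s))) := by
    intro s hs
    have hDs : Measurable (D s) := hDm.of_uncurry_left
    have hUs : Measurable (U s) := hUm.of_uncurry_left
    have hWs : Measurable (W s) := hWm.of_uncurry_left
    have h1 := lintegral_nlinMaj_le ha hσ hε hDs hUs
    -- The difference now sits in the second slot, so ε⁻¹ is used to place ε in front of its Z¹ norm
    -- again.
    have h2 := lintegral_nlinMaj_le ha hσ (inv_pos.2 hε) hWs hDs
    rw [inv_inv] at h2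
    have hm : Measurable fun ξ => wt (-1) a σ ξ * nlinMaj (D s) (U s) ξ :=
      (measurable_wt _ _ _).mul (measurable_nlinMaj hDm hUm).of_uncurry_left
    simp only [mul_add (wt (-1) a σ _)]
    rw [lintegral_add_left hm]
    refine (add_le_add h1 h2).trans ?_
    have hs' := Ioc_subset_Icc_self hs
    calc _ ≤ ENNReal.ofReal fourConst *
          (ENNReal.ofReal ε * (zInt 1 a σ (D s) * A) +
            ENNReal.ofReal ε⁻¹ * (zInt (-1) a σ (D s) * zInt 1 a σ (U s))) +
          ENNReal.ofReal fourConst *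
          (ENNReal.ofReal ε⁻¹ * (zInt 1 a σ (W s) * zInt (-1) a σ (D s)) +
            ENNReal.ofReal ε * (B * zInt 1 a σ (D s))) := by
          gcongr
          · exact hUA s hs'
          · exact hWB s hs'
      _ = (ENNReal.ofReal fourConst * (ENNReal.ofReal ε * (A + B))) * zInt 1 a σ (D s) +
          zInt (-1) a σ (D s) * (K * (zInt 1 a σ (U s) + zInt 1 a σ (W s))) := by
          rw [← hK]
          ring
      _ ≤ _ := by
          gcongr
          rw [← ENNReal.ofReal_coe_nnreal, ← ENNReal.ofReal_coe_nnreal (p := B),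
            ← ENNReal.ofReal_add A.coe_nonneg B.coe_nonneg, ← ENNReal.ofReal_mul hε.le,
            ← ENNReal.ofReal_mul fourConst_pos.le]
          exact ENNReal.ofReal_le_ofReal hεν
  have hfin : ∀ {V : ℝ → R3 → C3}, ∫⁻ t in Ioi 0, zInt 1 a σ (V t) < ∞ →
      ∀ s, ∫⁻ r in Ioc 0 s, zInt 1 a σ (V r) < ∞ := fun hV s =>
    (lintegral_mono_set Ioc_subset_Ioi_self).trans_lt hV
  have hsum : ∀ s, ∫⁻ r in Ioc 0 s, (zInt 1 a σ (U r) + zInt 1 a σ (W r)) < ∞ := fun s => by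
    rw [lintegral_add_left (measurable_zInt 1 a σ hUm)]
    exact ENNReal.add_lt_top.2 ⟨hfin hU1 s, hfin hW1 s⟩
  refine eq_zero_of_le_setLIntegral (T := t) (d := fun s => zInt (-1) a σ (D s))
    (b := fun s => K * (zInt 1 a σ (U s) + zInt 1 a σ (W s))) (M := A + B) (by finiteness)
    (fun s hs => (hle _ _).trans (add_le_add (hUA s hs) (hWB s hs))) ?_ ?_ t ⟨ht, le_rfl⟩
  · rw [lintegral_const_mul' _ _ hKtop]
    exact ENNReal.mul_ne_top hKtop (hsum t).ne
  · intro s hs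
    have h1 := zInt_add_integral_le hν (a := a) (σ := σ) (V := D) (y := fun _ => 0)
      (n := fun s ξ => nlinMaj (D s) (U s) ξ + nlinMaj (W s) (D s) ξ) measurable_const
      ((measurable_nlinMaj hDm hUm).add (measurable_nlinMaj hWm hDm)) hmaj hs.1
    have h2 : ∫⁻ r in Ioc 0 s,
        ∫⁻ ξ, wt (-1) a σ ξ * (nlinMaj (D r) (U r) ξ + nlinMaj (W r) (D r) ξ) ≤
        ENNReal.ofReal ν * (∫⁻ r in Ioc 0 s, zInt 1 a σ (D r)) +
        ∫⁻ r in Ioc 0 s, zInt (-1) a σ (D r) * (K * (zInt 1 a σ (U r) + zInt 1 a σ (W r))) := by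
      rw [← lintegral_const_mul' _ _ ENNReal.ofReal_ne_top,
        ← lintegral_add_left ((measurable_zInt 1 a σ hDm).const_mul _)]
      exact setLIntegral_mono' measurableSet_Ioc fun r hr => hnl r ⟨hr.1, hr.2.trans hs.2⟩
    -- The dissipation of the difference occurs on both sides and may be cancelled because it is
    -- finite.
    have h3 : ENNReal.ofReal ν * (∫⁻ r in Ioc 0 s, zInt 1 a σ (D r)) ≠ ∞ :=
      ENNReal.mul_ne_top ENNReal.ofReal_ne_top
        ((lintegral_mono fun r => hle 1 r).trans_lt (hsum s)).ne
    simp only [mul_zero, lintegral_zero, zero_add] at h1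
    have h4 := h1.trans h2
    rw [add_comm] at h4
    exact (ENNReal.add_le_add_iff_left h3).1 h4

end

/-- Uniqueness of solutions in `C(ℝ⁺, Z⁻¹) ∩ L¹(ℝ⁺, Z¹)`. -/
theorem IsNSESolution.unique {ν a σ : ℝ} (hν : 0 < ν) (ha : 0 < a) (hσ : 1 < σ)
    {u₀ : 𝓢'(R3, C3)} {u w : ℝ → 𝓢'(R3, C3)}
    (hu : IsNSESolution ν u₀ u) (huC : MemCZ (-1) a σ u) (huL : MemL1Z 1 a σ u)
    (hw : IsNSESolution ν u₀ w) (hwC : MemCZ (-1) a σ w) (hwL : MemL1Z 1 a σ w)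
    {t : ℝ} (ht : 0 ≤ t) : w t = u t := by
  -- Every solution in the class satisfies the integral equation, whatever its pressure, so both
  -- solutions can be compared on the Fourier side.
  have hmild : ∀ {v : ℝ → 𝓢'(R3, C3)}, IsNSESolution ν u₀ v → MemCZ (-1) a σ v →
      MemL1Z 1 a σ v → ∃ V : ℝ → R3 → C3, Measurable (Function.uncurry V) ∧
      (∀ t, 0 ≤ t → IsRepresentedBy (fourierDist (v t)) (V t)) ∧
      (∀ t, zInt (-1) a σ (V t) < ∞) ∧
      (∀ T, ∃ M < ∞, ∀ t ∈ Icc 0 T, zInt (-1) a σ (V t) ≤ M) ∧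
      ∫⁻ t in Ioi 0, zInt 1 a σ (V t) < ∞ ∧
      ∀ t, 0 ≤ t → ∀ᵐ ξ, V t ξ = V 0 ξ + ∫ s in Ioc 0 t, forcing ν (V s) ξ := by
    intro v hv hvC hvL
    obtain ⟨V, hVm, hVr, hVl, hVz, hVc, hV1⟩ := exists_fourier_version ha hσ hvC hvL hv.divFree
    obtain ⟨f, p, hf, hsol⟩ := hv.momentum
    refine ⟨V, hVm, hVr, hVz, exists_zInt_bound hVm hVz hVc, hV1, fun t ht => ?_⟩
    refine integral_eq_of_solvesMomentum hν ha hσ hVm hVl hVz hVc hV1 hsol (fun s hs => ?_) ht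
    exact (hf s hs.le).ae_eq (isRepresentedBy_synth
      (integrable_of_zInt ha hσ hVm.of_uncurry_left.aestronglyMeasurable (hVz s)) (hVr s hs.le))
  obtain ⟨U, hUm, hUr, hUz, hUB, hU1, hU⟩ := hmild hu huC huL
  obtain ⟨W, hWm, hWr, hWz, hWB, hW1, hW⟩ := hmild hw hwC hwL
  have h0 : U 0 =ᵐ[volume] W 0 := by
    have h1 := hUr 0 le_rfl
    have h2 := hWr 0 le_rfl
    rw [hu.initial] at h1
    rw [hw.initial] at h2
    exact h1.ae_eq h2
  have h1 := zInt_sub_eq_zero hν ha hσ hUm hWm hUB hWB hU1 hW1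
    (fun t ht => enorm_sub_le_duhMajorant hν ha hσ hUm hWm hUz hWz hUB hWB hU1 hW1 hU hW h0 ht) ht
  have hUt : Measurable (U t) := hUm.of_uncurry_left
  have hWt : Measurable (W t) := hWm.of_uncurry_left
  have h2 := ae_eq_zero_of_zInt_eq_zero (hUt.sub hWt).aestronglyMeasurable h1
  refine eq_of_fourierDist_rep (hWr t ht) (hUr t ht) (h2.mono fun ξ hξ => ?_)
  exact (sub_eq_zero.1 hξ).symm

end LeiLinGevrey

theorem theorem3p2 (ν a σ : ℝ) (hν : 0 < ν) (ha : 0 < a) (hσ : 1 < σ)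
    (u₀ : 𝓢'(LeiLinGevrey.R3, LeiLinGevrey.C3))
    (hreal : LeiLinGevrey.IsRealDist u₀) (hdiv : LeiLinGevrey.IsDivFree u₀)
    (hmem : LeiLinGevrey.MemZ (-1) a σ u₀)
    (hsmall : LeiLinGevrey.zNorm (-1) a σ u₀ < ENNReal.ofReal ν) :
    ∃ u : ℝ → 𝓢'(LeiLinGevrey.R3, LeiLinGevrey.C3),
      LeiLinGevrey.MemCZ (-1) a σ u ∧ LeiLinGevrey.MemL1Z 1 a σ u ∧
      LeiLinGevrey.IsNSESolution ν u₀ u ∧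
      (∀ t, 0 ≤ t →
        LeiLinGevrey.zNorm (-1) a σ (u t)
            + (ENNReal.ofReal ν - LeiLinGevrey.zNorm (-1) a σ u₀) / 2
              * ∫⁻ τ in Icc 0 t, LeiLinGevrey.zNorm (-1) a σ (Δ (u τ))
          ≤ LeiLinGevrey.zNorm (-1) a σ u₀) ∧
      ∀ w : ℝ → 𝓢'(LeiLinGevrey.R3, LeiLinGevrey.C3),
        LeiLinGevrey.MemCZ (-1) a σ w → LeiLinGevrey.MemL1Z 1 a σ w →
        LeiLinGevrey.IsNSESolution ν u₀ w → ∀ t, 0 ≤ t → w t = u t := by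
  obtain ⟨u, huC, huL, hu, henergy⟩ :=
    LeiLinGevrey.exists_solution hν ha hσ hreal hdiv hmem hsmall
  exact ⟨u, huC, huL, hu, henergy, fun w hwC hwL hw t ht => hu.unique hν ha hσ huC huL hw hwC hwL ht⟩
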